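/- Let $N\ge 2$ be an even integer and $\kappa=(-1)^{1+N/2}$. Let $p(t;x)=\frac1{2\pi}\int_{-\infty}^{\infty}e^{-i\mu x}e^{\kappa t(-i\mu)^N}\,d\mu$ be the elementary solution of $\partial u/\partial t=\kappa\,\partial^N u/\partial x^N$, and let $X$ be the pseudo-process started at $0$ and driven by the (signed) kernel $p$: for fixed $n$ and a bounded Borel function $F$ of $k$ observations, $$\mathbb E\big[F(X(1/2^n),\dots,X(k/2^n))\big]=\int_{\mathbb R^k}F(x_1,\dots,x_k)\prod_{j=1}^k p(1/2^n;x_{j-1}-x_j)\,dx_1\cdots dx_k,\qquad x_0=0 .$$ Put $X_n(t)=X(k/2^n)$ for $t\in[k/2^n,(k+1)/2^n)$, $k\ge0$, and $T_n(t)=\int_0^t 1_{[0,\infty)}(X_n(u))\,du$. For $\lambda,\nu>0$ and $\mu\in\mathbb R$ put $$E_n(\lambda,\mu,\nu)=\sum_{k=0}^\infty\mathbb E\Big[\int_{k/2^n}^{(k+1)/2^n}e^{-\lambda t+i\mu X_n(t)-\nu T_n(t)}\,dt\Big].$$ A real function $f(t,s,x)$, $0<s<t$, $x\in\mathbb R$,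 is called a joint density $\mathbb P\{T(t)\in ds,X(t)\in dx\}/(ds\,dx)$ of the couple $(T(t),X(t))$, where $T(t)$ is the sojourn time of $X$ in $[0,\infty)$ up to time $t$, if $e^{-\lambda t}f$ is integrable on $\{0<s<t,\ x\in\mathbb R\}$ for every $\lambda>0$ and if, for all $\lambda,\nu>0$ and $\mu\in\mathbb R$, the series $E_n(\lambda,\mu,\nu)$ converges absolutely for every $n$ and $$\lim_{n\to\infty}E_n(\lambda,\mu,\nu)=\int_0^\infty e^{-\lambda t}\int_0^t\int_{-\infty}^{\infty}e^{i\mu x-\nu s}f(t,s,x)\,dx\,ds\,dt .$$ Let $\theta_1,\dots,\theta_N$ be the $N$-th roots of $\kappa$, $J=\{i:\Re\theta_i>0\}$, $K=\{i:\Re\theta_i<0\}$, $$A_j=\prod_{i\in J\setminus\{j\}}\frac{\theta_i}{\theta_i-\theta_j},\quad B_k=\prod_{i\in K\setminus\{k\}}\frac{\theta_i}{\theta_i-\theta_k},\quad \alpha_m=\sum_{j\in J}A_j\theta_j^m\ (m\in\mathbb Z),\quad E_{a,b}(z)=\sum_{r=0}^\infty\frac{z^r}{\Gamma(ar+b)},$$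 $$\mathcal K_m(z)=e^{-i\frac{\#K-m-1}{N}\pi}\sum_{k\in K}B_k\theta_k^{m+1}e^{-\theta_ke^{i\pi/N}z}-e^{i\frac{\#K-m-1}{N}\pi}\sum_{k\in K}B_k\theta_k^{m+1}e^{-\theta_ke^{-i\pi/N}z}.$$ **Theorem.** The couple $(T(t),X(t))$ has a joint density $f$ that is continuous on $\{(t,s,x):0<s<t,\ x\in\mathbb R\}$; every joint density agrees with $f$ almost everywhere there; and for all $x\le 0$ and $0<s<t$, $$f(t,s,x)=-\frac{Ni}{2\pi}\sum_{m=0}^{\#K}\alpha_{-m}\,s^{\frac{m-\#K}{N}}\int_0^\infty\xi^{m+\#J}e^{-(t-s)\xi^N}\,\mathcal K_m(x\xi)\,E_{1,\frac{m+\#J}{N}}(-s\xi^N)\,d\xi ,$$ where all the integrals converge absolutely. -/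

import Mathlib

open MeasureTheory Filter Topology

noncomputable section

namespace PseudoProcess

/-! ### Roots and coefficients -/

/-- The sign of the heat-type equation `∂u/∂t = κ ∂ᴺu/∂xᴺ`, for even `N`:
`κ = (-1)^(1 + N/2)`. -/
def kappa (N : ℕ) : ℝ := (-1) ^ (1 + N / 2)

/-- The `N`-th roots of `κ` with positive real part (the roots `θ_j`, `j ∈ J`). -/
def rootsJ (N : ℕ) : Finset ℂ :=
  (Polynomial.nthRootsFinset N (kappa N : ℂ)).filter fun θ => 0 < θ.re

/-- The `N`-th roots of `κ` with negative real part (the roots `θ_k`, `k ∈ K`). -/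
def rootsK (N : ℕ) : Finset ℂ :=
  (Polynomial.nthRootsFinset N (kappa N : ℂ)).filter fun θ => θ.re < 0

/-- `A_j = ∏_{i ∈ J \ {j}} θ_i / (θ_i - θ_j)`, indexed by the root `θ = θ_j`. -/
def coeffA (N : ℕ) (θ : ℂ) : ℂ := ∏ η ∈ (rootsJ N).erase θ, η / (η - θ)

/-- `B_k = ∏_{i ∈ K \ {k}} θ_i / (θ_i - θ_k)`, indexed by the root `θ = θ_k`. -/
def coeffB (N : ℕ) (θ : ℂ) : ℂ := ∏ η ∈ (rootsK N).erase θ, η / (η - θ)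

/-- `α_m = ∑_{j ∈ J} A_j θ_j ^ m`, for an integer `m`. -/
def alpha (N : ℕ) (m : ℤ) : ℂ := ∑ θ ∈ rootsJ N, coeffA N θ * θ ^ m

/-- The Mittag-Leffler function `E_{a,b}(z) = ∑_{r ≥ 0} z ^ r / Γ(a r + b)`. -/
def mittagLeffler (a b : ℝ) (z : ℂ) : ℂ := ∑' r : ℕ, z ^ r / (Real.Gamma (a * r + b) : ℂ)

/-- The function
`K_m(z) = e^{-i (#K-m-1)π/N} ∑_{k ∈ K} B_k θ_k^{m+1} e^{-θ_k e^{iπ/N} z}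
  - e^{i (#K-m-1)π/N} ∑_{k ∈ K} B_k θ_k^{m+1} e^{-θ_k e^{-iπ/N} z}`. -/
def kernelK (N m : ℕ) (z : ℝ) : ℂ :=
  Complex.exp (-Complex.I * ((((rootsK N).card : ℂ) - m - 1) / N) * Real.pi) *
      ∑ θ ∈ rootsK N, coeffB N θ * θ ^ (m + 1) *
        Complex.exp (-θ * Complex.exp (Complex.I * (Real.pi / N)) * z)
    - Complex.exp (Complex.I * ((((rootsK N).card : ℂ) - m - 1) / N) * Real.pi) *
      ∑ θ ∈ rootsK N, coeffB N θ * θ ^ (m + 1) *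
        Complex.exp (-θ * Complex.exp (-Complex.I * (Real.pi / N)) * z)

/-- The integrand `ξ^{m+#J} e^{-(t-s) ξᴺ} K_m(xξ) E_{1,(m+#J)/N}(-s ξᴺ)`. -/
def densityIntegrand (N m : ℕ) (t s x ξ : ℝ) : ℂ :=
  (ξ : ℂ) ^ (m + (rootsJ N).card) * (Real.exp (-(t - s) * ξ ^ N) : ℂ) * kernelK N m (x * ξ) *
    mittagLeffler 1 (((m : ℝ) + (rootsJ N).card) / N) ((-s * ξ ^ N : ℝ) : ℂ)

/-! ### The pseudo-process on dyadic times, started at `0` -/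

/-- The elementary solution `p(t; x)` of `∂u/∂t = κ ∂ᴺu/∂xᴺ`, given by Fourier inversion of
`∫ e^{iμx} p(t; x) dx = e^{κ t (-iμ)ᴺ}`. -/
def heatKernel (N : ℕ) (t x : ℝ) : ℝ :=
  (1 / (2 * Real.pi)) *
    (∫ μ : ℝ, Complex.exp ((kappa N : ℂ) * t * (-Complex.I * μ) ^ N) *
      Complex.exp (-Complex.I * μ * x)).re

/-- The discrete path through `0` at index `0` and the observations `x₁, …, x_k` at the
indices `1, …, k` (the values after `k` are immaterial). -/
def discretePath {k : ℕ} (x : Fin k → ℝ) : ℕ → ℝ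
  | 0 => 0
  | j + 1 => if h : j < k then x ⟨j, h⟩ else 0

/-- The expectation of the tame function `F(X(1/2ⁿ), …, X(k/2ⁿ))`:
`∫ F(x₁, …, x_k) p(1/2ⁿ; x₀ - x₁) ⋯ p(1/2ⁿ; x_{k-1} - x_k) dx₁ ⋯ dx_k` with `x₀ = 0`. -/
def tameExpectation (N n k : ℕ) (F : (Fin k → ℝ) → ℂ) : ℂ :=
  ∫ x : Fin k → ℝ, F x *
    ((∏ j : Fin k, heatKernel N (1 / 2 ^ n) (discretePath x j - discretePath x (j + 1)) : ℝ) : ℂ)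

/-- Let `F n k` be a function of the first `k` observations at the times `j/2ⁿ`. The functional
`lim_n ∑_k F n k` is admissible, with pseudo-expectation `e`: each `F n k` is tame (bounded
Borel), for each `n` the series of the expectations of the `F n k` converges absolutely, and
its sum tends to `e` as `n → ∞`. -/
structure HasPseudoExpectation (N : ℕ) (F : (n k : ℕ) → (Fin k → ℝ) → ℂ) (e : ℂ) : Prop where
  measurable : ∀ n k, Measurable (F n k)
  bounded : ∀ n k, ∃ C : ℝ, ∀ x, ‖F n k x‖ ≤ C
  summable : ∀ n, Summable fun k => ‖tameExpectation N n k (F n k)‖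
  tendsto : Tendsto (fun n => ∑' k, tameExpectation N n k (F n k)) atTop (𝓝 e)

/-- The step process `X_n(t) = X(k/2ⁿ)` for `t ∈ [k/2ⁿ, (k+1)/2ⁿ)`. -/
def stepProcess (n : ℕ) (ω : ℕ → ℝ) (t : ℝ) : ℝ := ω ⌊2 ^ n * t⌋₊

/-- The sojourn time `T(t) = ∫₀ᵗ 1_{[0,∞)}(X(u)) du` of a path `X` in `[0, ∞)`. -/
def sojournTime (X : ℝ → ℝ) (t : ℝ) : ℝ :=
  ∫ u in (0 : ℝ)..t, (Set.Ici (0 : ℝ)).indicator (fun _ => (1 : ℝ)) (X u)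

/-- The contribution of the time interval `[k/2ⁿ, (k+1)/2ⁿ)` to the functional
`∫₀^∞ e^{-l t + i μ X_n(t) - ν T_n(t)} dt`; it depends only on the first `k` observations. -/
def transformTerm (l μ ν : ℝ) (n k : ℕ) (x : Fin k → ℝ) : ℂ :=
  ∫ t in ((k : ℝ) / 2 ^ n)..(((k : ℝ) + 1) / 2 ^ n),
    Complex.exp (-(l : ℂ) * t + Complex.I * μ * (stepProcess n (discretePath x) t : ℂ)
      - ν * (sojournTime (stepProcess n (discretePath x)) t : ℂ))

/-- The set of all `(t, s, x)` with `0 < s < t` and `x` real. -/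
def timeDomain : Set (ℝ × ℝ × ℝ) := {p | 0 < p.2.1 ∧ p.2.1 < p.1}

/-- `f t s x` (for `0 < s < t`, `x ∈ ℝ`) is a density `P{T(t) ∈ ds, X(t) ∈ dx}/(ds dx)`: the
three-parameter Laplace-Fourier transform `E[∫₀^∞ e^{-l t + i μ X(t) - ν T(t)} dt]` of the
couple `(T(t), X(t))` exists, for all `l, ν > 0` and real `μ`, and is the (absolutely
convergent) integral `∫₀^∞ e^{-l t} ∫₀ᵗ ∫_ℝ e^{i μ x - ν s} f t s x dx ds dt`. -/
structure IsJointDensity (N : ℕ) (f : ℝ → ℝ → ℝ → ℝ) : Prop where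
  integrable : ∀ l : ℝ, 0 < l →
    IntegrableOn (fun p : ℝ × ℝ × ℝ => Real.exp (-l * p.1) * f p.1 p.2.1 p.2.2) timeDomain
  transform : ∀ l μ ν : ℝ, 0 < l → 0 < ν →
    HasPseudoExpectation N (transformTerm l μ ν)
      (∫ p in timeDomain,
        Complex.exp (-(l : ℂ) * p.1 + Complex.I * μ * p.2.2 - ν * p.2.1) *
          (f p.1 p.2.1 p.2.2 : ℂ))

end PseudoProcess

end

/-! The proof computes the limit of `E_n` by a Wiener-Hopf argument, inverts the resulting
Laplace-Fourier transform by contour integrals, and evaluates the inverse for `x ≤ 0`.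

Limit. At time step `h = 2⁻ⁿ` put `w = e^{-νh}`, `z = e^{-lh}`. Each term of `E_n` is a combination
of `Q_k^± = E[w^{#{j<k : X_j ≥ 0}} e^{iμX_k}]`, restricted to `X_k ≥ 0` or to `X_k < 0`. One step of
the walk multiplies characters by `e^{-hμᴺ}`, which fixes `Q_{k+1}^+ + Q_{k+1}^-`. The two summands
are Fourier transforms of integrable functions on opposite half-lines, so they are fixed separately
(`IsPlus.eq_zero`). This uses integrability of the kernel but not its positivity, hence Spitzer's
identity survives for the signed kernel (`wienerHopf_unique`, `hasSum_tameExpectation`). The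
generating functions are exponentials of Riemann sums, and as `h → 0` they become exponentials of
Frullani integrals, which `integral_frullani` evaluates by logarithms. With `a = l^{1/N}` and `b =
(l+ν)^{1/N}` the limit is `limitTransform`, that is `1 / (∏ (θa + iμ) ∏ (θb - iμ))`, the products
running over `J`.

Inversion. Each factor `1 / ∏ (θa + c)` is the double Laplace transform of a kernel `q_u(y)` on `u,
y > 0` (`sojournKernel`), obtained from partial fractions in `c` and a contour integral in `ζ`,
where `ζᴺ` plays the role of `l` (`integral_laplace_sojournKernel`). A product of transforms is the
transform of a convolution, so `f(t,s,x) = ∫ q_s(y) q_{t-s}(y-x) dy` is a joint density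
(`isJointDensity_jointDensity`). Bounds on `q` make it continuous, and injectivity of the
Laplace-Fourier transform makes it unique almost everywhere (`IsJointDensity.ae_eq`).

Formula. If `x ≤ 0`, then `y - x` is positive for every `y > 0`, so inserting the contour integral
for `q_{t-s}(y-x)` leaves the full Laplace transform of `q_s` at `θζ`. On the rays of argument
`±π/N` the number `ζᴺ` is real and negative, and there this Laplace transform is a finite sum of
functions `s^{β-1} E_{1,β}(-sξᴺ)` with coefficients `α_{-m}` (`halfLaplace_eq`). The two rays give
the two halves of `kernelK`. -/

noncomputable section

namespace PseudoProcess

/-! ### Uniqueness of integral transforms -/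

section Uniqueness

open BoundedContinuousFunction

/-- A multiplicative, conjugation invariant family of bounded continuous functions that separates
points determines finite measures. -/
theorem measure_ext_of_submonoid {E : Type*} [TopologicalSpace E] [PolishSpace E]
    [MeasurableSpace E] [BorelSpace E] {P P' : Measure E} [IsFiniteMeasure P] [IsFiniteMeasure P']
    (S : Submonoid (E →ᵇ ℂ)) (hstar : ∀ χ ∈ S, star χ ∈ S)
    (hsep : ∀ x y : E, x ≠ y → ∃ χ ∈ S, χ x ≠ χ y)
    (h : ∀ χ ∈ S, ∫ x, χ x ∂P = ∫ x, χ x ∂P') : P = P' := by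
  refine ext_of_forall_mem_subalgebra_integral_eq_of_polish (𝕜 := ℂ)
    (A := StarAlgebra.adjoin ℂ (S : Set (E →ᵇ ℂ))) ?_ ?_
  · intro x y hxy
    obtain ⟨χ, hχ, hne⟩ := hsep x y hxy
    refine ⟨χ, ⟨toContinuousMapStarₐ ℂ χ, ⟨χ, StarAlgebra.subset_adjoin ℂ _ hχ, rfl⟩, rfl⟩, hne⟩
  · intro g hg
    -- Being multiplicative and closed under `star`, `S` spans its star algebra linearly, so
    -- equality of the integrals extends by linearity.
    have hSS : (S : Set (E →ᵇ ℂ)) ∪ star (S : Set (E →ᵇ ℂ)) = S := by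
      refine Set.union_eq_self_of_subset_right fun χ hχ => ?_
      have := hstar _ hχ
      rwa [star_star] at this
    have hg' : g ∈ Submodule.span ℂ (S : Set (E →ᵇ ℂ)) := by
      have h2 := StarAlgebra.adjoin_eq_span (R := ℂ) (S : Set (E →ᵇ ℂ))
      rw [hSS, Submonoid.closure_eq] at h2
      rw [← h2]
      exact hg
    induction hg' using Submodule.span_induction with
    | mem x hx => exact h x hx
    | zero => simp
    | add x y _ _ hx hy =>
      simp only [BoundedContinuousFunction.coe_add, Pi.add_apply]
      rw [integral_add (x.integrable P) (y.integrable P),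
        integral_add (x.integrable P') (y.integrable P')]
      have hxm : x ∈ StarAlgebra.adjoin ℂ (S : Set (E →ᵇ ℂ)) := by
        have h2 := StarAlgebra.adjoin_eq_span (R := ℂ) (S : Set (E →ᵇ ℂ))
        rw [hSS, Submonoid.closure_eq] at h2
        show x ∈ Subalgebra.toSubmodule (StarAlgebra.adjoin ℂ (S : Set (E →ᵇ ℂ))).toSubalgebra
        rw [h2]; assumption
      have hym : y ∈ StarAlgebra.adjoin ℂ (S : Set (E →ᵇ ℂ)) := by
        have h2 := StarAlgebra.adjoin_eq_span (R := ℂ) (S : Set (E →ᵇ ℂ))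
        rw [hSS, Submonoid.closure_eq] at h2
        show y ∈ Subalgebra.toSubmodule (StarAlgebra.adjoin ℂ (S : Set (E →ᵇ ℂ))).toSubalgebra
        rw [h2]; assumption
      rw [hx hxm, hy hym]
    | smul c x _ hx =>
      simp only [BoundedContinuousFunction.coe_smul, smul_eq_mul]
      rw [integral_const_mul, integral_const_mul]
      have hxm : x ∈ StarAlgebra.adjoin ℂ (S : Set (E →ᵇ ℂ)) := by
        have h2 := StarAlgebra.adjoin_eq_span (R := ℂ) (S : Set (E →ᵇ ℂ))
        rw [hSS, Submonoid.closure_eq] at h2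
        show x ∈ Subalgebra.toSubmodule (StarAlgebra.adjoin ℂ (S : Set (E →ᵇ ℂ))).toSubalgebra
        rw [h2]; assumption
      rw [hx hxm]

theorem integrable_bcf_comp_mul {Ω E : Type*} [MeasurableSpace Ω] {m : Measure Ω}
    [TopologicalSpace E] [MeasurableSpace E] [BorelSpace E] {T : Ω → E} (hT : Measurable T) (χ : E →ᵇ ℂ) {g : Ω → ℂ}
    (hg : Integrable g m) : Integrable (fun ω => χ (T ω) * g ω) m :=
  hg.bdd_mul (c := ‖χ‖) (χ.continuous.measurable.comp hT).aestronglyMeasurable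
    (Filter.Eventually.of_forall fun ω => χ.norm_coe_le_norm (T ω))

variable {Ω E : Type*} [MeasurableSpace Ω] {m : Measure Ω} [SigmaFinite m] [TopologicalSpace E]
    [PolishSpace E] [MeasurableSpace E] [BorelSpace E]

/-- The positive and negative parts of `g` are densities of two finite measures whose images under
`T` have the same integrals against `S`, hence coincide; the left inverse `U` carries the equality
back to `Ω`. The detour through `E` is needed because functions such as `e^{-nx}` are bounded on the
half-line only. -/
theorem ae_eq_zero_of_integral_submonoid_real {T : Ω → E} (hT : Measurable T) {U : E → Ω}
    (hU : Measurable U) (hUT : ∀ᵐ ω ∂m, U (T ω) = ω) (S : Submonoid (E →ᵇ ℂ))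
    (hstar : ∀ χ ∈ S, star χ ∈ S) (hsep : ∀ x y : E, x ≠ y → ∃ χ ∈ S, χ x ≠ χ y)
    {g : Ω → ℝ} (hg : Integrable g m)
    (h : ∀ χ ∈ S, ∫ ω, χ (T ω) * (g ω : ℂ) ∂m = 0) : g =ᵐ[m] 0 := by
  have key : ∀ r : Ω → ℝ, Integrable r m → ∀ χ : E →ᵇ ℂ,
      ∫ x, χ x ∂((m.withDensity fun ω => ENNReal.ofReal (r ω)).map T) =
        ∫ ω, χ (T ω) * ((max (r ω) 0 : ℝ) : ℂ) ∂m := by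
    intro r hr χ
    rw [integral_map hT.aemeasurable χ.continuous.measurable.aestronglyMeasurable,
      integral_withDensity_eq_integral_toReal_smul₀ hr.aemeasurable.ennreal_ofReal
        (by simp)]
    refine integral_congr_ae (Filter.Eventually.of_forall fun ω => ?_)
    simp [ENNReal.toReal_ofReal', mul_comm]
  have hfin : ∀ r : Ω → ℝ, Integrable r m →
      IsFiniteMeasure (m.withDensity fun ω => ENNReal.ofReal (r ω)) := fun r hr =>
    isFiniteMeasure_withDensity_ofReal hr.2
  have := hfin g hg
  have := hfin (fun ω => -g ω) hg.neg
  have heq : (m.withDensity fun ω => ENNReal.ofReal (g ω)).map T =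
      (m.withDensity fun ω => ENNReal.ofReal (-g ω)).map T := by
    refine measure_ext_of_submonoid S hstar hsep fun χ hχ => ?_
    rw [key g hg, key (fun ω => -g ω) hg.neg, ← sub_eq_zero, ← integral_sub, ← h χ hχ]
    · refine integral_congr_ae (Filter.Eventually.of_forall fun ω => ?_)
      simp only
      rw [← mul_sub, ← Complex.ofReal_sub]
      congr 2
      rcases le_total (g ω) 0 with h0 | h0
      · rw [max_eq_right h0, max_eq_left (by linarith)]; ring
      · rw [max_eq_left h0, max_eq_right (by linarith)]; ring
    · exact integrable_bcf_comp_mul hT χ hg.pos_part.ofReal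
    · exact integrable_bcf_comp_mul hT χ hg.neg.pos_part.ofReal
  have hback : ∀ d : Ω → ENNReal, ((m.withDensity d).map T).map U = m.withDensity d := by
    intro d
    rw [Measure.map_map hU hT]
    have : (U ∘ T) =ᵐ[m.withDensity d] id :=
      (withDensity_absolutelyContinuous m d).ae_le hUT
    rw [Measure.map_congr this, Measure.map_id]
  have heq2 : (m.withDensity fun ω => ENNReal.ofReal (g ω)) =
      (m.withDensity fun ω => ENNReal.ofReal (-g ω)) := by
    rw [← hback fun ω => ENNReal.ofReal (g ω), heq, hback]
  rw [withDensity_eq_iff_of_sigmaFinite hg.aemeasurable.ennreal_ofReal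
    (g := fun ω => ENNReal.ofReal (-g ω)) hg.aemeasurable.neg.ennreal_ofReal] at heq2
  filter_upwards [heq2] with ω hω
  have hω' : ENNReal.ofReal (g ω) = ENNReal.ofReal (-g ω) := hω
  show g ω = 0
  rcases le_total (g ω) 0 with h0 | h0
  · rw [ENNReal.ofReal_of_nonpos h0] at hω'
    have := ENNReal.ofReal_eq_zero.1 hω'.symm
    linarith
  · rw [ENNReal.ofReal_of_nonpos (p := -g ω) (by linarith)] at hω'
    have := ENNReal.ofReal_eq_zero.1 hω'
    linarith

/-- Since `S` is closed under conjugation, the conjugate of `g` is annihilated too, hence so are the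
real and imaginary parts. -/
theorem ae_eq_zero_of_integral_submonoid {T : Ω → E} (hT : Measurable T) {U : E → Ω}
    (hU : Measurable U) (hUT : ∀ᵐ ω ∂m, U (T ω) = ω) (S : Submonoid (E →ᵇ ℂ))
    (hstar : ∀ χ ∈ S, star χ ∈ S) (hsep : ∀ x y : E, x ≠ y → ∃ χ ∈ S, χ x ≠ χ y)
    {g : Ω → ℂ} (hg : Integrable g m)
    (h : ∀ χ ∈ S, ∫ ω, χ (T ω) * g ω ∂m = 0) : g =ᵐ[m] 0 := by
  have hconj : ∀ χ ∈ S, ∫ ω, χ (T ω) * (starRingEnd ℂ) (g ω) ∂m = 0 := by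
    intro χ hχ
    have h1 := congrArg (starRingEnd ℂ) (h _ (hstar χ hχ))
    rw [← integral_conj, map_zero] at h1
    rw [← h1]
    refine integral_congr_ae (Filter.Eventually.of_forall fun ω => ?_)
    simp
  have hgc : Integrable (fun ω => (starRingEnd ℂ) (g ω)) m :=
    (LinearIsometryEquiv.integrable_comp_iff (Complex.conjLIE)).2 hg
  have hre : (fun ω => (g ω).re) =ᵐ[m] 0 := by
    refine ae_eq_zero_of_integral_submonoid_real hT hU hUT S hstar hsep hg.re fun χ hχ => ?_
    have h2 : ∀ ω, χ (T ω) * ((g ω).re : ℂ) =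
        (1 / 2 : ℂ) * (χ (T ω) * g ω + χ (T ω) * (starRingEnd ℂ) (g ω)) := by
      intro ω
      rw [← mul_add, Complex.add_conj]; push_cast; ring
    simp only [h2]
    rw [integral_const_mul, integral_add (integrable_bcf_comp_mul hT χ hg)
      (integrable_bcf_comp_mul hT χ hgc), h χ hχ, hconj χ hχ]
    simp
  have him : (fun ω => (g ω).im) =ᵐ[m] 0 := by
    refine ae_eq_zero_of_integral_submonoid_real hT hU hUT S hstar hsep hg.im fun χ hχ => ?_
    have h2 : ∀ ω, χ (T ω) * ((g ω).im : ℂ) =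
        (1 / (2 * Complex.I) : ℂ) * (χ (T ω) * g ω - χ (T ω) * (starRingEnd ℂ) (g ω)) := by
      intro ω
      rw [← mul_sub, Complex.sub_conj]
      field_simp
      push_cast; ring
    simp only [h2]
    rw [integral_const_mul, integral_sub (integrable_bcf_comp_mul hT χ hg)
      (integrable_bcf_comp_mul hT χ hgc), h χ hχ, hconj χ hχ]
    simp
  filter_upwards [hre, him] with ω h1 h2
  exact Complex.ext h1 h2

end Uniqueness

/-- The characters `x ↦ e^{iμx}`, `x ∈ ℝ`. -/
def fourierChar (μ : ℝ) : BoundedContinuousFunction ℝ ℂ :=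
  BoundedContinuousFunction.ofNormedAddCommGroup (fun x => Complex.exp (Complex.I * μ * x))
    (by fun_prop) 1 (fun x => by
      rw [show Complex.I * (μ : ℂ) * x = ((μ * x : ℝ) : ℂ) * Complex.I by push_cast; ring,
        Complex.norm_exp_ofReal_mul_I])

/-- The functions `x ↦ e^{-nx}`, `x ≥ 0`. -/
def laplaceChar (n : ℕ) : BoundedContinuousFunction NNReal ℂ :=
  BoundedContinuousFunction.ofNormedAddCommGroup
    (fun x => Complex.exp (-(n : ℂ) * ((x : ℝ) : ℂ))) (by fun_prop) 1 (fun x => by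
      rw [Complex.norm_exp, show (-(n : ℂ) * ((x : ℝ) : ℂ)) = ((-(n * x : ℝ) : ℝ) : ℂ) by
        push_cast; ring, Complex.ofReal_re, Real.exp_le_one_iff]
      have := x.2
      have : (0 : ℝ) ≤ n * x := by positivity
      linarith)

/-- The functions `(t, s, x) ↦ e^{-jt - ks + iμx}`, `t, s ≥ 0`. -/
def laplaceFourierChar (j k : ℕ) (μ : ℝ) :
    BoundedContinuousFunction (NNReal × NNReal × ℝ) ℂ :=
  (laplaceChar j).compContinuous ⟨fun p => p.1, continuous_fst⟩ *
    ((laplaceChar k).compContinuous ⟨fun p => p.2.1, by fun_prop⟩ *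
      (fourierChar μ).compContinuous ⟨fun p => p.2.2, by fun_prop⟩)

theorem fourierChar_apply (μ x : ℝ) : fourierChar μ x = Complex.exp (Complex.I * μ * x) := rfl

theorem laplaceChar_apply (n : ℕ) (x : NNReal) :
    laplaceChar n x = Complex.exp (-(n : ℂ) * ((x : ℝ) : ℂ)) := rfl

theorem laplaceFourierChar_apply (j k : ℕ) (μ : ℝ) (p : NNReal × NNReal × ℝ) :
    laplaceFourierChar j k μ p = laplaceChar j p.1 * (laplaceChar k p.2.1 * fourierChar μ p.2.2) :=
  rfl

theorem exists_fourierChar_ne {x y : ℝ} (h : x ≠ y) : ∃ μ, fourierChar μ x ≠ fourierChar μ y := by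
  by_contra! hc
  refine h ?_
  -- With this frequency the two phases differ by exactly `1`, which is no multiple of `2π`.
  have h2 := hc (1 / (x - y))
  rw [fourierChar_apply, fourierChar_apply, ← sub_eq_zero, sub_eq_zero,
    Complex.exp_eq_exp_iff_exists_int] at h2
  obtain ⟨n, hn⟩ := h2
  have hxy : (x : ℂ) - y ≠ 0 := by
    rw [← Complex.ofReal_sub, Complex.ofReal_ne_zero]; exact sub_ne_zero.2 h
  push_cast at hn
  have h3 : Complex.I * (1 - n * (2 * Real.pi)) = 0 := by
    have : Complex.I * (1 / ((x : ℂ) - y)) * x - Complex.I * (1 / ((x : ℂ) - y)) * y =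
      Complex.I := by field_simp
    linear_combination -this + hn
  have h4 : (1 : ℝ) - n * (2 * Real.pi) = 0 := by
    have := (mul_eq_zero.1 h3).resolve_left Complex.I_ne_zero
    exact_mod_cast this
  have h5 : (n : ℝ) * (2 * Real.pi) = 1 := by linarith
  have h6 := Real.pi_gt_three
  rcases lt_trichotomy n 0 with h7 | h7 | h7
  · have : (n : ℝ) < 0 := by exact_mod_cast h7
    nlinarith
  · subst h7; simp at h5
  · have : (1 : ℝ) ≤ n := by exact_mod_cast h7
    nlinarith

theorem laplaceChar_one_ne {x y : NNReal} (h : x ≠ y) : laplaceChar 1 x ≠ laplaceChar 1 y := by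
  rw [laplaceChar_apply, laplaceChar_apply]
  intro hc
  refine h ?_
  have : Real.exp (-(x : ℝ)) = Real.exp (-(y : ℝ)) := by
    have h1 : Complex.exp ((-(x : ℝ) : ℝ) : ℂ) = Complex.exp ((-(y : ℝ) : ℝ) : ℂ) := by
      push_cast; simpa using hc
    rw [← Complex.ofReal_exp, ← Complex.ofReal_exp] at h1
    exact_mod_cast h1
  have := Real.exp_injective this
  exact NNReal.coe_injective (by linarith)

theorem fourierChar_mul (μ μ' : ℝ) : fourierChar μ * fourierChar μ' = fourierChar (μ + μ') := by
  ext x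
  simp only [BoundedContinuousFunction.coe_mul, Pi.mul_apply, fourierChar_apply]
  rw [← Complex.exp_add]; push_cast; ring_nf

theorem star_fourierChar (μ : ℝ) : star (fourierChar μ) = fourierChar (-μ) := by
  ext x
  simp only [BoundedContinuousFunction.star_apply, fourierChar_apply]
  rw [← starRingEnd_apply, ← Complex.exp_conj]; simp

theorem laplaceChar_mul (n k : ℕ) : laplaceChar n * laplaceChar k = laplaceChar (n + k) := by
  ext x
  simp only [BoundedContinuousFunction.coe_mul, Pi.mul_apply, laplaceChar_apply]
  rw [← Complex.exp_add]; push_cast; ring_nf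

theorem star_laplaceChar (n : ℕ) : star (laplaceChar n) = laplaceChar n := by
  ext x
  simp only [BoundedContinuousFunction.star_apply, laplaceChar_apply]
  rw [← starRingEnd_apply, ← Complex.exp_conj]; simp

/-- An integrable function on `ℝ` with vanishing Fourier transform vanishes a.e. -/
theorem ae_eq_zero_of_fourier {g : ℝ → ℂ} (hg : Integrable g)
    (h : ∀ μ : ℝ, ∫ x : ℝ, Complex.exp (Complex.I * μ * x) * g x = 0) : g =ᵐ[volume] 0 := by
  refine ae_eq_zero_of_integral_submonoid (T := id) measurable_id (U := id) measurable_id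
    (by simp) (S := ⟨⟨Set.range fourierChar, ?_⟩, ⟨0, ?_⟩⟩) ?_ ?_ hg ?_
  · rintro _ _ ⟨μ, rfl⟩ ⟨μ', rfl⟩
    exact ⟨μ + μ', (fourierChar_mul μ μ').symm⟩
  · ext x; simp [fourierChar_apply]
  · rintro _ ⟨μ, rfl⟩
    exact ⟨-μ, (star_fourierChar μ).symm⟩
  · intro x y hxy
    obtain ⟨μ, hμ⟩ := exists_fourierChar_ne hxy
    exact ⟨_, ⟨μ, rfl⟩, hμ⟩
  · rintro _ ⟨μ, rfl⟩
    exact h μ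

/-- An integrable function on `(0, ∞)` with vanishing Laplace transform vanishes a.e. -/
theorem ae_eq_zero_of_laplace {g : ℝ → ℂ} (hg : IntegrableOn g (Set.Ioi 0))
    (h : ∀ n : ℕ, ∫ x in Set.Ioi (0 : ℝ), Complex.exp (-(n : ℂ) * x) * g x = 0) :
    g =ᵐ[volume.restrict (Set.Ioi 0)] 0 := by
  refine ae_eq_zero_of_integral_submonoid (T := Real.toNNReal) (by fun_prop)
    (U := fun x : NNReal => (x : ℝ)) (by fun_prop) ?_
    (S := ⟨⟨Set.range laplaceChar, ?_⟩, ⟨0, ?_⟩⟩) ?_ ?_ hg ?_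
  · filter_upwards [self_mem_ae_restrict measurableSet_Ioi] with x hx
    exact Real.coe_toNNReal x (le_of_lt hx)
  · rintro _ _ ⟨μ, rfl⟩ ⟨μ', rfl⟩
    exact ⟨μ + μ', (laplaceChar_mul μ μ').symm⟩
  · ext x; simp [laplaceChar_apply]
  · rintro _ ⟨μ, rfl⟩
    exact ⟨μ, (star_laplaceChar μ).symm⟩
  · intro x y hxy
    exact ⟨_, ⟨1, rfl⟩, laplaceChar_one_ne hxy⟩
  · rintro _ ⟨n, rfl⟩
    rw [← h n]
    refine setIntegral_congr_fun measurableSet_Ioi fun x hx => ?_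
    simp only [laplaceChar_apply]
    rw [Real.coe_toNNReal x (le_of_lt hx)]

theorem measurableSet_timeDomain : MeasurableSet timeDomain :=
  (measurableSet_lt (f := fun _ : ℝ × ℝ × ℝ => (0 : ℝ)) (g := fun p => p.2.1) (by fun_prop)
    (by fun_prop)).inter (measurableSet_lt (f := fun p : ℝ × ℝ × ℝ => p.2.1) (g := fun p => p.1)
    (by fun_prop) (by fun_prop))

/-- An integrable function on `timeDomain` with vanishing Laplace-Fourier transform vanishes
a.e. -/
theorem ae_eq_zero_of_laplaceFourier {g : ℝ × ℝ × ℝ → ℂ} (hg : IntegrableOn g timeDomain)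
    (h : ∀ (j k : ℕ) (μ : ℝ), ∫ p in timeDomain,
      Complex.exp (-(j : ℂ) * p.1) * (Complex.exp (-(k : ℂ) * p.2.1) *
        Complex.exp (Complex.I * μ * p.2.2)) * g p = 0) :
    g =ᵐ[volume.restrict timeDomain] 0 := by
  refine ae_eq_zero_of_integral_submonoid
    (T := fun p : ℝ × ℝ × ℝ => (Real.toNNReal p.1, Real.toNNReal p.2.1, p.2.2)) (by fun_prop)
    (U := fun p : NNReal × NNReal × ℝ => ((p.1 : ℝ), (p.2.1 : ℝ), p.2.2)) (by fun_prop) ?_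
    (S := ⟨⟨{χ | ∃ j k μ, χ = laplaceFourierChar j k μ}, ?_⟩, ⟨0, 0, 0, ?_⟩⟩) ?_ ?_ hg ?_
  · filter_upwards [self_mem_ae_restrict measurableSet_timeDomain] with p hp
    rw [Real.coe_toNNReal _ (hp.1.trans hp.2).le, Real.coe_toNNReal _ hp.1.le]
  · rintro _ _ ⟨j, k, μ, rfl⟩ ⟨j', k', μ', rfl⟩
    refine ⟨j + j', k + k', μ + μ', ?_⟩
    ext p
    simp only [BoundedContinuousFunction.coe_mul, Pi.mul_apply, laplaceFourierChar_apply,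
      ← laplaceChar_mul, ← fourierChar_mul]
    ring
  · ext p; simp [laplaceFourierChar_apply, laplaceChar_apply, fourierChar_apply]
  · rintro _ ⟨j, k, μ, rfl⟩
    refine ⟨j, k, -μ, ?_⟩
    ext p
    rw [laplaceFourierChar_apply, ← star_fourierChar, ← star_laplaceChar j, ← star_laplaceChar k]
    simp [laplaceFourierChar_apply]
  · intro x y hxy
    by_cases h1 : x.1 = y.1
    · by_cases h2 : x.2.1 = y.2.1
      · have h3 : x.2.2 ≠ y.2.2 := fun h3 => hxy (Prod.ext h1 (Prod.ext h2 h3))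
        obtain ⟨μ, hμ⟩ := exists_fourierChar_ne h3
        exact ⟨_, ⟨0, 0, μ, rfl⟩, by
          simpa [laplaceFourierChar_apply, laplaceChar_apply] using hμ⟩
      · exact ⟨_, ⟨0, 1, 0, rfl⟩, by
          have := laplaceChar_one_ne h2
          simpa [laplaceFourierChar_apply, laplaceChar_apply, fourierChar_apply] using this⟩
    · exact ⟨_, ⟨1, 0, 0, rfl⟩, by
          have := laplaceChar_one_ne h1
          simpa [laplaceFourierChar_apply, laplaceChar_apply, fourierChar_apply] using this⟩
  · rintro _ ⟨j, k, μ, rfl⟩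
    rw [← h j k μ]
    refine setIntegral_congr_fun measurableSet_timeDomain fun p hp => ?_
    simp only [laplaceFourierChar_apply, laplaceChar_apply, fourierChar_apply]
    rw [Real.coe_toNNReal _ (hp.1.trans hp.2).le, Real.coe_toNNReal _ hp.1.le]

/-! ### Fourier transforms of integrable functions on a half-line -/

/-- `g` is the Fourier transform of an integrable function that vanishes on `(-∞, 0]`. -/
def IsPlus (g : ℝ → ℂ) : Prop :=
  ∃ f : ℝ → ℂ, Integrable f ∧ (∀ x ≤ 0, f x = 0) ∧
    ∀ μ : ℝ, g μ = ∫ x : ℝ, Complex.exp (Complex.I * μ * x) * f x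

theorem norm_exp_I_mul (μ x : ℝ) : ‖Complex.exp (Complex.I * μ * x)‖ = 1 := by
  rw [show Complex.I * (μ : ℂ) * x = ((μ * x : ℝ) : ℂ) * Complex.I by push_cast; ring,
        Complex.norm_exp_ofReal_mul_I]

theorem integrable_exp_I_mul (μ : ℝ) {m : Measure ℝ} {f : ℝ → ℂ} (hf : Integrable f m) :
    Integrable (fun x : ℝ => Complex.exp (Complex.I * μ * x) * f x) m :=
  hf.bdd_mul (c := 1) (by fun_prop) (Filter.Eventually.of_forall fun x => (norm_exp_I_mul μ x).le)

theorem IsPlus.zero : IsPlus 0 := ⟨0, integrable_zero _ _ _, by simp, by simp⟩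

theorem IsPlus.add {g g' : ℝ → ℂ} (hg : IsPlus g) (hg' : IsPlus g') : IsPlus (g + g') := by
  obtain ⟨f, hf, hf0, hfe⟩ := hg
  obtain ⟨f', hf', hf0', hfe'⟩ := hg'
  refine ⟨f + f', hf.add hf', fun x hx => by simp [hf0 x hx, hf0' x hx], fun μ => ?_⟩
  simp only [Pi.add_apply, mul_add]
  rw [integral_add (integrable_exp_I_mul μ hf) (integrable_exp_I_mul μ hf'), hfe, hfe']

theorem IsPlus.const_mul {g : ℝ → ℂ} (hg : IsPlus g) (c : ℂ) : IsPlus (fun μ => c * g μ) := by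
  obtain ⟨f, hf, hf0, hfe⟩ := hg
  refine ⟨fun x => c * f x, hf.const_mul c, fun x hx => by simp [hf0 x hx], fun μ => ?_⟩
  simp only [hfe, ← integral_const_mul]
  congr 1; ext x; ring

theorem IsPlus.sum {ι : Type*} {s : Finset ι} {g : ι → ℝ → ℂ} (h : ∀ i ∈ s, IsPlus (g i)) :
    IsPlus (∑ i ∈ s, g i) := by
  classical
  induction s using Finset.induction_on with
  | empty => simpa using IsPlus.zero
  | insert a s ha ih =>
    rw [Finset.sum_insert ha]
    exact (h a (Finset.mem_insert_self _ _)).add (ih fun i hi => h i (Finset.mem_insert_of_mem hi))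

/-- The convolution of two functions that vanish on `(-∞, 0]` vanishes there as well. The class is
thus an algebra, without unit. -/
theorem IsPlus.mul {g g' : ℝ → ℂ} (hg : IsPlus g) (hg' : IsPlus g') : IsPlus (g * g') := by
  obtain ⟨f, hf, hf0, hfe⟩ := hg
  obtain ⟨f', hf', hf0', hfe'⟩ := hg'
  refine ⟨convolution f f' (ContinuousLinearMap.mul ℝ ℂ) volume,
    hf.integrable_convolution _ hf', fun x hx => ?_, fun μ => ?_⟩
  · rw [convolution_def]
    convert integral_zero ℝ ℂ with t
    rcases le_or_gt t 0 with ht | ht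
    · simp [hf0 t ht]
    · simp [hf0' (x - t) (by linarith)]
  · rw [Pi.mul_apply, hfe, hfe']
    have := integral_convolution (ContinuousLinearMap.mul ℝ ℂ) (integrable_exp_I_mul μ hf)
      (integrable_exp_I_mul μ hf')
    rw [ContinuousLinearMap.mul_apply'] at this
    rw [← this]
    congr 1; ext x
    rw [convolution_def, convolution_def, ← integral_const_mul]
    congr 1; ext t
    simp only [ContinuousLinearMap.mul_apply']
    rw [show Complex.I * (μ : ℂ) * x = Complex.I * μ * t + Complex.I * μ * ((x - t : ℝ) : ℂ) by
      push_cast; ring, Complex.exp_add]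
    ring

/-- A function that is the Fourier transform both of a function on the positive and of one on the
negative half-line is zero. -/
theorem IsPlus.eq_zero {g : ℝ → ℂ} (hg : IsPlus g) (hg' : IsPlus fun μ => g (-μ)) : g = 0 := by
  obtain ⟨f, hf, hf0, hfe⟩ := hg
  obtain ⟨f', hf', hf0', hfe'⟩ := hg'
  have hf'' : Integrable fun x => f' (-x) := hf'.comp_neg
  -- By injectivity of the Fourier transform the two representing functions agree a.e., but they
  -- live on opposite half-lines.
  have h1 : (fun x => f x - f' (-x)) =ᵐ[volume] 0 := by
    refine ae_eq_zero_of_fourier (hf.sub hf'') fun μ => ?_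
    simp only [mul_sub]
    rw [integral_sub (integrable_exp_I_mul μ hf) (integrable_exp_I_mul μ hf''), ← hfe]
    have h2 : g (- -μ) = _ := hfe' (-μ)
    rw [neg_neg, ← integral_neg_eq_self] at h2
    rw [h2, sub_eq_zero]
    congr 1; ext x
    push_cast; ring_nf
  have h3 : f =ᵐ[volume] 0 := by
    filter_upwards [h1] with x hx
    simp only [Pi.zero_apply] at hx ⊢
    rcases le_or_gt x 0 with h | h
    · exact hf0 x h
    · rw [hf0' (-x) (by linarith)] at hx
      simpa using hx
  funext μ
  rw [hfe, Pi.zero_apply]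
  rw [integral_congr_ae (g := 0)]
  · simp
  · filter_upwards [h3] with x hx
    simp [hx]

/-! ### The roots of `κ` -/

section Roots

variable {N : ℕ}

theorem kappa_eq (N : ℕ) : kappa N = -(-1) ^ (N / 2) := by
  rw [kappa, pow_add]; ring

theorem kappa_mul_self (N : ℕ) : kappa N * kappa N = 1 := by
  rw [kappa_eq, neg_mul_neg, ← pow_add, ← two_mul, pow_mul]; simp

theorem kappa_ne_zero (N : ℕ) : (kappa N : ℂ) ≠ 0 := by
  rw [Complex.ofReal_ne_zero]
  intro h
  have := kappa_mul_self N
  rw [h] at this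
  simp at this

theorem I_pow_even (hN : Even N) : (Complex.I) ^ N = (-1) ^ (N / 2) := by
  obtain ⟨k, rfl⟩ := hN
  rw [← two_mul, pow_mul, Complex.I_sq, Nat.mul_div_cancel_left _ (by norm_num)]

theorem mem_rootsJ (hN2 : 2 ≤ N) {θ : ℂ} :
    θ ∈ rootsJ N ↔ θ ^ N = (kappa N : ℂ) ∧ 0 < θ.re := by
  rw [rootsJ, Finset.mem_filter, Polynomial.mem_nthRootsFinset (by omega)]

theorem mem_rootsK (hN2 : 2 ≤ N) {θ : ℂ} :
    θ ∈ rootsK N ↔ θ ^ N = (kappa N : ℂ) ∧ θ.re < 0 := by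
  rw [rootsK, Finset.mem_filter, Polynomial.mem_nthRootsFinset (by omega)]

theorem rootsJ_ne_zero (hN2 : 2 ≤ N) {θ : ℂ} (h : θ ∈ rootsJ N) : θ ≠ 0 := by
  rintro rfl
  simpa using ((mem_rootsJ hN2).1 h).2

theorem norm_of_mem_rootsJ (hN2 : 2 ≤ N) {θ : ℂ} (h : θ ∈ rootsJ N) : ‖θ‖ = 1 := by
  have h1 := congrArg norm ((mem_rootsJ hN2).1 h).1
  rw [norm_pow] at h1
  have h2 : ‖(kappa N : ℂ)‖ = 1 := by
    rw [Complex.norm_real, kappa_eq, norm_neg, norm_pow, norm_neg, norm_one, one_pow]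
  rw [h2] at h1
  exact (pow_eq_one_iff_of_nonneg (norm_nonneg _) (by omega)).1 h1

/-- For even `N` negation exchanges `J` and `K`; this allows every sum and product over `K` to be
rewritten over `J`. -/
theorem neg_mem_rootsK (hN : Even N) (hN2 : 2 ≤ N) {θ : ℂ} : -θ ∈ rootsK N ↔ θ ∈ rootsJ N := by
  rw [mem_rootsK hN2, mem_rootsJ hN2, hN.neg_pow, Complex.neg_re, neg_lt_zero]

theorem rootsK_eq (hN : Even N) (hN2 : 2 ≤ N) :
    rootsK N = (rootsJ N).map (Equiv.neg ℂ).toEmbedding := by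
  ext θ
  rw [Finset.mem_map_equiv, ← neg_mem_rootsK hN hN2]
  simp

theorem card_rootsK (hN : Even N) (hN2 : 2 ≤ N) : (rootsK N).card = (rootsJ N).card := by
  rw [rootsK_eq hN hN2, Finset.card_map]

theorem sum_rootsK (hN : Even N) (hN2 : 2 ≤ N) (F : ℂ → ℂ) :
    ∑ θ ∈ rootsK N, F θ = ∑ θ ∈ rootsJ N, F (-θ) := by
  rw [rootsK_eq hN hN2, Finset.sum_map]; rfl

theorem coeffB_neg (hN : Even N) (hN2 : 2 ≤ N) (θ : ℂ) : coeffB N (-θ) = coeffA N θ := by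
  have h : (rootsK N).erase (-θ) = ((rootsJ N).erase θ).map (Equiv.neg ℂ).toEmbedding := by
    rw [rootsK_eq hN hN2, Finset.map_erase]; rfl
  rw [coeffB, coeffA, h, Finset.prod_map]
  refine Finset.prod_congr rfl fun η _ => ?_
  show -η / (-η - -θ) = _
  rw [show -η - -θ = -(η - θ) by ring, neg_div_neg_eq]

/-- A purely imaginary root `iy` would satisfy `yᴺ = -1` with `y` real and `N` even. Hence `J` and
`K` exhaust the roots. -/
theorem re_ne_zero_of_pow_eq_kappa (hN : Even N) {θ : ℂ} (h : θ ^ N = (kappa N : ℂ)) :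
    θ.re ≠ 0 := by
  intro h0
  have h1 : θ = θ.im * Complex.I := by
    apply Complex.ext <;> simp [h0]
  rw [h1, mul_pow, I_pow_even hN, kappa_eq] at h
  have h2 : (θ.im : ℂ) ^ N = -1 := by
    have h3 : ((-1 : ℂ)) ^ (N / 2) ≠ 0 := pow_ne_zero _ (by norm_num)
    push_cast at h
    exact mul_right_cancel₀ h3 (by linear_combination h)
  have h4 : θ.im ^ N = -1 := by exact_mod_cast h2
  have := hN.pow_nonneg θ.im
  linarith

theorem disjoint_rootsJ_rootsK (hN2 : 2 ≤ N) : Disjoint (rootsJ N) (rootsK N) := by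
  rw [Finset.disjoint_left]
  intro θ h1 h2
  have h3 := ((mem_rootsJ hN2).1 h1).2
  have h4 := ((mem_rootsK hN2).1 h2).2
  linarith

theorem rootsJ_union_rootsK (hN : Even N) (hN2 : 2 ≤ N) :
    rootsJ N ∪ rootsK N = Polynomial.nthRootsFinset N (kappa N : ℂ) := by
  ext θ
  rw [Finset.mem_union, mem_rootsJ hN2, mem_rootsK hN2,
    Polynomial.mem_nthRootsFinset (by omega)]
  constructor
  · rintro (h | h) <;> exact h.1
  · intro h
    rcases lt_or_gt_of_ne (re_ne_zero_of_pow_eq_kappa hN h) with h1 | h1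
    · exact Or.inr ⟨h, h1⟩
    · exact Or.inl ⟨h, h1⟩

theorem prod_nthRoots_kappa (hN2 : 2 ≤ N) :
    ∏ θ ∈ Polynomial.nthRootsFinset N (kappa N : ℂ), (Polynomial.X - Polynomial.C θ) =
      Polynomial.X ^ N - Polynomial.C (kappa N : ℂ) := by
  have hmon := Polynomial.monic_X_pow_sub_C (kappa N : ℂ) (n := N) (by omega)
  have hsep : (Polynomial.X ^ N - Polynomial.C (kappa N : ℂ)).Separable :=
    Polynomial.separable_X_pow_sub_C _ (by exact_mod_cast (by omega : N ≠ 0)) (kappa_ne_zero N)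
  have h1 := (IsAlgClosed.splits (Polynomial.X ^ N -
    Polynomial.C (kappa N : ℂ))).eq_prod_roots_of_monic hmon
  have h2 : (Polynomial.nthRootsFinset N (kappa N : ℂ)).val =
      (Polynomial.X ^ N - Polynomial.C (kappa N : ℂ)).roots := by
    classical
    rw [Polynomial.nthRootsFinset_def, Multiset.toFinset_val, Polynomial.nthRoots,
      Multiset.dedup_eq_self]
    exact Polynomial.nodup_roots hsep
  rw [Finset.prod, h2, ← h1]

theorem prod_rootsJ_sub_mul_add (hN : Even N) (hN2 : 2 ≤ N) (y : ℂ) :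
    ∏ θ ∈ rootsJ N, (y - θ) * (y + θ) = y ^ N - kappa N := by
  have h := congrArg (Polynomial.eval y) (prod_nthRoots_kappa hN2)
  rw [← rootsJ_union_rootsK hN hN2, Finset.prod_union (disjoint_rootsJ_rootsK hN2),
    rootsK_eq hN hN2, Finset.prod_map, Polynomial.eval_mul, Polynomial.eval_prod,
    Polynomial.eval_prod] at h
  rw [Finset.prod_mul_distrib]
  simpa using h

theorem card_rootsJ (hN : Even N) (hN2 : 2 ≤ N) : (rootsJ N).card = N / 2 := by
  have h := congrArg Polynomial.natDegree (prod_nthRoots_kappa hN2)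
  rw [Polynomial.natDegree_finsetProd_X_sub_C_eq_card, Polynomial.natDegree_X_pow_sub_C,
    ← rootsJ_union_rootsK hN hN2, Finset.card_union_of_disjoint (disjoint_rootsJ_rootsK hN2),
    card_rootsK hN hN2] at h
  omega

/-- For `y = iμ` the right side is `aᴺ + μᴺ`; this is the algebraic Wiener-Hopf factorization, with
the zeros in `y` separated by the imaginary axis when `a > 0`. -/
theorem prod_rootsJ_mul (hN : Even N) (hN2 : 2 ≤ N) (a y : ℂ) :
    ∏ θ ∈ rootsJ N, (θ * a - y) * (θ * a + y) = a ^ N + (-1) ^ (N / 2) * y ^ N := by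
  have hN0 : N ≠ 0 := by omega
  have hpow : ∀ z : ℂ, (z * z) ^ (N / 2) = z ^ N := by
    intro z
    rw [← pow_two, ← pow_mul, Nat.mul_div_cancel' hN.two_dvd]
  rcases eq_or_ne a 0 with rfl | ha
  · simp only [mul_zero, zero_sub, zero_add]
    rw [Finset.prod_const, card_rootsJ hN hN2, neg_mul, neg_pow, hpow, zero_pow hN0]; ring
  · have h := prod_rootsJ_sub_mul_add hN hN2 (y / a)
    have h1 : ∀ θ ∈ rootsJ N, (θ * a - y) * (θ * a + y) =
        -(a * a) * ((y / a - θ) * (y / a + θ)) := by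
      intro θ _; field_simp; ring
    rw [Finset.prod_congr rfl h1, Finset.prod_mul_distrib, h, Finset.prod_const,
      card_rootsJ hN hN2, neg_pow, hpow, div_pow, kappa_eq]
    have h2 : ((-1 : ℂ) ^ (N / 2)) * (-1) ^ (N / 2) = 1 := by
      rw [← pow_add, ← two_mul, pow_mul]; simp
    have h3 : a ^ N ≠ 0 := pow_ne_zero _ ha
    push_cast
    field_simp
    linear_combination (a ^ N) * h2

theorem conj_mem_rootsJ (hN2 : 2 ≤ N) {θ : ℂ} (h : θ ∈ rootsJ N) :
    (starRingEnd ℂ) θ ∈ rootsJ N := by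
  rw [mem_rootsJ hN2] at h ⊢
  rw [← map_pow, h.1]
  exact ⟨by simp, by simpa using h.2⟩

theorem sum_rootsJ_conj (hN2 : 2 ≤ N) (F : ℂ → ℂ) :
    ∑ θ ∈ rootsJ N, F ((starRingEnd ℂ) θ) = ∑ θ ∈ rootsJ N, F θ :=
  Finset.sum_bij' (fun θ _ => (starRingEnd ℂ) θ) (fun θ _ => (starRingEnd ℂ) θ)
    (fun _ h => conj_mem_rootsJ hN2 h) (fun _ h => conj_mem_rootsJ hN2 h)
    (fun _ _ => Complex.conj_conj _) (fun _ _ => Complex.conj_conj _) (fun _ _ => rfl)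

theorem coeffA_conj (hN2 : 2 ≤ N) (θ : ℂ) :
    coeffA N ((starRingEnd ℂ) θ) = (starRingEnd ℂ) (coeffA N θ) := by
  rw [coeffA, coeffA, map_prod]
  refine Finset.prod_bij' (fun η _ => (starRingEnd ℂ) η) (fun η _ => (starRingEnd ℂ) η)
    (fun η h => ?_) (fun η h => ?_) (fun _ _ => Complex.conj_conj _)
    (fun _ _ => Complex.conj_conj _) (fun η _ => ?_)
  · rw [Finset.mem_erase] at h ⊢
    exact ⟨fun h' => h.1 (by rw [← h', Complex.conj_conj]), conj_mem_rootsJ hN2 h.2⟩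
  · rw [Finset.mem_erase] at h ⊢
    exact ⟨fun h' => h.1 ((starRingEnd ℂ).injective h'), conj_mem_rootsJ hN2 h.2⟩
  · simp

/-- Conjugate roots have modulus one and cancel in pairs; a real root in `J` is positive of modulus
one, hence equals `1`. -/
theorem prod_rootsJ (hN2 : 2 ≤ N) : ∏ θ ∈ rootsJ N, θ = 1 := by
  refine Finset.prod_involution (fun θ _ => (starRingEnd ℂ) θ) (fun θ h => ?_) (fun θ h h1 h2 => ?_)
    (fun θ h => conj_mem_rootsJ hN2 h) (fun θ h => Complex.conj_conj θ)
  · rw [Complex.mul_conj, Complex.normSq_eq_norm_sq, norm_of_mem_rootsJ hN2 h]; simp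
  · apply h1
    obtain ⟨r, rfl⟩ := Complex.conj_eq_iff_real.1 h2
    have h3 := norm_of_mem_rootsJ hN2 h
    have h4 := ((mem_rootsJ hN2).1 h).2
    rw [Complex.ofReal_re] at h4
    rw [Complex.norm_real, Real.norm_of_nonneg h4.le] at h3
    rw [h3]; simp

/-- The equation `θᴺ = κ` says `cos (N|α| - Nπ/2) = -1`. If `|α|` lay strictly between `π/2 - π/N`
and `π/2`, the angle would lie in `(-π, 0)`, where the cosine exceeds `-1`. -/
theorem exists_arg_of_mem_rootsJ (hN : Even N) (hN2 : 2 ≤ N) {θ : ℂ} (h : θ ∈ rootsJ N) :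
    ∃ α : ℝ, θ = Complex.exp (α * Complex.I) ∧ |α| ≤ Real.pi / 2 - Real.pi / N := by
  have hN0 : (0 : ℝ) < N := by exact_mod_cast (by omega : 0 < N)
  have hθ : θ = Complex.exp (θ.arg * Complex.I) := by
    conv_lhs => rw [← Complex.norm_mul_exp_arg_mul_I θ, norm_of_mem_rootsJ hN2 h]
    simp
  refine ⟨θ.arg, hθ, ?_⟩
  by_contra! hlt
  have hpi := Real.pi_pos
  have h1 : |θ.arg| < Real.pi / 2 :=
    Complex.abs_arg_lt_pi_div_two_iff.2 (Or.inl ((mem_rootsJ hN2).1 h).2)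
  obtain ⟨k, hk⟩ := hN
  have hkN : N / 2 = k := by omega
  have hkr : (N : ℝ) = 2 * k := by rw [hk]; push_cast; ring
  have hpow := ((mem_rootsJ hN2).1 h).1
  have h2 : Real.cos (N * |θ.arg|) = kappa N := by
    have : Real.cos (N * |θ.arg|) = Real.cos (N * θ.arg) := by
      rcases abs_choice θ.arg with h | h <;> rw [h]
      rw [mul_neg, Real.cos_neg]
    rw [this]
    rw [hθ, ← Complex.exp_nat_mul] at hpow
    have := congrArg Complex.re hpow
    rw [Complex.ofReal_re, show (N : ℂ) * (θ.arg * Complex.I) = ((N * θ.arg : ℝ) : ℂ) * Complex.I by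
      push_cast; ring, Complex.exp_ofReal_mul_I_re] at this
    exact this
  have h3 : Real.cos (N * |θ.arg| - k * Real.pi) = -1 := by
    rw [Real.cos_sub_nat_mul_pi, h2, kappa_eq, hkN]
    have : ((-1 : ℝ) ^ k) * (-1) ^ k = 1 := by rw [← mul_pow]; simp
    linarith
  have h4 : -Real.pi < N * |θ.arg| - k * Real.pi := by
    have := mul_lt_mul_of_pos_left hlt hN0
    have e : (N : ℝ) * (Real.pi / 2 - Real.pi / N) = k * Real.pi - Real.pi := by
      field_simp; rw [hkr]; ring
    linarith
  have h5 : N * |θ.arg| - k * Real.pi < 0 := by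
    have := mul_lt_mul_of_pos_left h1 hN0
    rw [hkr] at this ⊢
    nlinarith
  have h6 : -1 < Real.cos (N * |θ.arg| - k * Real.pi) := by
    rw [← Real.cos_pi, ← Real.cos_neg (N * |θ.arg| - k * Real.pi)]
    exact Real.cos_lt_cos_of_nonneg_of_le_pi (by linarith) le_rfl (by linarith)
  linarith

/-- The roots in `J` keep an angular distance `π/N` from the imaginary axis, so a rotation by at
most `π/N` does not take them out of the closed right half-plane. All rotations of contours below
rest on this margin. -/
theorem re_mul_exp_ge (hN : Even N) (hN2 : 2 ≤ N) {θ : ℂ} (h : θ ∈ rootsJ N) {φ : ℝ}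
    (hφ : |φ| ≤ Real.pi / N) :
    Real.sin (Real.pi / N - |φ|) ≤ (θ * Complex.exp (φ * Complex.I)).re := by
  obtain ⟨α, rfl, hα⟩ := exists_arg_of_mem_rootsJ hN hN2 h
  rw [← Complex.exp_add, show (α : ℂ) * Complex.I + φ * Complex.I = ((α + φ : ℝ) : ℂ) * Complex.I by
    push_cast; ring, Complex.exp_ofReal_mul_I_re, ← Real.cos_abs (α + φ), ← Real.cos_pi_div_two_sub]
  have h1 : |α + φ| ≤ |α| + |φ| := abs_add_le _ _
  have h2 := abs_nonneg α
  have h3 := abs_nonneg φ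
  have hpi := Real.pi_pos
  exact Real.cos_le_cos_of_nonneg_of_le_pi (abs_nonneg _) (by linarith) (by linarith)

theorem re_mul_exp_nonneg (hN : Even N) (hN2 : 2 ≤ N) {θ : ℂ} (h : θ ∈ rootsJ N) {φ : ℝ}
    (hφ : |φ| ≤ Real.pi / N) : 0 ≤ (θ * Complex.exp (φ * Complex.I)).re := by
  refine le_trans ?_ (re_mul_exp_ge hN hN2 h hφ)
  have hpi := Real.pi_pos
  have h3 := abs_nonneg φ
  have : Real.pi / N ≤ Real.pi := div_le_self hpi.le (by exact_mod_cast (by omega : 1 ≤ N))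
  exact Real.sin_nonneg_of_nonneg_of_le_pi (by linarith) (by linarith)

/-- Partial fractions for simple poles. -/
theorem sum_prod_inv_mul_inv {s : Finset ℂ} (hs : s.Nonempty) {y : ℂ} (hy : y ∉ s) :
    ∑ θ ∈ s, (∏ η ∈ s.erase θ, (η - θ)⁻¹) * (θ - y)⁻¹ = (∏ θ ∈ s, (θ - y))⁻¹ := by
  have hv : Set.InjOn (fun θ : ℂ => -θ) s := neg_injective.injOn
  have hx : ∀ i ∈ s, -y ≠ -i := fun i hi h => hy (by rw [neg_injective h]; exact hi)
  -- Partial fractions are Lagrange interpolation of the constant `1`; the nodes are `-θ` so that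
  -- the differences come out as `η - θ`.
  have h := Lagrange.eval_interpolate_not_at_node (1 : ℂ → ℂ) hx
  rw [Lagrange.interpolate_one hv hs, Polynomial.eval_one, Lagrange.eval_nodal] at h
  have h2 : ∏ θ ∈ s, (-y - -θ) = ∏ θ ∈ s, (θ - y) :=
    Finset.prod_congr rfl fun θ _ => by ring
  rw [h2] at h
  rw [← eq_inv_of_mul_eq_one_right h.symm]
  refine Finset.sum_congr rfl fun θ _ => ?_
  rw [Lagrange.nodalWeight, Pi.one_apply, mul_one]
  have e : ∀ η, -θ - -η = η - θ := fun η => by ring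
  simp only [e]
  rw [show -y - -θ = θ - y by ring]

theorem rootsJ_nonempty (hN : Even N) (hN2 : 2 ≤ N) : (rootsJ N).Nonempty := by
  rw [← Finset.card_pos, card_rootsJ hN hN2]; omega

/-- As the roots in `J` have product `1`, the number `A_j θ_j` is precisely the partial fraction
weight at the node `θ_j`. -/
theorem coeffA_mul_self (hN2 : 2 ≤ N) {θ : ℂ} (h : θ ∈ rootsJ N) :
    coeffA N θ * θ = ∏ η ∈ (rootsJ N).erase θ, (η - θ)⁻¹ := by
  have h1 := prod_rootsJ hN2
  rw [← Finset.mul_prod_erase _ _ h] at h1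
  rw [coeffA]
  simp only [div_eq_mul_inv]
  rw [Finset.prod_mul_distrib]
  linear_combination (∏ η ∈ (rootsJ N).erase θ, (η - θ)⁻¹) * h1

/-- Partial fractions after scaling by `a`. Together with the Jacobian `N a^(N-1)` of `l = aᴺ`, the
power of `a` accounts for the factor `ζ ^ (N / 2)` in `contourIntegrand`. -/
theorem sum_coeffA_inv (hN : Even N) (hN2 : 2 ≤ N) {a y : ℂ} (ha : a ≠ 0)
    (hy : ∀ θ ∈ rootsJ N, θ * a - y ≠ 0) :
    a * ∑ θ ∈ rootsJ N, coeffA N θ * θ * (θ * a - y)⁻¹ =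
      a ^ (N / 2) * (∏ θ ∈ rootsJ N, (θ * a - y))⁻¹ := by
  have h1 := sum_prod_inv_mul_inv (rootsJ_nonempty hN hN2) (y := y / a) (fun h => hy _ h (by
    field_simp; ring))
  have h2 : ∀ θ : ℂ, θ * a - y = a * (θ - y / a) := fun θ => by field_simp
  simp only [h2]
  rw [Finset.prod_mul_distrib, Finset.prod_const, card_rootsJ hN hN2, mul_inv, ← mul_assoc,
    mul_inv_cancel₀ (pow_ne_zero _ ha), one_mul, ← h1, Finset.mul_sum]
  refine Finset.sum_congr rfl fun θ hθ => ?_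
  rw [coeffA_mul_self hN2 hθ, mul_inv]
  field_simp

/-- By the factorization of `yᴺ - κ`, the product equals `(1 - κyᴺ) / ∏ (θ - y)`. Partial fractions
turn this into `∑ A_θ (1 - (y/θ)ᴺ) / (1 - y/θ)`, a sum of finite geometric series with coefficients
`α_{-m}`. This is how the numbers `α_{-m}` enter the final formula. -/
theorem prod_one_add_div_eq (hN : Even N) (hN2 : 2 ≤ N) (y : ℂ) :
    ∏ θ ∈ rootsJ N, (1 + θ⁻¹ * y) =
      ∑ m ∈ Finset.range ((rootsK N).card + 1), alpha N (-(m : ℤ)) * y ^ m := by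
  set P : Polynomial ℂ := ∏ θ ∈ rootsJ N, (1 + Polynomial.C θ⁻¹ * Polynomial.X) with hP
  set Q : Polynomial ℂ := ∑ m ∈ Finset.range N, Polynomial.C (alpha N (-(m : ℤ))) *
    Polynomial.X ^ m with hQ
  have hPe : ∀ y, P.eval y = ∏ θ ∈ rootsJ N, (1 + θ⁻¹ * y) := fun y => by
    rw [hP, Polynomial.eval_prod]; simp
  have hQe : ∀ y, Q.eval y = ∑ m ∈ Finset.range N, alpha N (-(m : ℤ)) * y ^ m := fun y => by
    rw [hQ, Polynomial.eval_finsetSum]; simp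
  have hPQ : P = Q := by
    -- The computation divides by `θ - y`, so it is done off the finite set `J` and extended by
    -- polynomial identity.
    refine Polynomial.eq_of_infinite_eval_eq P Q ?_
    refine Set.Infinite.mono (s := ((rootsJ N : Set ℂ))ᶜ) (fun y hy => ?_)
      (rootsJ N).finite_toSet.infinite_compl
    have hy' : y ∉ rootsJ N := hy
    show P.eval y = Q.eval y
    have hne : ∀ θ ∈ rootsJ N, θ - y ≠ 0 := fun θ hθ h0 => hy' (by
      rw [← sub_eq_zero.1 h0]; exact hθ)
    have hprod : (∏ θ ∈ rootsJ N, (θ - y)) ≠ 0 := Finset.prod_ne_zero_iff.2 hne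
    have h1 := sum_prod_inv_mul_inv (rootsJ_nonempty hN hN2) hy'
    have h2 : (∏ θ ∈ rootsJ N, (θ - y)) * P.eval y = 1 - kappa N * y ^ N := by
      have h3 := prod_rootsJ_sub_mul_add hN hN2 y
      have h4 : P.eval y = ∏ θ ∈ rootsJ N, (y + θ) := by
        have h5 : ∏ θ ∈ rootsJ N, (y + θ) = (∏ θ ∈ rootsJ N, θ) * P.eval y := by
          rw [hPe, ← Finset.prod_mul_distrib]
          refine Finset.prod_congr rfl fun θ hθ => ?_
          have := rootsJ_ne_zero hN2 hθ
          field_simp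
          ring
        rw [h5, prod_rootsJ hN2, one_mul]
      have h6 : ∏ θ ∈ rootsJ N, (θ - y) = (-1) ^ (N / 2) * ∏ θ ∈ rootsJ N, (y - θ) := by
        rw [← card_rootsJ hN hN2, ← Finset.prod_const, ← Finset.prod_mul_distrib]
        exact Finset.prod_congr rfl fun θ _ => by ring
      rw [Finset.prod_mul_distrib] at h3
      rw [h4, h6, mul_assoc, h3]
      have h7 : ((-1 : ℂ) ^ (N / 2)) = -kappa N := by rw [kappa_eq]; push_cast; ring
      have h8 : (kappa N : ℂ) * kappa N = 1 := by exact_mod_cast kappa_mul_self N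
      rw [h7]; linear_combination h8
    have h3 : P.eval y = (1 - kappa N * y ^ N) * (∏ θ ∈ rootsJ N, (θ - y))⁻¹ := by
      rw [← h2]; field_simp
    rw [h3, ← h1, hQe, Finset.mul_sum]
    simp only [alpha, Finset.sum_mul]
    rw [Finset.sum_comm]
    refine Finset.sum_congr rfl fun θ hθ => ?_
    have h0 := rootsJ_ne_zero hN2 hθ
    rw [← coeffA_mul_self hN2 hθ]
    have hg := mul_neg_geom_sum (θ⁻¹ * y) N
    have h9 : (θ⁻¹ * y) ^ N = kappa N * y ^ N := by
      rw [mul_pow, inv_pow, ((mem_rootsJ hN2).1 hθ).1]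
      have h8 : (kappa N : ℂ) * kappa N = 1 := by exact_mod_cast kappa_mul_self N
      rw [inv_eq_of_mul_eq_one_right h8]
    rw [h9] at hg
    rw [← hg]
    have h10 : θ * (θ - y)⁻¹ * (1 - θ⁻¹ * y) = 1 := by
      have := hne θ hθ
      field_simp
    have h11 : ∀ x ∈ Finset.range N, coeffA N θ * θ ^ (-(x : ℤ)) * y ^ x =
        coeffA N θ * (θ⁻¹ * y) ^ x := by
      intro x _
      rw [mul_pow, zpow_neg, zpow_natCast, inv_pow]; ring
    rw [Finset.sum_congr rfl h11, ← Finset.mul_sum]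
    linear_combination (coeffA N θ * ∑ i ∈ Finset.range N, (θ⁻¹ * y) ^ i) * h10
  have hcK := card_rootsK hN hN2
  have hcJ := card_rootsJ hN hN2
  have hdeg : P.natDegree ≤ (rootsK N).card := by
    refine (Polynomial.natDegree_prod_le _ _).trans ?_
    rw [hcK, Finset.card_eq_sum_ones]
    refine Finset.sum_le_sum fun θ _ => ?_
    compute_degree
  -- The geometric series reach up to `y ^ (N-1)`, but a product of `#J = #K` linear factors has no
  -- terms of degree above `#K`.
  rw [← hPe, Polynomial.eval_eq_sum_range' (n := (rootsK N).card + 1) (by omega)]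
  refine Finset.sum_congr rfl fun m hm => ?_
  rw [hPQ, hQ, Polynomial.finsetSum_coeff]
  simp only [Polynomial.coeff_C_mul, Polynomial.coeff_X_pow]
  rw [Finset.mem_range] at hm
  rw [Finset.sum_eq_single m]
  · simp
  · intro b _ hb; simp [hb.symm]
  · intro hm'; rw [Finset.mem_range] at hm'; omega

theorem sub_I_mul_ne_zero (hN2 : 2 ≤ N) {θ : ℂ} (h : θ ∈ rootsJ N) {a : ℝ} (ha : 0 < a) {c : ℂ}
    (hc : 0 ≤ c.re) : θ * a + c ≠ 0 := by
  intro h0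
  have := congrArg Complex.re h0
  have h1 := ((mem_rootsJ hN2).1 h).2
  simp only [Complex.add_re, Complex.mul_re, Complex.ofReal_re, Complex.ofReal_im, mul_zero,
    sub_zero, Complex.zero_re] at this
  nlinarith [mul_pos h1 ha]

/-- Logarithmic derivative with respect to `a` of `aᴺ + μᴺ = ∏ (θa - iμ)(θa + iμ)`. -/
theorem sum_div_rootsJ (hN : Even N) (hN2 : 2 ≤ N) {a : ℝ} (ha : 0 < a) (μ : ℝ) :
    ∑ θ ∈ rootsJ N, θ / (θ * a - Complex.I * μ) + ∑ θ ∈ rootsJ N, θ / (θ * a + Complex.I * μ) =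
      N * a ^ (N - 1) / (a ^ N + μ ^ N) := by
  have hF : ∀ z : ℂ, ∏ θ ∈ rootsJ N, (θ * z - Complex.I * μ) * (θ * z + Complex.I * μ) =
      z ^ N + μ ^ N := by
    intro z
    rw [prod_rootsJ_mul hN hN2, mul_pow, I_pow_even hN, ← mul_assoc, ← mul_pow]; simp
  have hne1 : ∀ θ ∈ rootsJ N, θ * a - Complex.I * μ ≠ 0 := fun θ hθ => by
    rw [sub_eq_add_neg]; exact sub_I_mul_ne_zero hN2 hθ ha (by simp)
  have hne2 : ∀ θ ∈ rootsJ N, θ * a + Complex.I * μ ≠ 0 := fun θ hθ =>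
    sub_I_mul_ne_zero hN2 hθ ha (by simp)
  have h1 : HasDerivAt (fun z : ℂ => ∏ θ ∈ rootsJ N,
      (θ * z - Complex.I * μ) * (θ * z + Complex.I * μ))
      (∑ θ ∈ rootsJ N, (∏ η ∈ (rootsJ N).erase θ,
        (η * a - Complex.I * μ) * (η * a + Complex.I * μ)) •
        (θ * (θ * a + Complex.I * μ) + (θ * a - Complex.I * μ) * θ)) (a : ℂ) := by
    refine HasDerivAt.fun_finsetProd fun θ _ => ?_
    have e1 : HasDerivAt (fun z : ℂ => θ * z) θ (a : ℂ) := by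
      simpa using (hasDerivAt_id (a : ℂ)).const_mul θ
    exact (e1.sub_const _).mul (e1.add_const _)
  simp only [hF] at h1
  have h2 : HasDerivAt (fun z : ℂ => z ^ N + (μ : ℂ) ^ N) (N * (a : ℂ) ^ (N - 1)) (a : ℂ) := by
    simpa using (hasDerivAt_pow N (a : ℂ)).add_const ((μ : ℂ) ^ N)
  have h3 := h1.unique h2
  rw [← h3, ← hF, Finset.sum_div, ← Finset.sum_add_distrib]
  refine Finset.sum_congr rfl fun θ hθ => ?_
  rw [← Finset.mul_prod_erase _ _ hθ]
  have e1 := hne1 θ hθ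
  have e2 := hne2 θ hθ
  have e3 : ∏ η ∈ (rootsJ N).erase θ, (η * a - Complex.I * μ) * (η * a + Complex.I * μ) ≠ 0 :=
    Finset.prod_ne_zero_iff.2 fun η hη => mul_ne_zero (hne1 η (Finset.mem_of_mem_erase hη))
      (hne2 η (Finset.mem_of_mem_erase hη))
  rw [smul_eq_mul]
  generalize ∏ η ∈ (rootsJ N).erase θ, (η * a - Complex.I * μ) * (η * a + Complex.I * μ) = P at e3 ⊢
  field_simp

end Roots

/-! ### The elementary solution -/

section HeatKernel

open scoped FourierTransform

variable {N : ℕ}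

theorem integrable_ofReal_comp {α : Type*} [MeasurableSpace α] {m : Measure α} {f : α → ℝ}
    (hf : Integrable f m) : Integrable (fun x => (f x : ℂ)) m :=
  hf.ofReal

/-- Lets a multiple of the Gaussian dominate `e^{-xᴺ}`. -/
theorem sq_sub_one_le_pow (hN : Even N) (hN2 : 2 ≤ N) (x : ℝ) : x ^ 2 - 1 ≤ x ^ N := by
  obtain ⟨k, hk⟩ := hN
  have hx : 0 ≤ x ^ 2 := sq_nonneg x
  have hN' : x ^ N = (x ^ 2) ^ k := by rw [← pow_mul]; congr 1; omega
  rw [hN']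
  rcases le_or_gt 1 (x ^ 2) with h | h
  · have := le_self_pow₀ h (by omega : k ≠ 0)
    linarith
  · have : 0 ≤ (x ^ 2) ^ k := by positivity
    linarith

theorem integrable_pow_mul_exp_neg_pow (hN : Even N) (hN2 : 2 ≤ N) (k : ℕ) :
    Integrable fun x : ℝ => x ^ k * Real.exp (-x ^ N) := by
  have h := (integrable_rpow_mul_exp_neg_mul_sq (b := 1) one_pos (s := k)
    (by linarith [(Nat.cast_nonneg k : (0 : ℝ) ≤ k)])).const_mul (Real.exp 1)
  refine h.mono (by fun_prop) (Eventually.of_forall fun x => ?_)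
  have h1 := sq_sub_one_le_pow hN hN2 x
  rw [Real.rpow_natCast, norm_mul, norm_mul, norm_mul, mul_left_comm]
  refine mul_le_mul_of_nonneg_left ?_ (norm_nonneg _)
  simp only [Real.norm_eq_abs, Real.abs_exp]
  rw [← Real.exp_add, Real.exp_le_exp]
  linarith

/-- The function `e^{-μᴺ}`. -/
def expNegPow (N : ℕ) (μ : ℝ) : ℂ := (Real.exp (-μ ^ N) : ℂ)

theorem continuous_expNegPow : Continuous (expNegPow N) := by
  unfold expNegPow; fun_prop

theorem integrable_expNegPow (hN : Even N) (hN2 : 2 ≤ N) : Integrable (expNegPow N) := by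
  refine (integrable_ofReal_comp (integrable_pow_mul_exp_neg_pow hN hN2 0)).congr
    (Eventually.of_forall fun x => ?_)
  simp [expNegPow]

/-- Two integrable derivatives give quadratic decay of the Fourier transform. Hence `p(1; ·)` is
integrable and Fourier inversion applies to it, which is all that replaces the positivity of a
transition density. -/
theorem exists_fourier_expNegPow_le (hN : Even N) (hN2 : 2 ≤ N) :
    ∃ C : ℝ, ∀ x, ‖𝓕 (expNegPow N) x‖ ≤ C * (1 + x ^ 2)⁻¹ := by
  set g1 : ℝ → ℂ := fun x => ((-(N * x ^ (N - 1)) * Real.exp (-x ^ N) : ℝ) : ℂ) with hg1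
  set g2 : ℝ → ℂ := fun x => ((-(N * ((N - 1 : ℕ) * x ^ (N - 1 - 1))) * Real.exp (-x ^ N) +
    -(N * x ^ (N - 1)) * (-(N * x ^ (N - 1)) * Real.exp (-x ^ N)) : ℝ) : ℂ) with hg2
  have e0 : ∀ x : ℝ, HasDerivAt (fun x : ℝ => Real.exp (-x ^ N))
      (-(N * x ^ (N - 1)) * Real.exp (-x ^ N)) x := fun x => by
    have := ((hasDerivAt_pow N x).neg).exp
    rw [mul_comm] at this
    exact this
  have d1 : ∀ x, HasDerivAt (expNegPow N) (g1 x) x := fun x => (e0 x).ofReal_comp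
  have d2 : ∀ x, HasDerivAt g1 (g2 x) x := fun x => by
    have e1 : HasDerivAt (fun x : ℝ => -(N * x ^ (N - 1)))
        (-(N * ((N - 1 : ℕ) * x ^ (N - 1 - 1)))) x :=
      ((hasDerivAt_pow (N - 1) x).const_mul (N : ℝ)).neg
    exact (e1.mul (e0 x)).ofReal_comp
  have hd1 : deriv (expNegPow N) = g1 := funext fun x => (d1 x).deriv
  have hd2 : deriv g1 = g2 := funext fun x => (d2 x).deriv
  have i0 := integrable_expNegPow hN hN2
  have i1 : Integrable g1 := by
    have := integrable_ofReal_comp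
      ((integrable_pow_mul_exp_neg_pow hN hN2 (N - 1)).const_mul (-(N : ℝ)))
    refine this.congr (Eventually.of_forall fun x => ?_)
    simp only [hg1]; push_cast; ring
  have i2 : Integrable g2 := by
    have h1 := integrable_ofReal_comp ((integrable_pow_mul_exp_neg_pow hN hN2 (N - 1 - 1)).const_mul
      (-(N * (N - 1 : ℕ) : ℝ)))
    have h2 := integrable_ofReal_comp
      ((integrable_pow_mul_exp_neg_pow hN hN2 ((N - 1) + (N - 1))).const_mul ((N : ℝ) * N))
    refine (h1.add h2).congr (Eventually.of_forall fun x => ?_)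
    simp only [hg2, Pi.add_apply]; push_cast; ring
  have f1 := Real.fourier_deriv i0 (fun x => (d1 x).differentiableAt) (by rw [hd1]; exact i1)
  have f2 := Real.fourier_deriv i1 (fun x => (d2 x).differentiableAt) (by rw [hd2]; exact i2)
  rw [hd1] at f1
  rw [hd2] at f2
  have b : ∀ g : ℝ → ℂ, ∀ x, ‖𝓕 g x‖ ≤ ∫ v, ‖g v‖ := fun g x =>
    VectorFourier.norm_fourierIntegral_le_integral_norm _ _ _ _ _
  refine ⟨(∫ v, ‖expNegPow N v‖) + ∫ v, ‖g2 v‖, fun x => ?_⟩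
  have b0 := b (expNegPow N) x
  have b2 := b g2 x
  rw [f2] at b2
  simp only [f1, smul_eq_mul, norm_mul] at b2
  have hn : ‖(2 : ℂ)‖ * ‖(Real.pi : ℂ)‖ * ‖Complex.I‖ * ‖(x : ℂ)‖ = 2 * Real.pi * |x| := by
    simp [abs_of_pos Real.pi_pos]
  rw [hn, ← mul_assoc] at b2
  rw [← div_eq_mul_inv, le_div_iff₀ (by positivity)]
  have h3 : x ^ 2 ≤ 2 * Real.pi * |x| * (2 * Real.pi * |x|) := by
    have h4 := Real.pi_gt_three
    have h5 : 2 * Real.pi * |x| * (2 * Real.pi * |x|) = (4 * Real.pi ^ 2) * x ^ 2 := by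
      rw [← sq_abs x]; ring
    rw [h5]
    have : 1 ≤ 4 * Real.pi ^ 2 := by nlinarith
    nlinarith [sq_nonneg x]
  have h6 := mul_le_mul_of_nonneg_right h3 (norm_nonneg (𝓕 (expNegPow N) x))
  linarith

theorem continuous_fourier_expNegPow (hN : Even N) (hN2 : 2 ≤ N) :
    Continuous (𝓕 (expNegPow N)) :=
  VectorFourier.fourierIntegral_continuous Real.continuous_fourierChar
    (by exact continuous_inner) (integrable_expNegPow hN hN2)

theorem integrable_fourier_expNegPow (hN : Even N) (hN2 : 2 ≤ N) :
    Integrable (𝓕 (expNegPow N)) := by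
  obtain ⟨C, hC⟩ := exists_fourier_expNegPow_le hN hN2
  exact (integrable_inv_one_add_sq.const_mul C).mono'
    (continuous_fourier_expNegPow hN hN2).aestronglyMeasurable (Eventually.of_forall hC)

theorem kappa_mul_pow (hN : Even N) (t μ : ℝ) :
    (kappa N : ℂ) * t * (-Complex.I * μ) ^ N = ((-(t * μ ^ N) : ℝ) : ℂ) := by
  rw [neg_mul, hN.neg_pow, mul_pow, I_pow_even hN, kappa_eq]
  have h2 : ((-1 : ℂ) ^ (N / 2)) * (-1) ^ (N / 2) = 1 := by
    rw [← pow_add, ← two_mul, pow_mul]; simp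
  push_cast
  linear_combination (-(t : ℂ) * μ ^ N) * h2

theorem ofReal_heatKernel_one (hN : Even N) (x : ℝ) :
    (heatKernel N 1 x : ℂ) = (1 / (2 * Real.pi) : ℝ) * 𝓕 (expNegPow N) (x / (2 * Real.pi)) := by
  have h1 : 𝓕 (expNegPow N) (x / (2 * Real.pi)) =
      ∫ μ : ℝ, Complex.exp ((kappa N : ℂ) * (1 : ℝ) * (-Complex.I * μ) ^ N) *
        Complex.exp (-Complex.I * μ * x) := by
    rw [Real.fourier_real_eq_integral_exp_smul]
    congr 1; ext μ
    rw [kappa_mul_pow hN, smul_eq_mul, mul_comm, expNegPow, Complex.ofReal_exp, one_mul]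
    congr 2
    have : (Real.pi : ℂ) ≠ 0 := by exact_mod_cast Real.pi_ne_zero
    push_cast; field_simp
  rw [heatKernel, h1, Complex.ofReal_mul]
  congr 1
  -- The real part in `heatKernel` discards nothing: the substitution `μ ↦ -μ` shows that the
  -- integral equals its conjugate.
  refine Complex.conj_eq_iff_re.1 ?_
  rw [← integral_conj, ← integral_neg_eq_self]
  congr 1; ext μ
  rw [kappa_mul_pow hN, kappa_mul_pow hN, hN.neg_pow, map_mul, ← Complex.exp_conj,
    ← Complex.exp_conj, Complex.conj_ofReal]
  simp

theorem heatKernel_scale (hN : Even N) (hN2 : 2 ≤ N) {t : ℝ} (ht : 0 < t) (x : ℝ) :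
    heatKernel N t x = t ^ (-(1 / N : ℝ)) * heatKernel N 1 (t ^ (-(1 / N : ℝ)) * x) := by
  set c := t ^ (-(1 / N : ℝ)) with hc
  have hc0 : 0 < c := Real.rpow_pos_of_pos ht _
  have hcN : t * c ^ N = 1 := by
    rw [hc, ← Real.rpow_natCast, ← Real.rpow_mul ht.le]
    have : (N : ℝ) ≠ 0 := by exact_mod_cast (by omega : N ≠ 0)
    rw [show -(1 / N : ℝ) * N = -1 by field_simp, Real.rpow_neg_one, mul_inv_cancel₀ ht.ne']
  have h := Measure.integral_comp_mul_left (fun μ : ℝ =>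
    Complex.exp ((kappa N : ℂ) * t * (-Complex.I * μ) ^ N) * Complex.exp (-Complex.I * μ * x)) c
  rw [abs_of_pos (inv_pos.2 hc0)] at h
  have h2 : ∫ μ : ℝ, Complex.exp ((kappa N : ℂ) * t * (-Complex.I * μ) ^ N) *
      Complex.exp (-Complex.I * μ * x) = (c : ℂ) * ∫ μ : ℝ,
      Complex.exp ((kappa N : ℂ) * (1 : ℝ) * (-Complex.I * μ) ^ N) *
      Complex.exp (-Complex.I * μ * (c * x : ℝ)) := by
    have h3 : ∀ μ : ℝ, Complex.exp ((kappa N : ℂ) * t * (-Complex.I * (c * μ : ℝ)) ^ N) *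
      Complex.exp (-Complex.I * (c * μ : ℝ) * x) =
        Complex.exp ((kappa N : ℂ) * (1 : ℝ) * (-Complex.I * μ) ^ N) *
      Complex.exp (-Complex.I * μ * (c * x : ℝ)) := by
      intro μ
      rw [kappa_mul_pow hN, kappa_mul_pow hN, mul_pow, ← mul_assoc, hcN]
      congr 2
      push_cast; ring
    simp only [h3] at h
    rw [h, Complex.real_smul, ← mul_assoc, ← Complex.ofReal_mul c, mul_inv_cancel₀ hc0.ne']
    simp
  rw [heatKernel, h2, Complex.re_ofReal_mul, heatKernel]
  ring

theorem continuous_heatKernel_one (hN : Even N) (hN2 : 2 ≤ N) : Continuous (heatKernel N 1) := by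
  have h := ((continuous_fourier_expNegPow hN hN2).comp
    (by fun_prop : Continuous fun x : ℝ => x / (2 * Real.pi))).const_smul (1 / (2 * Real.pi) : ℝ)
  have h2 := Complex.continuous_re.comp h
  refine h2.congr fun x => ?_
  rw [← Complex.ofReal_re (heatKernel N 1 x), ofReal_heatKernel_one hN]
  simp

theorem integrable_heatKernel_one (hN : Even N) (hN2 : 2 ≤ N) : Integrable (heatKernel N 1) := by
  have h := ((integrable_fourier_expNegPow hN hN2).comp_div
    (R := 2 * Real.pi) (by positivity)).const_mul ((1 / (2 * Real.pi) : ℝ) : ℂ)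
  refine h.re.congr (Eventually.of_forall fun x => ?_)
  rw [← Complex.ofReal_re (heatKernel N 1 x), ofReal_heatKernel_one hN]
  rfl

theorem heatKernel_neg (hN : Even N) (t x : ℝ) : heatKernel N t (-x) = heatKernel N t x := by
  rw [heatKernel, heatKernel, ← integral_neg_eq_self]
  congr 3; ext μ
  rw [kappa_mul_pow hN, kappa_mul_pow hN, hN.neg_pow]
  congr 2
  push_cast; ring

theorem integral_exp_mul_heatKernel_one (hN : Even N) (hN2 : 2 ≤ N) (μ : ℝ) :
    ∫ x : ℝ, Complex.exp (Complex.I * μ * x) * heatKernel N 1 x = Real.exp (-μ ^ N) := by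
  have h := congrFun (continuous_expNegPow.fourierInv_fourier_eq
    (integrable_expNegPow hN hN2) (integrable_fourier_expNegPow hN hN2)) μ
  rw [Real.fourierInv_eq'] at h
  have hpi : (Real.pi : ℂ) ≠ 0 := by exact_mod_cast Real.pi_ne_zero
  have h2 := Measure.integral_comp_div (fun x : ℝ => Complex.exp (2 * Real.pi * Complex.I * μ * x) *
    𝓕 (expNegPow N) x) (2 * Real.pi)
  rw [expNegPow] at h
  rw [← h]
  have h3 : ∀ x : ℝ, Complex.exp (Complex.I * μ * x) * heatKernel N 1 x =
      (1 / (2 * Real.pi) : ℝ) * (Complex.exp (2 * Real.pi * Complex.I * μ *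
        (x / (2 * Real.pi) : ℝ)) * 𝓕 (expNegPow N) (x / (2 * Real.pi))) := by
    intro x
    rw [ofReal_heatKernel_one hN]
    have : (2 * Real.pi * Complex.I * μ * (x / (2 * Real.pi) : ℝ) : ℂ) = Complex.I * μ * x := by
      push_cast; field_simp
    rw [this]; ring
  simp only [h3]
  rw [integral_const_mul, h2, abs_of_pos (by positivity), Complex.real_smul, ← mul_assoc,
    ← Complex.ofReal_mul, one_div_mul_cancel (by positivity), Complex.ofReal_one, one_mul]
  congr 1; ext x
  rw [smul_eq_mul]
  congr 2
  simp only [RCLike.inner_apply, conj_trivial]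
  push_cast; ring

/-- Self-similarity `p(t; x) = t^{-1/N} p(1; t^{-1/N} x)`, stated for integrands homogeneous in the
kernel value, so that it serves Fourier integrals over the line and over half-lines alike. -/
theorem integral_comp_heatKernel (hN : Even N) (hN2 : 2 ≤ N) {t : ℝ} (ht : 0 < t)
    {E : Type*} [NormedAddCommGroup E] [NormedSpace ℝ E] (F : ℝ → ℝ → E)
    (hF : ∀ c x y, F x (c * y) = c • F x y) :
    ∫ x, F x (heatKernel N t x) = ∫ x, F (t ^ (1 / N : ℝ) * x) (heatKernel N 1 x) := by
  set c := t ^ (-(1 / N : ℝ)) with hc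
  have hc0 : 0 < c := Real.rpow_pos_of_pos ht _
  have hcc : t ^ (1 / N : ℝ) * c = 1 := by
    rw [hc, ← Real.rpow_add ht]; simp
  have h := Measure.integral_comp_mul_left
    (fun x => F (t ^ (1 / N : ℝ) * x) (heatKernel N 1 x)) c
  simp only [← mul_assoc, hcc, one_mul] at h
  simp only [heatKernel_scale hN hN2 ht, hF, ← hc]
  rw [integral_smul, h, abs_of_pos (inv_pos.2 hc0), smul_smul, mul_inv_cancel₀ hc0.ne', one_smul]

theorem continuous_heatKernel (hN : Even N) (hN2 : 2 ≤ N) {t : ℝ} (ht : 0 < t) :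
    Continuous (heatKernel N t) := by
  have := continuous_heatKernel_one hN hN2
  rw [funext (heatKernel_scale hN hN2 ht)]
  fun_prop

theorem integrable_heatKernel (hN : Even N) (hN2 : 2 ≤ N) {t : ℝ} (ht : 0 < t) :
    Integrable (heatKernel N t) := by
  rw [funext (heatKernel_scale hN hN2 ht)]
  exact ((integrable_heatKernel_one hN hN2).comp_mul_left'
    (Real.rpow_pos_of_pos ht _).ne').const_mul _

/-- The total variation of the signed kernel `p(t; ·)`, which does not depend on `t`. -/
def totalVariation (N : ℕ) : ℝ := ∫ x, ‖heatKernel N 1 x‖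

theorem integral_norm_heatKernel (hN : Even N) (hN2 : 2 ≤ N) {t : ℝ} (ht : 0 < t) :
    ∫ x, ‖heatKernel N t x‖ = totalVariation N := by
  set c := t ^ (-(1 / N : ℝ)) with hc
  have hc0 : 0 < c := Real.rpow_pos_of_pos ht _
  have h := Measure.integral_comp_mul_left (fun x => ‖heatKernel N 1 x‖) c
  simp only [heatKernel_scale hN hN2 ht, ← hc, norm_mul]
  rw [integral_const_mul, h, abs_of_pos (inv_pos.2 hc0), smul_eq_mul, ← mul_assoc,
    Real.norm_of_nonneg hc0.le, mul_inv_cancel₀ hc0.ne', one_mul, totalVariation]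

theorem integral_exp_mul_heatKernel (hN : Even N) (hN2 : 2 ≤ N) {t : ℝ} (ht : 0 < t) (μ : ℝ) :
    ∫ x : ℝ, Complex.exp (Complex.I * μ * x) * heatKernel N t x = Real.exp (-(t * μ ^ N)) := by
  rw [integral_comp_heatKernel hN hN2 ht
    (fun x y => Complex.exp (Complex.I * μ * x) * (y : ℂ)) (fun c x y => by
      rw [Complex.real_smul]; push_cast; ring)]
  have h := integral_exp_mul_heatKernel_one hN hN2 (t ^ (1 / N : ℝ) * μ)
  have hN0 : (N : ℝ) ≠ 0 := by exact_mod_cast (by omega : N ≠ 0)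
  rw [mul_pow, ← Real.rpow_natCast (t ^ (1 / N : ℝ)), ← Real.rpow_mul ht.le,
    one_div_mul_cancel hN0, Real.rpow_one] at h
  rw [← h]
  congr 1; ext x
  congr 2
  push_cast; ring

/-- The Fourier transform of the restriction of `p(t; ·)` to `(0, ∞)`. -/
def halfTransform (N : ℕ) (t μ : ℝ) : ℂ :=
  ∫ x in Set.Ioi (0 : ℝ), Complex.exp (Complex.I * μ * x) * heatKernel N t x

theorem halfTransform_eq (t μ : ℝ) : halfTransform N t μ =
    ∫ x : ℝ, Complex.exp (Complex.I * μ * x) *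
      (Set.Ioi (0 : ℝ)).indicator (fun x => (heatKernel N t x : ℂ)) x := by
  rw [halfTransform, ← integral_indicator measurableSet_Ioi]
  congr 1; ext x
  by_cases hx : x ∈ Set.Ioi (0 : ℝ) <;> simp [hx]

theorem isPlus_halfTransform (hN : Even N) (hN2 : 2 ≤ N) {t : ℝ} (ht : 0 < t) :
    IsPlus (halfTransform N t) :=
  ⟨_, (integrable_ofReal_comp (integrable_heatKernel hN hN2 ht)).indicator measurableSet_Ioi,
    fun x hx => Set.indicator_of_notMem (by simpa using hx) _, fun μ => halfTransform_eq t μ⟩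

/-- Because `p(t; ·)` is even, replacing `μ` by `-μ` gives the transform of its restriction to `(-∞,
0]`. This splits `e^{-tμᴺ}` additively into a positive-side and a negative-side transform. -/
theorem halfTransform_add_neg (hN : Even N) (hN2 : 2 ≤ N) {t : ℝ} (ht : 0 < t) (μ : ℝ) :
    halfTransform N t μ + halfTransform N t (-μ) = Real.exp (-(t * μ ^ N)) := by
  have hi := integrable_exp_I_mul μ (integrable_ofReal_comp (integrable_heatKernel hN hN2 ht))
  have h1 : halfTransform N t (-μ) =
      ∫ x in Set.Iic (0 : ℝ), Complex.exp (Complex.I * μ * x) * heatKernel N t x := by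
    have := integral_comp_neg_Ioi (0 : ℝ)
      (fun x : ℝ => Complex.exp (Complex.I * μ * x) * heatKernel N t x)
    rw [neg_zero] at this
    rw [← this, halfTransform]
    congr 1; ext x
    rw [heatKernel_neg hN]
    congr 2
    push_cast; ring
  rw [h1, halfTransform, add_comm, intervalIntegral.integral_Iic_add_Ioi hi.integrableOn
    hi.integrableOn, integral_exp_mul_heatKernel hN hN2 ht]

theorem norm_halfTransform_le (hN : Even N) (hN2 : 2 ≤ N) {t : ℝ} (ht : 0 < t) (μ : ℝ) :
    ‖halfTransform N t μ‖ ≤ totalVariation N := by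
  rw [← integral_norm_heatKernel hN hN2 ht]
  refine (norm_integral_le_integral_norm _).trans ?_
  simp only [norm_mul, norm_exp_I_mul, one_mul, Complex.norm_real]
  exact setIntegral_le_integral (integrable_heatKernel hN hN2 ht).norm
    (Eventually.of_forall fun _ => norm_nonneg _)

theorem halfTransform_scale (hN : Even N) (hN2 : 2 ≤ N) {t : ℝ} (ht : 0 < t) (μ : ℝ) :
    halfTransform N t μ = ∫ x in Set.Ioi (0 : ℝ),
      Complex.exp (Complex.I * μ * (t ^ (1 / N : ℝ) * x : ℝ)) * heatKernel N 1 x := by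
  have h0 : 0 < t ^ (1 / N : ℝ) := Real.rpow_pos_of_pos ht _
  rw [halfTransform, ← integral_indicator measurableSet_Ioi, ← integral_indicator measurableSet_Ioi]
  have := integral_comp_heatKernel hN hN2 ht
    (fun x y => Complex.exp (Complex.I * μ * x) *
      (Set.Ioi (0 : ℝ)).indicator (fun _ => (y : ℂ)) x) (fun c x y => by
      rw [Complex.real_smul]
      by_cases hx : x ∈ Set.Ioi (0 : ℝ) <;> simp [hx]; ring)
  convert this using 2 <;> ext x
  · by_cases hx : x ∈ Set.Ioi (0 : ℝ) <;> simp [hx]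
  have hiff : t ^ (1 / N : ℝ) * x ∈ Set.Ioi (0 : ℝ) ↔ x ∈ Set.Ioi (0 : ℝ) := by
    simp only [Set.mem_Ioi]; exact mul_pos_iff_of_pos_left h0
  by_cases hx : x ∈ Set.Ioi (0 : ℝ)
  · rw [Set.indicator_of_mem hx, Set.indicator_of_mem (hiff.2 hx)]
  · rw [Set.indicator_of_notMem hx, Set.indicator_of_notMem (fun h => hx (hiff.1 h)), mul_zero]

theorem continuousOn_halfTransform (hN : Even N) (hN2 : 2 ≤ N) (μ : ℝ) :
    ContinuousOn (fun t => halfTransform N t μ) (Set.Ioi 0) := by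
  -- After scaling, time enters through the character only, so the fixed function `p(1; ·)`
  -- dominates.
  have h : Continuous fun s : ℝ => ∫ x in Set.Ioi (0 : ℝ),
      Complex.exp (Complex.I * μ * (s * x : ℝ)) * heatKernel N 1 x := by
    refine continuous_of_dominated (bound := fun x => ‖heatKernel N 1 x‖) (fun s => ?_)
      (fun s => Eventually.of_forall fun x => ?_)
      (integrable_heatKernel_one hN hN2).norm.integrableOn (Eventually.of_forall fun x => ?_)
    · have := continuous_heatKernel_one hN hN2
      exact Continuous.aestronglyMeasurable (by fun_prop)
    · rw [norm_mul, norm_exp_I_mul, one_mul, Complex.norm_real]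
    · fun_prop
  have h2 : ContinuousOn (fun t : ℝ => t ^ (1 / N : ℝ)) (Set.Ioi 0) := fun t ht =>
    (Real.continuousAt_rpow_const t _ (Or.inl (ne_of_gt ht))).continuousWithinAt
  exact (h.comp_continuousOn h2).congr fun t ht => halfTransform_scale hN hN2 ht μ

theorem aestronglyMeasurable_heatKernel (hN : Even N) (hN2 : 2 ≤ N) :
    AEStronglyMeasurable (fun p : ℝ × ℝ => heatKernel N p.1 p.2)
      ((volume.restrict (Set.Ioi 0)).prod volume) := by
  have h1 : ContinuousOn (fun p : ℝ × ℝ => heatKernel N p.1 p.2) (Set.Ioi 0 ×ˢ Set.univ) := by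
    have hc := continuous_heatKernel_one hN hN2
    have h2 : ContinuousOn (fun p : ℝ × ℝ => p.1 ^ (-(1 / N : ℝ))) (Set.Ioi 0 ×ˢ Set.univ) :=
      fun p hp => (ContinuousAt.rpow_const (by fun_prop)
        (Or.inl (ne_of_gt hp.1))).continuousWithinAt
    refine ContinuousOn.congr (f := fun p : ℝ × ℝ => p.1 ^ (-(1 / N : ℝ)) *
      heatKernel N 1 (p.1 ^ (-(1 / N : ℝ)) * p.2)) ?_ fun p hp => heatKernel_scale hN hN2 hp.1 _
    exact h2.mul (hc.comp_continuousOn (h2.mul continuous_snd.continuousOn))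
  have := h1.aestronglyMeasurable (μ := volume) (measurableSet_Ioi.prod MeasurableSet.univ)
  rwa [Measure.volume_eq_prod, ← Measure.prod_restrict, Measure.restrict_univ] at this

theorem integrable_exp_mul_heatKernel (hN : Even N) (hN2 : 2 ≤ N) {l : ℝ} (hl : 0 < l) :
    Integrable (fun p : ℝ × ℝ => (Real.exp (-l * p.1) * heatKernel N p.1 p.2 : ℝ))
      ((volume.restrict (Set.Ioi 0)).prod volume) := by
  have hm : AEStronglyMeasurable (fun p : ℝ × ℝ => Real.exp (-l * p.1) * heatKernel N p.1 p.2)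
      ((volume.restrict (Set.Ioi 0)).prod volume) :=
    (Continuous.aestronglyMeasurable (by fun_prop)).mul (aestronglyMeasurable_heatKernel hN hN2)
  rw [integrable_prod_iff hm]
  constructor
  · filter_upwards [self_mem_ae_restrict measurableSet_Ioi] with t ht
    exact (integrable_heatKernel hN hN2 ht).const_mul _
  · have h1 : IntegrableOn (fun t => Real.exp (-l * t) * totalVariation N) (Set.Ioi 0) :=
      (integrableOn_exp_mul_Ioi (by linarith) 0).mul_const _
    refine h1.congr ?_
    filter_upwards [self_mem_ae_restrict measurableSet_Ioi] with t ht
    simp only [norm_mul]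
    rw [integral_const_mul, integral_norm_heatKernel hN hN2 ht, Real.norm_of_nonneg
      (Real.exp_pos _).le]

theorem isPlus_inv (hN2 : 2 ≤ N) {θ : ℂ} (h : θ ∈ rootsJ N) {a : ℝ} (ha : 0 < a) :
    IsPlus fun μ => (θ * a - Complex.I * μ)⁻¹ := by
  have hre : 0 < (θ * a).re := by
    rw [Complex.re_mul_ofReal]; exact mul_pos ((mem_rootsJ hN2).1 h).2 ha
  refine ⟨(Set.Ioi (0 : ℝ)).indicator fun x => Complex.exp (-(θ * a) * x), ?_,
    fun x hx => Set.indicator_of_notMem (by simpa using hx) _, fun μ => ?_⟩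
  · rw [integrable_indicator_iff measurableSet_Ioi]
    exact integrableOn_exp_mul_complex_Ioi (by simpa using hre) 0
  · have h1 : ∀ x : ℝ, Complex.exp (Complex.I * μ * x) *
        (Set.Ioi (0 : ℝ)).indicator (fun x : ℝ => Complex.exp (-(θ * a) * x)) x =
        (Set.Ioi (0 : ℝ)).indicator (fun x : ℝ =>
          Complex.exp ((Complex.I * μ - θ * a) * x)) x := by
      intro x
      by_cases hx : x ∈ Set.Ioi (0 : ℝ)
      · rw [Set.indicator_of_mem hx, Set.indicator_of_mem hx, ← Complex.exp_add]; congr 1; ring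
      · rw [Set.indicator_of_notMem hx, Set.indicator_of_notMem hx, mul_zero]
    simp only [h1]
    rw [integral_indicator measurableSet_Ioi,
      integral_exp_mul_complex_Ioi (by simpa using hre)]
    simp only [Complex.ofReal_zero, mul_zero, Complex.exp_zero]
    rw [neg_div, ← div_neg, neg_sub, one_div]

theorem rpow_inv_pow (hN2 : 2 ≤ N) {l : ℝ} (hl : 0 < l) : (l ^ (1 / N : ℝ)) ^ N = l := by
  have hN0 : (N : ℝ) ≠ 0 := by exact_mod_cast (by omega : N ≠ 0)
  rw [← Real.rpow_natCast, ← Real.rpow_mul hl.le, one_div_mul_cancel hN0, Real.rpow_one]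

/-- The Laplace transform in time of `halfTransform`. -/
theorem integral_exp_mul_halfTransform (hN : Even N) (hN2 : 2 ≤ N) {l : ℝ} (hl : 0 < l) (μ : ℝ) :
    ∫ t in Set.Ioi (0 : ℝ), (Real.exp (-l * t) : ℂ) * halfTransform N t μ =
      ∑ θ ∈ rootsJ N, ((1 / N * l ^ (1 / N - 1 : ℝ) : ℝ) : ℂ) *
        (θ * (θ * (l ^ (1 / N : ℝ) : ℝ) - Complex.I * μ)⁻¹) := by
  set a := l ^ (1 / N : ℝ) with ha
  have ha0 : 0 < a := Real.rpow_pos_of_pos hl _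
  set G : ℝ → ℂ := fun μ => ∫ t in Set.Ioi (0 : ℝ), (Real.exp (-l * t) : ℂ) *
    halfTransform N t μ with hG
  set H : ℝ → ℂ := fun μ => ∑ θ ∈ rootsJ N, ((1 / N * l ^ (1 / N - 1 : ℝ) : ℝ) : ℂ) *
        (θ * (θ * a - Complex.I * μ)⁻¹) with hH
  have hHplus : IsPlus H := by
    have h1 : IsPlus (∑ θ ∈ rootsJ N, fun μ : ℝ => ((1 / N * l ^ (1 / N - 1 : ℝ) : ℝ) : ℂ) *
        (θ * (θ * a - Complex.I * μ)⁻¹)) :=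
      IsPlus.sum fun θ hθ => ((isPlus_inv hN2 hθ ha0).const_mul θ).const_mul _
    convert h1 using 1
    ext μ; simp [hH]
  have hi := integrable_exp_mul_heatKernel hN hN2 hl
  have hGplus : IsPlus G := by
    refine ⟨(Set.Ioi (0 : ℝ)).indicator fun x => ∫ t in Set.Ioi (0 : ℝ),
      ((Real.exp (-l * t) * heatKernel N t x : ℝ) : ℂ), ?_,
      fun x hx => Set.indicator_of_notMem (by simpa using hx) _, fun μ => ?_⟩
    · exact ((integrable_ofReal_comp hi).integral_prod_right).indicator measurableSet_Ioi
    · have h1 : ∀ x : ℝ, Complex.exp (Complex.I * μ * x) *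
          (Set.Ioi (0 : ℝ)).indicator (fun x => ∫ t in Set.Ioi (0 : ℝ),
            ((Real.exp (-l * t) * heatKernel N t x : ℝ) : ℂ)) x =
          (Set.Ioi (0 : ℝ)).indicator (fun x => ∫ t in Set.Ioi (0 : ℝ),
            Complex.exp (Complex.I * μ * x) *
            ((Real.exp (-l * t) * heatKernel N t x : ℝ) : ℂ)) x := by
        intro x
        by_cases hx : x ∈ Set.Ioi (0 : ℝ)
        · rw [Set.indicator_of_mem hx, Set.indicator_of_mem hx, ← integral_const_mul]
        · rw [Set.indicator_of_notMem hx, Set.indicator_of_notMem hx, mul_zero]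
      simp only [h1]
      rw [integral_indicator measurableSet_Ioi, integral_integral_swap]
      · simp only [hG, halfTransform, ← integral_const_mul]
        congr 1; ext t; congr 1; ext x
        push_cast; ring
      · have h2 : Integrable (fun p : ℝ × ℝ => ((Real.exp (-l * p.1) * heatKernel N p.1 p.2 : ℝ) : ℂ))
            ((volume.restrict (Set.Ioi 0)).prod (volume.restrict (Set.Ioi 0))) :=
          (integrable_ofReal_comp hi).mono_measure
            (Measure.prod_mono le_rfl Measure.restrict_le_self)
        exact h2.swap.bdd_mul (c := 1) (Continuous.aestronglyMeasurable (by fun_prop))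
          (Eventually.of_forall fun p => (norm_exp_I_mul μ p.1).le)
  have hintG : ∀ μ, IntegrableOn (fun t => (Real.exp (-l * t) : ℂ) * halfTransform N t μ)
      (Set.Ioi 0) := by
    intro μ
    refine ((integrableOn_exp_mul_Ioi (by linarith : -l < 0) 0).mul_const
      (totalVariation N)).mono' ?_ ?_
    · exact (Continuous.aestronglyMeasurable (by fun_prop)).mul
        ((continuousOn_halfTransform hN hN2 μ).aestronglyMeasurable measurableSet_Ioi)
    · filter_upwards [self_mem_ae_restrict measurableSet_Ioi] with t ht
      rw [norm_mul, Complex.norm_real, Real.norm_of_nonneg (Real.exp_pos _).le]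
      exact mul_le_mul_of_nonneg_left (norm_halfTransform_le hN hN2 ht μ) (Real.exp_pos _).le
  -- Both sides are `1 / (l + μᴺ)`: the left by integrating `e^{-(l+μᴺ)t}`, the right by
  -- `sum_div_rootsJ`.
  have hsum : ∀ μ, G μ + G (-μ) = H μ + H (-μ) := by
    intro μ
    have hpos : 0 < l + μ ^ N := by have := hN.pow_nonneg μ; linarith
    have h1 : G μ + G (-μ) = ((l + μ ^ N : ℝ) : ℂ)⁻¹ := by
      simp only [hG]
      rw [← integral_add (hintG μ) (hintG (-μ))]
      have h2 : ∀ t ∈ Set.Ioi (0 : ℝ), (Real.exp (-l * t) : ℂ) * halfTransform N t μ +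
          (Real.exp (-l * t) : ℂ) * halfTransform N t (-μ) =
          Complex.exp (((-(l + μ ^ N) : ℝ) : ℂ) * t) := by
        intro t ht
        rw [← mul_add, halfTransform_add_neg hN hN2 ht, Complex.ofReal_exp, Complex.ofReal_exp,
          ← Complex.exp_add]
        congr 1; push_cast; ring
      rw [setIntegral_congr_fun measurableSet_Ioi h2,
        integral_exp_mul_complex_Ioi (by rw [Complex.ofReal_re]; linarith)]
      simp only [Complex.ofReal_zero, mul_zero, Complex.exp_zero, Complex.ofReal_neg]
      rw [neg_div_neg_eq, one_div]
    have h3 : H μ + H (-μ) = ((l + μ ^ N : ℝ) : ℂ)⁻¹ := by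
      have h4 := sum_div_rootsJ hN hN2 ha0 μ
      have hN0 : (N : ℝ) ≠ 0 := by exact_mod_cast (by omega : N ≠ 0)
      have haN : a ^ N = l := rpow_inv_pow hN2 hl
      have h5 : ((1 / N * l ^ (1 / N - 1 : ℝ) : ℝ)) * (N * a ^ (N - 1)) = 1 := by
        have : a ^ (N - 1) * a = l := by rw [← haN, ← pow_succ]; congr 1; omega
        rw [Real.rpow_sub hl, Real.rpow_one, ← ha]
        field_simp
        linarith
      have e : ∀ θ : ℂ, θ * a + Complex.I * μ = θ * a - Complex.I * ((-μ : ℝ) : ℂ) := fun θ => by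
        push_cast; ring
      simp only [hH, ← Finset.mul_sum, ← mul_add]
      simp only [e] at h4
      simp only [div_eq_mul_inv] at h4 ⊢
      rw [h4]
      have h6 : (((1 * (N : ℝ)⁻¹ * l ^ (1 * (N : ℝ)⁻¹ - 1 : ℝ) : ℝ)) : ℂ) *
          (N * (a : ℂ) ^ (N - 1)) = 1 := by
        simp only [div_eq_mul_inv] at h5
        exact_mod_cast h5
      rw [← mul_assoc, h6, one_mul]
      congr 1
      rw [← haN]; push_cast; ring
    rw [h1, h3]
  -- By `hsum` the difference `G - H` is odd. It is a positive-side transform, so by oddness it is a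
  -- negative-side one too, and vanishes.
  have hzero : (G + fun μ => (-1 : ℂ) * H μ) = 0 := by
    refine (hGplus.add (hHplus.const_mul (-1))).eq_zero ?_
    have : (fun μ => (G + fun μ => (-1 : ℂ) * H μ) (-μ)) = (H + fun μ => (-1 : ℂ) * G μ) := by
      ext μ
      simp only [Pi.add_apply]
      linear_combination hsum μ
    rw [this]
    exact hHplus.add (hGplus.const_mul (-1))
  have := congrFun hzero μ
  simp only [Pi.add_apply, Pi.zero_apply] at this
  linear_combination this

end HeatKernel

/-! ### Exponentials of power series -/

/-- The coefficients of `exp (∑ c_n z ^ (n + 1) / (n + 1))`. -/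
def expSeq (c : ℕ → ℂ) : ℕ → ℂ
  | 0 => 1
  | n + 1 => (1 / (n + 1)) * ∑ j : Fin (n + 1), c (n - j) * expSeq c j
termination_by n => n
decreasing_by omega

theorem expSeq_zero (c : ℕ → ℂ) : expSeq c 0 = 1 := by rw [expSeq]

theorem expSeq_succ (c : ℕ → ℂ) (n : ℕ) :
    expSeq c (n + 1) = (1 / (n + 1)) * ∑ j ∈ Finset.range (n + 1), c (n - j) * expSeq c j := by
  rw [expSeq, Finset.sum_range]

/-- The constant coefficient `1` is not the transform of an integrable function, hence the shift to
positive index. The coefficients of positive index are polynomials in the `c j` without constant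
term. -/
theorem IsPlus.expSeq {c : ℕ → ℝ → ℂ} (hc : ∀ j, IsPlus (c j)) (k : ℕ) :
    IsPlus fun μ => expSeq (fun j => c j μ) (k + 1) := by
  induction k using Nat.strong_induction_on with
  | _ k ih =>
    simp only [expSeq_succ]
    refine IsPlus.const_mul (g := fun μ => ∑ j ∈ Finset.range (k + 1),
      c (k - j) μ * PseudoProcess.expSeq (fun j => c j μ) j) ?_ _
    have h : IsPlus (∑ j ∈ Finset.range (k + 1), fun μ =>
      c (k - j) μ * PseudoProcess.expSeq (fun j => c j μ) j) := by
      refine IsPlus.sum fun j hj => ?_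
      rw [Finset.mem_range] at hj
      cases j with
      | zero => simpa only [expSeq_zero, mul_one] using! hc _
      | succ j => exact (hc _).mul (ih j (by omega))
    convert h using 1
    ext μ; simp

open PowerSeries in
-- The differential equation `F' = cF` with `F(0) = 1` determines the coefficients recursively.
theorem coeff_eq_expSeq {c : ℕ → ℂ} {F : PowerSeries ℂ}
    (hF : d⁄dX ℂ F = PowerSeries.mk c * F) (h0 : PowerSeries.coeff 0 F = 1) (n : ℕ) :
    PowerSeries.coeff n F = expSeq c n := by
  induction n using Nat.strong_induction_on with
  | _ n ih =>
    cases n with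
    | zero => rw [h0, expSeq_zero]
    | succ n =>
      have h := congrArg (PowerSeries.coeff n) hF
      rw [PowerSeries.coeff_derivative, mul_comm (PowerSeries.mk c), PowerSeries.coeff_mul,
        Finset.Nat.sum_antidiagonal_eq_sum_range_succ_mk] at h
      have h1 : ((n : ℂ) + 1) ≠ 0 := by exact_mod_cast Nat.succ_ne_zero n
      rw [expSeq_succ, one_div, eq_inv_mul_iff_mul_eq₀ h1, mul_comm, h]
      refine Finset.sum_congr rfl fun j hj => ?_
      rw [Finset.mem_range] at hj
      rw [ih j (by omega), PowerSeries.coeff_mk, mul_comm]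

open PowerSeries in
theorem derivative_mk_expSeq (c : ℕ → ℂ) :
    d⁄dX ℂ (PowerSeries.mk (expSeq c)) = PowerSeries.mk c * PowerSeries.mk (expSeq c) := by
  ext n
  rw [PowerSeries.coeff_derivative, mul_comm (PowerSeries.mk c), PowerSeries.coeff_mul,
    Finset.Nat.sum_antidiagonal_eq_sum_range_succ_mk, PowerSeries.coeff_mk, expSeq_succ]
  have h1 : ((n : ℂ) + 1) ≠ 0 := by exact_mod_cast Nat.succ_ne_zero n
  rw [mul_comm, ← mul_assoc, mul_one_div_cancel h1, one_mul]
  refine Finset.sum_congr rfl fun j hj => ?_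
  rw [PowerSeries.coeff_mk, PowerSeries.coeff_mk, mul_comm]

/-- Multiplication of `exp (∑ c_n z ^ (n + 1) / (n + 1))` by `1 - φ z`. -/
theorem expSeq_sub_pow (c : ℕ → ℂ) (φ : ℂ) (n : ℕ) :
    expSeq (fun j => c j - φ ^ (j + 1)) (n + 1) = expSeq c (n + 1) - φ * expSeq c n := by
  -- The logarithmic derivative of `1 - φz` is `-∑ φ^(j+1) z^j`; this is that fact with the
  -- denominator cleared.
  have hgeo : (1 - PowerSeries.C φ * PowerSeries.X) * PowerSeries.mk (fun j => φ ^ (j + 1)) =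
      PowerSeries.C φ := by
    ext n
    rw [sub_mul, one_mul, map_sub, mul_assoc, PowerSeries.coeff_C_mul, PowerSeries.coeff_C]
    cases n with
    | zero => simp
    | succ n => rw [PowerSeries.coeff_succ_X_mul]; simp; ring
  rw [← coeff_eq_expSeq (F := (1 - PowerSeries.C φ * PowerSeries.X) * PowerSeries.mk (expSeq c))]
  · rw [sub_mul, one_mul, map_sub, mul_assoc, PowerSeries.coeff_C_mul, PowerSeries.coeff_succ_X_mul,
      PowerSeries.coeff_mk, PowerSeries.coeff_mk]
  · rw [Derivation.leibniz, derivative_mk_expSeq]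
    have h1 : PowerSeries.mk (fun j => c j - φ ^ (j + 1)) =
      PowerSeries.mk c - PowerSeries.mk (fun j => φ ^ (j + 1)) := by ext; simp
    have h2 : PowerSeries.derivative ℂ (1 - PowerSeries.C φ * PowerSeries.X) = -PowerSeries.C φ := by
      rw [map_sub, Derivation.leibniz]
      simp
    rw [h1, h2, smul_eq_mul, smul_eq_mul]
    linear_combination (PowerSeries.mk (expSeq c)) * hgeo
  · rw [sub_mul, one_mul, map_sub, mul_assoc, PowerSeries.coeff_C_mul]
    simp [expSeq_zero]

/-- The extremal case is `c` constant equal to `m + 1`, where the exponential is `(1 - z)^{-(m+1)}`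
with these binomial coefficients. So bounded `c` suffices for convergence in the unit disc. -/
theorem norm_expSeq_le {c : ℕ → ℂ} {m : ℕ} (hc : ∀ n, ‖c n‖ ≤ m + 1) (n : ℕ) :
    ‖expSeq c n‖ ≤ ((n + m).choose m : ℝ) := by
  induction n using Nat.strong_induction_on with
  | _ n ih =>
    cases n with
    | zero => simp [expSeq_zero]
    | succ n =>
      have hn : (0 : ℝ) < n + 1 := by positivity
      have h1 : ‖((n : ℂ) + 1)‖ = n + 1 := by
        rw [show ((n : ℂ) + 1) = ((n + 1 : ℝ) : ℂ) by push_cast; rfl, Complex.norm_real,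
          Real.norm_of_nonneg hn.le]
      rw [expSeq_succ, norm_mul, norm_div, h1, norm_one, one_div, inv_mul_le_iff₀ hn]
      calc ‖∑ j ∈ Finset.range (n + 1), c (n - j) * expSeq c j‖
          ≤ ∑ j ∈ Finset.range (n + 1), ((m : ℝ) + 1) * ((j + m).choose m : ℝ) := by
            refine (norm_sum_le _ _).trans (Finset.sum_le_sum fun j hj => ?_)
            rw [Finset.mem_range] at hj
            rw [norm_mul]
            exact mul_le_mul (hc _) (ih j (by omega)) (norm_nonneg _) (by positivity)
        _ = ((m + 1) * (n + m + 1).choose (m + 1) : ℕ) := by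
            rw [← Finset.mul_sum, ← Nat.sum_range_add_choose]; push_cast; ring
        _ = ((n + 1) * (n + 1 + m).choose m : ℕ) := by
            congr 1
            have := Nat.choose_succ_right_eq (n + m + 1) m
            rw [show n + m + 1 - m = n + 1 by omega] at this
            rw [show n + 1 + m = n + m + 1 by ring]
            linarith
        _ = _ := by push_cast; ring

theorem summable_mul_pow_of_le {a : ℕ → ℂ} {m : ℕ} (ha : ∀ n, ‖a n‖ ≤ ((n + m).choose m : ℝ))
    {z : ℂ} (hz : ‖z‖ < 1) : Summable fun n => ‖a n * z ^ n‖ := by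
  have h := summable_choose_mul_geometric_of_norm_lt_one (R := ℝ) m (r := ‖z‖) (by simpa using hz)
  refine h.of_nonneg_of_le (fun n => norm_nonneg _) fun n => ?_
  rw [norm_mul, norm_pow]
  exact mul_le_mul_of_nonneg_right (ha n) (by positivity)

theorem hasDerivAt_tsum_mul_pow {a : ℕ → ℂ} {m : ℕ} (ha : ∀ n, ‖a n‖ ≤ ((n + m).choose m : ℝ))
    {z : ℂ} (hz : ‖z‖ < 1) :
    HasDerivAt (fun z => ∑' n, a n * z ^ n) (∑' n : ℕ, ((n : ℂ) + 1) * a (n + 1) * z ^ n) z := by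
  obtain ⟨r, hzr, hr1⟩ := exists_between hz
  have hr0 : 0 ≤ r := (norm_nonneg z).trans hzr.le
  -- Majorant of the differentiated terms on the disc of radius `r`, where `‖z‖ < r < 1`; up to the
  -- factor `m + 1` it is again a binomial series, of order `m + 1`.
  set u : ℕ → ℝ := fun n => ((n + m).choose m : ℝ) * (n * r ^ (n - 1)) with hu
  have hus : Summable u := by
    rw [← summable_nat_add_iff 1]
    have h := (summable_choose_mul_geometric_of_norm_lt_one (R := ℝ) (m + 1) (r := r)
      (by rwa [Real.norm_of_nonneg hr0])).mul_left ((m : ℝ) + 1)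
    refine h.congr fun n => ?_
    have h2 := Nat.choose_succ_right_eq (n + 1 + m) m
    rw [show n + 1 + m - m = n + 1 by omega] at h2
    have h3 : (((n + 1 + m).choose (m + 1) : ℕ) : ℝ) * (m + 1) =
      ((n + 1 + m).choose m : ℕ) * (n + 1) := by exact_mod_cast h2
    simp only [hu, Nat.add_sub_cancel]
    rw [show n + (m + 1) = n + 1 + m by ring]
    push_cast
    linear_combination (r ^ n) * h3
  have key := hasDerivAt_tsum_of_isPreconnected (t := Metric.ball (0 : ℂ) r) (u := u)
    (g := fun n z => a n * z ^ n) (g' := fun n z => a n * (n * z ^ (n - 1))) (y₀ := 0) (y := z) hus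
    Metric.isOpen_ball (convex_ball _ _).isPreconnected
    (fun n y _ => (hasDerivAt_pow n y).const_mul _) (fun n y hy => ?_)
    (by simpa using (norm_nonneg z).trans_lt hzr) ?_ (by simpa using hzr)
  · have hs : Summable fun n => a n * (n * z ^ (n - 1)) := by
      refine Summable.of_norm_bounded hus fun n => ?_
      simp only [hu]
      rw [norm_mul, norm_mul, norm_pow, Complex.norm_natCast]
      gcongr
      exact ha n
    rw [hs.tsum_eq_zero_add] at key
    simp only [Nat.cast_zero, zero_mul, mul_zero, zero_add, Nat.add_sub_cancel] at key
    refine key.congr_deriv (tsum_congr fun n => ?_)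
    push_cast; ring
  · simp only [hu]
    rw [norm_mul, norm_mul, norm_pow, Complex.norm_natCast]
    have hy' : ‖y‖ ≤ r := by simpa using (Metric.mem_ball.1 hy).le
    gcongr
    exact ha n
  · exact (summable_mul_pow_of_le ha (z := 0) (by simp)).of_norm

/-- If `L` is the exponent and `E` the series, the recursion gives `E' = L'E`, so `E e^{-L}` is
constant on the disc, with value `1` at the origin. -/
theorem tsum_expSeq {c : ℕ → ℂ} {m : ℕ} (hc : ∀ n, ‖c n‖ ≤ m + 1) {z : ℂ} (hz : ‖z‖ < 1) :
    ∑' n, expSeq c n * z ^ n = Complex.exp (∑' n, c n / (n + 1) * z ^ (n + 1)) := by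
  set a : ℕ → ℂ := fun n => if n = 0 then 0 else c (n - 1) / n with ha
  have hab : ∀ n, ‖a n‖ ≤ ((n + (m + 1)).choose (m + 1) : ℝ) := by
    intro n
    rcases Nat.eq_zero_or_pos n with rfl | hn
    · simp [ha]
    · have h1 : (m : ℝ) + 1 ≤ ((n + (m + 1)).choose (m + 1) : ℝ) := by
        have : (m + 2).choose (m + 1) ≤ (n + (m + 1)).choose (m + 1) :=
          Nat.choose_le_choose _ (by omega)
        rw [Nat.choose_succ_self_right] at this
        have h2 : ((m + 1 + 1 : ℕ) : ℝ) ≤ ((n + (m + 1)).choose (m + 1) : ℝ) := by exact_mod_cast this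
        push_cast at h2
        linarith
      simp only [ha, hn.ne', if_false]
      rw [norm_div, Complex.norm_natCast]
      have h3 : (1 : ℝ) ≤ n := by exact_mod_cast hn
      exact ((div_le_self (norm_nonneg _) h3).trans (hc _)).trans h1
  have hcb : ∀ n, ‖c n * (1 / ((m : ℂ) + 1))‖ ≤ ((n + 0).choose 0 : ℝ) := by
    intro n
    have hm : ‖((m : ℂ) + 1)‖ = m + 1 := by
      rw [show ((m : ℂ) + 1) = ((m + 1 : ℝ) : ℂ) by push_cast; rfl, Complex.norm_real,
          Real.norm_of_nonneg (by positivity)]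
    rw [norm_mul, norm_div, hm, norm_one, mul_one_div, Nat.choose_zero_right, Nat.cast_one,
      div_le_one (by positivity)]
    exact hc n
  have hcs : ∀ z : ℂ, ‖z‖ < 1 → Summable fun n => ‖c n * z ^ n‖ := fun z hz => by
    have h := (summable_mul_pow_of_le hcb hz).mul_left ‖((m : ℂ) + 1)‖
    refine h.congr fun n => ?_
    have hm : ((m : ℂ) + 1) ≠ 0 := by exact_mod_cast Nat.succ_ne_zero m
    rw [← norm_mul]
    congr 1; field_simp
  have hL : ∀ z : ℂ, ‖z‖ < 1 → HasDerivAt (fun z => ∑' n, a n * z ^ n) (∑' n, c n * z ^ n) z := by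
    intro z hz
    refine (hasDerivAt_tsum_mul_pow hab hz).congr_deriv (tsum_congr fun n => ?_)
    have h1 : ((n : ℂ) + 1) ≠ 0 := by exact_mod_cast Nat.succ_ne_zero n
    simp only [ha, Nat.succ_ne_zero, if_false, Nat.add_sub_cancel]
    push_cast
    field_simp
  have hE : ∀ z : ℂ, ‖z‖ < 1 → HasDerivAt (fun z => ∑' n, expSeq c n * z ^ n)
      ((∑' n, expSeq c n * z ^ n) * ∑' n, c n * z ^ n) z := by
    intro z hz
    refine (hasDerivAt_tsum_mul_pow (norm_expSeq_le hc) hz).congr_deriv ?_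
    rw [tsum_mul_tsum_eq_tsum_sum_antidiagonal_of_summable_norm
      (summable_mul_pow_of_le (norm_expSeq_le hc) hz) (hcs z hz)]
    refine tsum_congr fun n => ?_
    have h1 : ((n : ℂ) + 1) ≠ 0 := by exact_mod_cast Nat.succ_ne_zero n
    rw [Finset.Nat.sum_antidiagonal_eq_sum_range_succ_mk, expSeq_succ, ← mul_assoc,
      mul_one_div_cancel h1, one_mul, Finset.sum_mul]
    refine Finset.sum_congr rfl fun j hj => ?_
    rw [Finset.mem_range] at hj
    have : z ^ n = z ^ j * z ^ (n - j) := by rw [← pow_add]; congr 1; omega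
    rw [this]; ring
  have hG : ∀ z : ℂ, ‖z‖ < 1 → HasDerivAt (fun z => (∑' n, expSeq c n * z ^ n) *
      Complex.exp (-∑' n, a n * z ^ n)) 0 z := by
    intro z hz
    refine ((hE z hz).mul (hL z hz).neg.cexp).congr_deriv ?_
    ring
  have hball : ∀ z : ℂ, z ∈ Metric.ball (0 : ℂ) 1 ↔ ‖z‖ < 1 := fun z => by simp
  have hconst := (Metric.isOpen_ball (x := (0 : ℂ)) (ε := 1)).is_const_of_deriv_eq_zero (𝕜 := ℂ)
    (convex_ball (0 : ℂ) 1).isPreconnected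
    (fun z hz => (hG z ((hball z).1 hz)).differentiableAt.differentiableWithinAt)
    (fun z hz => (hG z ((hball z).1 hz)).deriv) ((hball z).2 hz) ((hball 0).2 (by simp))
  have h0 : (∑' n, expSeq c n * (0 : ℂ) ^ n) = 1 := by
    rw [tsum_eq_single 0 (fun n hn => by simp [hn])]; simp [expSeq_zero]
  have h0' : (∑' n, a n * (0 : ℂ) ^ n) = 0 := by
    rw [tsum_eq_single 0 (fun n hn => by simp [hn])]; simp [ha]
  rw [h0, h0', neg_zero, Complex.exp_zero, mul_one] at hconst
  have hLz : ∑' n, a n * z ^ n = ∑' n, c n / (n + 1) * z ^ (n + 1) := by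
    rw [(summable_mul_pow_of_le hab hz).of_norm.tsum_eq_zero_add]
    simp [ha]
  rw [← hLz, ← mul_one (Complex.exp _), ← hconst, mul_left_comm, ← Complex.exp_add]
  simp

/-! ### The Wiener-Hopf factorization -/

section WienerHopf

variable {N : ℕ}

/-- The logarithmic coefficients of the factor of the generating function on the positive side. -/
def whPlus (N : ℕ) (h w : ℝ) (j : ℕ) (μ : ℝ) : ℂ :=
  ((w : ℂ) ^ (j + 1) - 1) * halfTransform N ((j + 1) * h) μ

/-- The logarithmic coefficients of the factor of the generating function on the negative side. -/
def whMinus (N : ℕ) (h w : ℝ) (j : ℕ) (μ : ℝ) : ℂ :=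
  (1 - (w : ℂ) ^ (j + 1)) * halfTransform N ((j + 1) * h) (-μ)

/-- With `φ = e^{-hμᴺ}`, the additive splitting of `φ^(j+1)` gives `whMinus_j - φ^(j+1) = whPlus_j -
(wφ)^(j+1)`. Exponentiating, the two factors satisfy `(1 - φz) E₋ = (1 - wφz) E₊`, read here
coefficientwise. -/
theorem expSeq_whPlus_whMinus (hN : Even N) (hN2 : 2 ≤ N) {h : ℝ} (hh : 0 < h) (w μ : ℝ) (n : ℕ) :
    expSeq (fun j => whMinus N h w j μ) (n + 1) -
        Real.exp (-(h * μ ^ N)) * expSeq (fun j => whMinus N h w j μ) n =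
      expSeq (fun j => whPlus N h w j μ) (n + 1) -
        w * Real.exp (-(h * μ ^ N)) * expSeq (fun j => whPlus N h w j μ) n := by
  rw [← expSeq_sub_pow, ← expSeq_sub_pow]
  congr 1; ext j
  have h1 := halfTransform_add_neg hN hN2 (t := (j + 1) * h) (by positivity) μ
  have h2 : (Real.exp (-((j + 1) * h * μ ^ N)) : ℂ) = (Real.exp (-(h * μ ^ N)) : ℂ) ^ (j + 1) := by
    rw [← Complex.ofReal_pow, ← Real.exp_nat_mul]
    congr 2; push_cast; ring
  rw [h2] at h1
  rw [whMinus, whPlus, mul_pow, ← h1]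
  ring

/-- The two sequences of transforms with the recursion of the random walk and the support
properties of its restrictions to the two half-lines are given by the Wiener-Hopf factors. -/
theorem wienerHopf_unique (hN : Even N) (hN2 : 2 ≤ N) {h w : ℝ} (hh : 0 < h) (hw : w ≠ 1)
    {Qp Qm : ℕ → ℝ → ℂ} (hp0 : Qp 0 = 1) (hm0 : Qm 0 = 0)
    (hp : ∀ k, IsPlus (Qp (k + 1))) (hm : ∀ k, IsPlus fun μ => Qm (k + 1) (-μ))
    (hrec : ∀ k μ, Qp (k + 1) μ + Qm (k + 1) μ =
      Real.exp (-(h * μ ^ N)) * (w * Qp k μ + Qm k μ)) (k : ℕ) :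
    (∀ μ, (1 - w) * Qp k μ = (if k = 0 then 1 else 0) - w * expSeq (fun j => whPlus N h w j μ) k) ∧
    ∀ μ, (1 - w) * Qm k μ = w * (expSeq (fun j => whMinus N h w j μ) k - if k = 0 then 1 else 0) := by
  have hw' : (1 - (w : ℂ)) ≠ 0 := by
    rw [sub_ne_zero]; exact_mod_cast hw.symm
  induction k with
  | zero => simp [hp0, hm0, expSeq_zero]
  | succ k ih =>
    obtain ⟨ih1, ih2⟩ := ih
    simp only [Nat.succ_ne_zero, if_false, zero_sub, sub_zero]
    -- `D` and `D'` are the deviations from the claimed formulas on the positive and on the negative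
    -- side. Their sum is zero by the recursion, so each vanishes.
    set D : ℝ → ℂ := fun μ => (1 - w) * Qp (k + 1) μ +
      w * expSeq (fun j => whPlus N h w j μ) (k + 1) with hD
    set D' : ℝ → ℂ := fun μ => (1 - w) * Qm (k + 1) μ +
      (-w) * expSeq (fun j => whMinus N h w j μ) (k + 1) with hD'
    have hpos : ∀ j : ℕ, 0 < ((j : ℝ) + 1) * h := fun j => by positivity
    have hDp : IsPlus D := ((hp k).const_mul _).add ((IsPlus.expSeq
      (fun j => (isPlus_halfTransform hN hN2 (hpos j)).const_mul _) k).const_mul _)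
    have hDm : IsPlus fun μ => D' (-μ) := by
      refine ((hm k).const_mul _).add (IsPlus.const_mul (g := fun μ =>
        expSeq (fun j => whMinus N h w j (-μ)) (k + 1)) ?_ _)
      refine IsPlus.expSeq (c := fun j μ => whMinus N h w j (-μ)) (fun j => ?_) k
      simp only [whMinus, neg_neg]
      exact (isPlus_halfTransform hN hN2 (hpos j)).const_mul _
    have hsum : ∀ μ, D μ + D' μ = 0 := by
      intro μ
      have e := expSeq_whPlus_whMinus hN hN2 hh w μ k
      have r := hrec k μ
      simp only [hD, hD']
      linear_combination (1 - (w : ℂ)) * r - w * e + Real.exp (-(h * μ ^ N)) * w * ih1 μ +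
        Real.exp (-(h * μ ^ N)) * ih2 μ
    have hD0 : D = 0 := by
      refine hDp.eq_zero ?_
      have : (fun μ => D (-μ)) = fun μ => (-1 : ℂ) * D' (-μ) := by
        ext μ; linear_combination hsum (-μ)
      rw [this]
      exact hDm.const_mul _
    constructor
    · intro μ
      have := congrFun hD0 μ
      simp only [hD, Pi.zero_apply] at this
      linear_combination this
    · intro μ
      have h1 := hsum μ
      rw [hD0, Pi.zero_apply, zero_add] at h1
      simp only [hD'] at h1
      linear_combination h1

end WienerHopf

/-! ### Expectations of tame functionals -/

section Tame

variable {N : ℕ}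

theorem measurable_discretePath {k : ℕ} (j : ℕ) :
    Measurable fun x : Fin k → ℝ => discretePath x j := by
  cases j with
  | zero => simp only [discretePath]; exact measurable_const
  | succ j =>
    simp only [discretePath]
    split_ifs
    · exact measurable_pi_apply _
    · exact measurable_const

theorem discretePath_snoc {k j : ℕ} (hj : j ≤ k) (x : Fin k → ℝ) (a : ℝ) :
    discretePath (Fin.snoc (α := fun _ => ℝ) x a) j = discretePath x j := by
  cases j with
  | zero => simp [discretePath]
  | succ j =>
    have h1 : j < k + 1 := by omega
    have h2 : j < k := by omega
    simp [discretePath, h1, h2, Fin.snoc]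

theorem discretePath_snoc_last {k : ℕ} (x : Fin k → ℝ) (a : ℝ) :
    discretePath (Fin.snoc (α := fun _ => ℝ) x a) (k + 1) = a := by
  simp [discretePath, Fin.snoc]

/-- The signed density of the first `k` observations at time step `h`. -/
def pathKernel (N : ℕ) (h : ℝ) (k : ℕ) (x : Fin k → ℝ) : ℝ :=
  ∏ j : Fin k, heatKernel N h (discretePath x j - discretePath x (j + 1))

theorem pathKernel_snoc (h : ℝ) {k : ℕ} (x : Fin k → ℝ) (a : ℝ) :
    pathKernel N h (k + 1) (Fin.snoc (α := fun _ => ℝ) x a) =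
      pathKernel N h k x * heatKernel N h (discretePath x k - a) := by
  rw [pathKernel, Fin.prod_univ_castSucc, pathKernel]
  congr 1
  · refine Finset.prod_congr rfl fun j _ => ?_
    have := j.2
    rw [Fin.val_castSucc, discretePath_snoc (by omega), discretePath_snoc (by omega)]
  · rw [Fin.val_last, discretePath_snoc le_rfl, discretePath_snoc_last]

theorem measurePreserving_snoc (k : ℕ) :
    MeasurePreserving (fun p : ℝ × (Fin k → ℝ) => (Fin.snoc (α := fun _ => ℝ) p.2 p.1)) := by
  have h := (volume_preserving_piFinSuccAbove (fun _ : Fin (k + 1) => ℝ) (Fin.last k)).symm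
  convert h using 1
  ext p i
  rw [MeasurableEquiv.piFinSuccAbove_symm_apply, ← Fin.insertNth_last']
  rfl

theorem measurableEmbedding_snoc (k : ℕ) :
    MeasurableEmbedding (fun p : ℝ × (Fin k → ℝ) => (Fin.snoc (α := fun _ => ℝ) p.2 p.1)) := by
  have h := (MeasurableEquiv.piFinSuccAbove (fun _ : Fin (k + 1) => ℝ)
    (Fin.last k)).symm.measurableEmbedding
  convert h using 1
  ext p i
  rw [MeasurableEquiv.piFinSuccAbove_symm_apply, ← Fin.insertNth_last']
  rfl

/-- Integrating the new position first costs only the factor `totalVariation`, by translation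
invariance. -/
theorem integrable_mul_heatKernel_shear (hN : Even N) (hN2 : 2 ≤ N) {h : ℝ} (hh : 0 < h)
    {α : Type*} [MeasurableSpace α] {m : Measure α} [SFinite m] {K : α → ℝ} (hK : Integrable K m)
    {y : α → ℝ} (hy : Measurable y) :
    Integrable (fun p : ℝ × α => K p.2 * heatKernel N h (y p.2 - p.1)) (volume.prod m) := by
  have hc := continuous_heatKernel hN hN2 hh
  have hm : AEStronglyMeasurable (fun p : ℝ × α => K p.2 * heatKernel N h (y p.2 - p.1))
      (volume.prod m) :=
    hK.1.comp_snd.mul (hc.measurable.comp ((hy.comp measurable_snd).sub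
      measurable_fst)).aestronglyMeasurable
  rw [integrable_prod_iff' hm]
  constructor
  · exact Eventually.of_forall fun x =>
      ((integrable_heatKernel hN hN2 hh).comp_sub_left (y x)).const_mul (K x)
  · simp only [norm_mul]
    refine (hK.norm.mul_const (totalVariation N)).congr (Eventually.of_forall fun x => ?_)
    simp only
    rw [integral_const_mul, integral_sub_left_eq_self (fun x => ‖heatKernel N h x‖),
      integral_norm_heatKernel hN hN2 hh]

theorem integrable_pathKernel (hN : Even N) (hN2 : 2 ≤ N) {h : ℝ} (hh : 0 < h) (k : ℕ) :
    Integrable (pathKernel N h k) := by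
  induction k with
  | zero =>
    have : IsFiniteMeasure (volume : Measure (Fin 0 → ℝ)) := by
      rw [volume_pi, Measure.pi_of_empty]; infer_instance
    have h1 : pathKernel N h 0 = fun _ => 1 := by ext x; simp [pathKernel]
    rw [h1]
    exact integrable_const _
  | succ k ih =>
    rw [← (measurePreserving_snoc k).integrable_comp_emb (measurableEmbedding_snoc k)]
    refine (integrable_mul_heatKernel_shear hN hN2 hh ih (measurable_discretePath k)).congr
      (Eventually.of_forall fun p => ?_)
    simp only [Function.comp_apply]
    rw [pathKernel_snoc]

/-- A tame functional: a bounded Borel function. -/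
def IsBoundedMeasurable {α : Type*} [MeasurableSpace α] (F : α → ℂ) : Prop :=
  Measurable F ∧ ∃ C : ℝ, ∀ x, ‖F x‖ ≤ C

theorem IsBoundedMeasurable.mul {α : Type*} [MeasurableSpace α] {F G : α → ℂ}
    (hF : IsBoundedMeasurable F) (hG : IsBoundedMeasurable G) :
    IsBoundedMeasurable fun x => F x * G x := by
  obtain ⟨hF1, C, hC⟩ := hF
  obtain ⟨hG1, D, hD⟩ := hG
  refine ⟨hF1.mul hG1, C * D, fun x => ?_⟩
  rw [norm_mul]
  exact mul_le_mul (hC x) (hD x) (norm_nonneg _) ((norm_nonneg _).trans (hC x))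

theorem IsBoundedMeasurable.add {α : Type*} [MeasurableSpace α] {F G : α → ℂ}
    (hF : IsBoundedMeasurable F) (hG : IsBoundedMeasurable G) :
    IsBoundedMeasurable fun x => F x + G x := by
  obtain ⟨hF1, C, hC⟩ := hF
  obtain ⟨hG1, D, hD⟩ := hG
  exact ⟨hF1.add hG1, C + D, fun x => (norm_add_le _ _).trans (add_le_add (hC x) (hD x))⟩

theorem IsBoundedMeasurable.comp {α β : Type*} [MeasurableSpace α] [MeasurableSpace β] {F : β → ℂ}
    (hF : IsBoundedMeasurable F) {y : α → β} (hy : Measurable y) :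
    IsBoundedMeasurable fun x => F (y x) := by
  obtain ⟨hF1, C, hC⟩ := hF
  exact ⟨hF1.comp hy, C, fun x => hC _⟩

theorem isBoundedMeasurable_const {α : Type*} [MeasurableSpace α] (c : ℂ) :
    IsBoundedMeasurable fun _ : α => c := ⟨measurable_const, ‖c‖, fun _ => le_rfl⟩

theorem IsBoundedMeasurable.integrable_mul {α : Type*} [MeasurableSpace α] {m : Measure α}
    {F : α → ℂ} (hF : IsBoundedMeasurable F) {K : α → ℝ} (hK : Integrable K m) :
    Integrable (fun x => F x * (K x : ℂ)) m := by
  obtain ⟨hF1, C, hC⟩ := hF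
  exact (integrable_ofReal_comp hK).bdd_mul (c := C) hF1.aestronglyMeasurable
    (Eventually.of_forall hC)

theorem tameExpectation_eq (n k : ℕ) (F : (Fin k → ℝ) → ℂ) :
    tameExpectation N n k F = ∫ x, F x * (pathKernel N (1 / 2 ^ n) k x : ℂ) := rfl

theorem tameExpectation_add (hN : Even N) (hN2 : 2 ≤ N) (n k : ℕ) {F G : (Fin k → ℝ) → ℂ}
    (hF : IsBoundedMeasurable F) (hG : IsBoundedMeasurable G) :
    tameExpectation N n k (fun x => F x + G x) =
      tameExpectation N n k F + tameExpectation N n k G := by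
  have hK := integrable_pathKernel hN hN2 (h := 1 / 2 ^ n) (by positivity) k
  simp only [tameExpectation_eq, add_mul]
  exact integral_add (hF.integrable_mul hK) (hG.integrable_mul hK)

theorem tameExpectation_const_mul (n k : ℕ) (c : ℂ) (F : (Fin k → ℝ) → ℂ) :
    tameExpectation N n k (fun x => c * F x) = c * tameExpectation N n k F := by
  simp only [tameExpectation_eq, mul_assoc]
  exact integral_const_mul _ _

theorem tameExpectation_zero (n : ℕ) (F : (Fin 0 → ℝ) → ℂ) :
    tameExpectation N n 0 F = F Fin.elim0 := by
  rw [tameExpectation_eq, volume_pi, Measure.pi_of_empty (x := (Fin.elim0 : Fin 0 → ℝ)),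
    integral_dirac]
  simp [pathKernel]

/-- Integration of the last observation. -/
theorem tameExpectation_succ (hN : Even N) (hN2 : 2 ≤ N) (n k : ℕ) {F : (Fin (k + 1) → ℝ) → ℂ}
    (hF : IsBoundedMeasurable F) :
    tameExpectation N n (k + 1) F = tameExpectation N n k fun x =>
      ∫ a, F (Fin.snoc (α := fun _ => ℝ) x a) * heatKernel N (1 / 2 ^ n) (discretePath x k - a) := by
  have hh : (0 : ℝ) < 1 / 2 ^ n := by positivity
  have hK := integrable_mul_heatKernel_shear hN hN2 hh (integrable_pathKernel hN hN2 hh k)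
    (measurable_discretePath (k := k) k)
  rw [tameExpectation_eq, ← (measurePreserving_snoc k).integral_comp (measurableEmbedding_snoc k),
    Measure.volume_eq_prod]
  have h1 := (hF.comp (measurePreserving_snoc k).measurable).integrable_mul hK
  have h2 : ∀ p : ℝ × (Fin k → ℝ), F (Fin.snoc (α := fun _ => ℝ) p.2 p.1) *
      (pathKernel N (1 / 2 ^ n) (k + 1) (Fin.snoc (α := fun _ => ℝ) p.2 p.1) : ℂ) =
      F (Fin.snoc (α := fun _ => ℝ) p.2 p.1) * ((pathKernel N (1 / 2 ^ n) k p.2 *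
        heatKernel N (1 / 2 ^ n) (discretePath p.2 k - p.1) : ℝ) : ℂ) := fun p => by
    rw [pathKernel_snoc]
  simp only [h2]
  rw [integral_prod_symm _ h1, tameExpectation_eq]
  congr 1; ext x
  rw [← integral_mul_const]
  congr 1; ext a
  push_cast; ring

/-- The weight `w` on `[0, ∞)` and `1` on `(-∞, 0)`. -/
def sideWeight (w y : ℝ) : ℝ := if 0 ≤ y then w else 1

theorem measurable_sideWeight (w : ℝ) : Measurable (sideWeight w) :=
  Measurable.ite measurableSet_Ici measurable_const measurable_const

theorem abs_sideWeight_le {w : ℝ} (y : ℝ) : |sideWeight w y| ≤ max |w| 1 := by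
  rw [sideWeight]
  split_ifs
  · exact le_max_left _ _
  · simp

theorem isBoundedMeasurable_sideWeight (w : ℝ) :
    IsBoundedMeasurable fun y => (sideWeight w y : ℂ) :=
  ⟨Complex.measurable_ofReal.comp (measurable_sideWeight w), max |w| 1, fun y => by
    rw [Complex.norm_real]; exact abs_sideWeight_le y⟩

/-- The expectation `E[w^{#{j < k : X_j ≥ 0}} G(X_k)]`. -/
def weightedExpectation (N n : ℕ) (w : ℝ) (k : ℕ) (G : ℝ → ℂ) : ℂ :=
  tameExpectation N n k fun x =>
    (∏ j ∈ Finset.range k, (sideWeight w (discretePath x j) : ℂ)) * G (discretePath x k)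

theorem isBoundedMeasurable_weight (w : ℝ) {k : ℕ} (m : ℕ) : IsBoundedMeasurable
    fun x : Fin k → ℝ => ∏ j ∈ Finset.range m, (sideWeight w (discretePath x j) : ℂ) := by
  induction m with
  | zero => simpa using isBoundedMeasurable_const 1
  | succ m ih =>
    simp only [Finset.prod_range_succ]
    exact ih.mul ((isBoundedMeasurable_sideWeight w).comp (measurable_discretePath m))

theorem isBoundedMeasurable_weighted (w : ℝ) (k : ℕ) {G : ℝ → ℂ} (hG : IsBoundedMeasurable G) :
    IsBoundedMeasurable fun x : Fin k → ℝ =>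
      (∏ j ∈ Finset.range k, (sideWeight w (discretePath x j) : ℂ)) * G (discretePath x k) :=
  (isBoundedMeasurable_weight w k).mul (hG.comp (measurable_discretePath k))

theorem weightedExpectation_add (hN : Even N) (hN2 : 2 ≤ N) (n : ℕ) (w : ℝ) (k : ℕ) {G H : ℝ → ℂ}
    (hG : IsBoundedMeasurable G) (hH : IsBoundedMeasurable H) :
    weightedExpectation N n w k (fun y => G y + H y) =
      weightedExpectation N n w k G + weightedExpectation N n w k H := by
  simp only [weightedExpectation, mul_add]
  exact tameExpectation_add hN hN2 n k (isBoundedMeasurable_weighted w k hG)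
    (isBoundedMeasurable_weighted w k hH)

theorem weightedExpectation_const_mul (n : ℕ) (w : ℝ) (k : ℕ) (c : ℂ) (G : ℝ → ℂ) :
    weightedExpectation N n w k (fun y => c * G y) = c * weightedExpectation N n w k G := by
  simp only [weightedExpectation, mul_left_comm _ c]
  exact tameExpectation_const_mul n k c _

theorem weightedExpectation_zero (n : ℕ) (w : ℝ) (G : ℝ → ℂ) :
    weightedExpectation N n w 0 G = G 0 := by
  rw [weightedExpectation, tameExpectation_zero]
  simp [discretePath]

/-- The Markov property: integrating out the last observation applies the transition operator to
`G`, and the weight of the preceding position joins the new test function. -/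
theorem weightedExpectation_succ (hN : Even N) (hN2 : 2 ≤ N) (n : ℕ) (w : ℝ) (k : ℕ) {G : ℝ → ℂ}
    (hG : IsBoundedMeasurable G) :
    weightedExpectation N n w (k + 1) G = weightedExpectation N n w k fun y =>
      sideWeight w y * ∫ a, G a * heatKernel N (1 / 2 ^ n) (y - a) := by
  rw [weightedExpectation, tameExpectation_succ hN hN2 n k (isBoundedMeasurable_weighted w _ hG),
    weightedExpectation]
  congr 1; ext x
  rw [← mul_assoc, ← integral_const_mul]
  congr 1; ext a
  rw [discretePath_snoc_last, ← Finset.prod_range_succ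
    (fun j => (sideWeight w (discretePath x j) : ℂ)), Finset.prod_congr rfl fun j hj => ?_]
  · ring
  · rw [Finset.mem_range] at hj
    rw [discretePath_snoc (by omega)]

/-- After at least one step the weighted law has an integrable density, each step convolving with
`p`. At index `0` the law is the unit mass at the origin, hence the shift. -/
theorem exists_density (hN : Even N) (hN2 : 2 ≤ N) (n : ℕ) (w : ℝ) (k : ℕ) :
    ∃ u : ℝ → ℂ, Integrable u ∧ ∀ G : ℝ → ℂ, IsBoundedMeasurable G →
      weightedExpectation N n w (k + 1) G = ∫ a, G a * u a := by
  have hh : (0 : ℝ) < 1 / 2 ^ n := by positivity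
  induction k with
  | zero =>
    refine ⟨fun a => sideWeight w 0 * heatKernel N (1 / 2 ^ n) (0 - a),
      (integrable_ofReal_comp ((integrable_heatKernel hN hN2 hh).comp_sub_left 0)).const_mul _,
      fun G hG => ?_⟩
    rw [weightedExpectation_succ hN hN2 n w 0 hG, weightedExpectation_zero, ← integral_const_mul]
    congr 1; ext a; ring
  | succ k ih =>
    obtain ⟨u, hu, hue⟩ := ih
    have hcont := continuous_heatKernel hN hN2 hh
    have hWu : Integrable fun y => (sideWeight w y : ℂ) * u y := by
      obtain ⟨h1, C, hC⟩ := isBoundedMeasurable_sideWeight w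
      exact hu.bdd_mul (c := C) h1.aestronglyMeasurable (Eventually.of_forall hC)
    have hprod : Integrable (fun p : ℝ × ℝ => (sideWeight w p.2 : ℂ) * u p.2 *
        heatKernel N (1 / 2 ^ n) (p.2 - p.1)) (volume.prod volume) := by
      have h1 := integrable_mul_heatKernel_shear hN hN2 hh hWu.norm measurable_id
      refine h1.mono ?_ (Eventually.of_forall fun p => ?_)
      · exact hWu.1.comp_snd.mul (Continuous.aestronglyMeasurable (by fun_prop))
      · simp
    refine ⟨fun a => ∫ y, (sideWeight w y : ℂ) * u y * heatKernel N (1 / 2 ^ n) (y - a),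
      hprod.integral_prod_left, fun G hG => ?_⟩
    have hPG : IsBoundedMeasurable fun y => (sideWeight w y : ℂ) *
        ∫ a, G a * heatKernel N (1 / 2 ^ n) (y - a) := by
      refine (isBoundedMeasurable_sideWeight w).mul ?_
      obtain ⟨hG1, C, hC⟩ := hG
      refine ⟨?_, C * totalVariation N, fun y => ?_⟩
      · refine StronglyMeasurable.measurable ?_
        refine StronglyMeasurable.integral_prod_right (f := fun y a =>
          G a * (heatKernel N (1 / 2 ^ n) (y - a) : ℂ)) ?_
        refine Measurable.stronglyMeasurable ?_
        exact (hG1.comp measurable_snd).mul (Complex.measurable_ofReal.comp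
          (hcont.measurable.comp (measurable_fst.sub measurable_snd)))
      · have h1 : ∫ a, C * ‖heatKernel N (1 / 2 ^ n) (y - a)‖ = C * totalVariation N := by
          rw [integral_const_mul, integral_sub_left_eq_self (fun x => ‖heatKernel N (1 / 2 ^ n) x‖),
            integral_norm_heatKernel hN hN2 hh]
        rw [← h1]
        refine norm_integral_le_of_norm_le
          (((integrable_heatKernel hN hN2 hh).comp_sub_left y).norm.const_mul _)
          (Eventually.of_forall fun a => ?_)
        rw [norm_mul, Complex.norm_real]
        exact mul_le_mul_of_nonneg_right (hC a) (norm_nonneg _)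
    rw [weightedExpectation_succ hN hN2 n w (k + 1) hG, hue _ hPG]
    simp only [← integral_const_mul, ← integral_mul_const]
    rw [integral_integral_swap]
    · congr 1; ext a; congr 1; ext y; ring
    · obtain ⟨hG1, C, hC⟩ := hG
      refine ((hprod.bdd_mul (f := fun p : ℝ × ℝ => G p.1) (c := C)
        (hG1.comp measurable_fst).aestronglyMeasurable
        (Eventually.of_forall fun p => hC p.1)).swap).congr (Eventually.of_forall fun p => ?_)
      simp only [Function.comp_apply, Function.uncurry, Prod.fst_swap, Prod.snd_swap]
      ring

/-- The character `e^{iμy}` restricted to `[0, ∞)`. -/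
def charPlus (μ y : ℝ) : ℂ := if 0 ≤ y then Complex.exp (Complex.I * μ * y) else 0

/-- The character `e^{iμy}` restricted to `(-∞, 0)`. -/
def charMinus (μ y : ℝ) : ℂ := if 0 ≤ y then 0 else Complex.exp (Complex.I * μ * y)

theorem isBoundedMeasurable_charPlus (μ : ℝ) : IsBoundedMeasurable (charPlus μ) := by
  refine ⟨Measurable.ite measurableSet_Ici (by fun_prop) measurable_const, 1, fun y => ?_⟩
  rw [charPlus]
  split_ifs
  · exact (norm_exp_I_mul μ y).le
  · simp

theorem isBoundedMeasurable_charMinus (μ : ℝ) : IsBoundedMeasurable (charMinus μ) := by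
  refine ⟨Measurable.ite measurableSet_Ici measurable_const (by fun_prop), 1, fun y => ?_⟩
  rw [charMinus]
  split_ifs
  · simp
  · exact (norm_exp_I_mul μ y).le

theorem isPlus_weightedExpectation (hN : Even N) (hN2 : 2 ≤ N) (n : ℕ) (w : ℝ) (k : ℕ) :
    IsPlus fun μ => weightedExpectation N n w (k + 1) (charPlus μ) := by
  obtain ⟨u, hu, hue⟩ := exists_density hN hN2 n w k
  refine ⟨(Set.Ioi (0 : ℝ)).indicator u, hu.indicator measurableSet_Ioi,
    fun x hx => Set.indicator_of_notMem (by simpa using hx) _, fun μ => ?_⟩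
  simp only
  rw [hue _ (isBoundedMeasurable_charPlus μ)]
  refine integral_congr_ae ?_
  -- `charPlus` keeps the origin while `IsPlus` excludes it; a law with a density does not see the
  -- difference.
  filter_upwards [Measure.ae_ne volume (0 : ℝ)] with x hx
  rw [charPlus]
  split_ifs with h
  · rw [Set.indicator_of_mem (Set.mem_Ioi.2 (lt_of_le_of_ne h (Ne.symm hx)))]
  · rw [Set.indicator_of_notMem (fun h' => h (Set.mem_Ioi.1 h').le), zero_mul, mul_zero]

theorem isPlus_weightedExpectation_neg (hN : Even N) (hN2 : 2 ≤ N) (n : ℕ) (w : ℝ) (k : ℕ) :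
    IsPlus fun μ => weightedExpectation N n w (k + 1) (charMinus (-μ)) := by
  obtain ⟨u, hu, hue⟩ := exists_density hN hN2 n w k
  refine ⟨(Set.Ioi (0 : ℝ)).indicator fun x => u (-x), hu.comp_neg.indicator measurableSet_Ioi,
    fun x hx => Set.indicator_of_notMem (by simpa using hx) _, fun μ => ?_⟩
  simp only
  rw [hue _ (isBoundedMeasurable_charMinus _), ← integral_neg_eq_self]
  congr 1; ext x
  rw [charMinus]
  split_ifs with h
  · rw [Set.indicator_of_notMem (by simpa using h), zero_mul, mul_zero]
  · rw [Set.indicator_of_mem (by simpa using h)]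
    congr 2; push_cast; ring

/-- The two restricted characters add up to the full character, an eigenfunction of the transition
operator with eigenvalue `e^{-hμᴺ}`. This is the recursion required by `wienerHopf_unique`. -/
theorem weightedExpectation_char_succ (hN : Even N) (hN2 : 2 ≤ N) (n : ℕ) (w : ℝ) (k : ℕ) (μ : ℝ) :
    weightedExpectation N n w (k + 1) (charPlus μ) +
        weightedExpectation N n w (k + 1) (charMinus μ) =
      Real.exp (-(1 / 2 ^ n * μ ^ N)) * (w * weightedExpectation N n w k (charPlus μ) +
        weightedExpectation N n w k (charMinus μ)) := by
  have hh : (0 : ℝ) < 1 / 2 ^ n := by positivity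
  have hp := isBoundedMeasurable_charPlus μ
  have hm := isBoundedMeasurable_charMinus μ
  rw [← weightedExpectation_add hN hN2 n w _ hp hm,
    weightedExpectation_succ hN hN2 n w k (hp.add hm), ← weightedExpectation_const_mul,
    ← weightedExpectation_add hN hN2 n w k ((isBoundedMeasurable_const _).mul hp) hm,
    ← weightedExpectation_const_mul]
  congr 1; ext y
  have h1 : ∀ a : ℝ, charPlus μ a + charMinus μ a = Complex.exp (Complex.I * μ * a) := fun a => by
    rw [charPlus, charMinus]; split_ifs <;> simp
  simp only [h1]
  have h2 : ∫ a : ℝ, Complex.exp (Complex.I * μ * a) * heatKernel N (1 / 2 ^ n) (y - a) =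
      Complex.exp (Complex.I * μ * y) * Real.exp (-(1 / 2 ^ n * μ ^ N)) := by
    rw [← integral_exp_mul_heatKernel hN hN2 hh μ, ← integral_const_mul,
      ← integral_add_left_eq_self _ y]
    congr 1; ext a
    rw [show y - (y + a) = -a by ring, heatKernel_neg hN, ← mul_assoc, ← Complex.exp_add]
    congr 2; push_cast; ring
  rw [h2, charPlus, charMinus, sideWeight]
  split_ifs <;> push_cast <;> ring

end Tame

/-! ### The transform of the discretized process -/

section Transform

variable {N : ℕ}

theorem stepProcess_eq {n k : ℕ} (ω : ℕ → ℝ) {t : ℝ} (h1 : (k : ℝ) / 2 ^ n ≤ t)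
    (h2 : t < ((k : ℝ) + 1) / 2 ^ n) : stepProcess n ω t = ω k := by
  rw [stepProcess]
  congr 1
  have hp : (0 : ℝ) < 2 ^ n := by positivity
  rw [div_le_iff₀ hp] at h1
  rw [lt_div_iff₀ hp] at h2
  have h0 : (0 : ℝ) ≤ 2 ^ n * t := by
    have : (0 : ℝ) ≤ k := Nat.cast_nonneg k
    linarith
  rw [Nat.floor_eq_iff h0]
  constructor <;> linarith

theorem measurable_stepProcess (n : ℕ) (ω : ℕ → ℝ) : Measurable (stepProcess n ω) := by
  have h : Measurable ω := measurable_from_top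
  exact h.comp (Nat.measurable_floor.comp (measurable_const.mul measurable_id))

theorem intervalIntegrable_indicator_stepProcess (n : ℕ) (ω : ℕ → ℝ) (a b : ℝ) :
    IntervalIntegrable (fun u => (Set.Ici (0 : ℝ)).indicator (fun _ => (1 : ℝ))
      (stepProcess n ω u)) volume a b := by
  refine (intervalIntegrable_const (c := (1 : ℝ))).mono_fun ?_ ?_
  · exact ((measurable_const.indicator measurableSet_Ici).comp
      (measurable_stepProcess n ω)).aestronglyMeasurable
  · refine Eventually.of_forall fun u => ?_
    by_cases h : stepProcess n ω u ∈ Set.Ici (0 : ℝ) <;> simp [h]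

theorem integral_indicator_stepProcess {n k : ℕ} (ω : ℕ → ℝ) {t : ℝ} (h1 : (k : ℝ) / 2 ^ n ≤ t)
    (h2 : t ≤ ((k : ℝ) + 1) / 2 ^ n) :
    ∫ u in ((k : ℝ) / 2 ^ n)..t, (Set.Ici (0 : ℝ)).indicator (fun _ => (1 : ℝ))
      (stepProcess n ω u) = (t - (k : ℝ) / 2 ^ n) *
        (Set.Ici (0 : ℝ)).indicator (fun _ => (1 : ℝ)) (ω k) := by
  -- The step process may jump at the right endpoint of the cell, so the comparison is made on the
  -- open interval.
  rw [intervalIntegral.integral_of_le h1, integral_Ioc_eq_integral_Ioo,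
    setIntegral_congr_fun (g := fun _ => (Set.Ici (0 : ℝ)).indicator (fun _ => (1 : ℝ)) (ω k))
      measurableSet_Ioo fun u hu => by
        simp only
        rw [stepProcess_eq ω hu.1.le (hu.2.trans_le h2)],
    ← integral_Ioc_eq_integral_Ioo, ← intervalIntegral.integral_of_le h1,
    intervalIntegral.integral_const, smul_eq_mul]

theorem sojournTime_stepProcess_nat (n k : ℕ) (ω : ℕ → ℝ) :
    sojournTime (stepProcess n ω) ((k : ℝ) / 2 ^ n) =
      ∑ j ∈ Finset.range k, 1 / 2 ^ n * (Set.Ici (0 : ℝ)).indicator (fun _ => (1 : ℝ)) (ω j) := by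
  induction k with
  | zero => simp [sojournTime]
  | succ k ih =>
    rw [Finset.sum_range_succ, ← ih, sojournTime, sojournTime,
      ← intervalIntegral.integral_add_adjacent_intervals
        (intervalIntegrable_indicator_stepProcess n ω 0 ((k : ℝ) / 2 ^ n))
        (intervalIntegrable_indicator_stepProcess n ω _ _)]
    congr 1
    have hp : (0 : ℝ) < 2 ^ n := by positivity
    push_cast
    rw [integral_indicator_stepProcess ω (by gcongr; linarith) le_rfl]
    congr 1; ring

theorem sojournTime_stepProcess {n k : ℕ} (ω : ℕ → ℝ) {t : ℝ} (h1 : (k : ℝ) / 2 ^ n ≤ t)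
    (h2 : t ≤ ((k : ℝ) + 1) / 2 ^ n) :
    sojournTime (stepProcess n ω) t =
      ∑ j ∈ Finset.range k, 1 / 2 ^ n * (Set.Ici (0 : ℝ)).indicator (fun _ => (1 : ℝ)) (ω j) +
        (t - (k : ℝ) / 2 ^ n) * (Set.Ici (0 : ℝ)).indicator (fun _ => (1 : ℝ)) (ω k) := by
  rw [← sojournTime_stepProcess_nat, sojournTime, sojournTime,
    ← integral_indicator_stepProcess ω h1 h2,
    intervalIntegral.integral_add_adjacent_intervals
        (intervalIntegrable_indicator_stepProcess n ω _ _)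
        (intervalIntegrable_indicator_stepProcess n ω _ _)]

/-- The integral of `e^{-cτ}` over `[0, h]`. -/
def cellIntegral (c h : ℝ) : ℝ := (1 - Real.exp (-(c * h))) / c

theorem integral_exp_cell {c h a : ℝ} (hc : c ≠ 0) :
    ∫ t in a..(a + h), (Real.exp (-(c * (t - a))) : ℂ) = cellIntegral c h := by
  rw [intervalIntegral.integral_ofReal]
  congr 1
  rw [intervalIntegral.integral_comp_sub_right (fun t => Real.exp (-(c * t))) a]
  have h1 : ∀ t : ℝ, HasDerivAt (fun t => -Real.exp (-(c * t)) / c) (Real.exp (-(c * t))) t := by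
    intro t
    have := ((((hasDerivAt_id t).const_mul c).neg).exp.neg).div_const c
    refine this.congr_deriv ?_
    simp; field_simp
  rw [intervalIntegral.integral_eq_sub_of_hasDerivAt (fun t _ => h1 t)
    (Continuous.intervalIntegrable (by fun_prop) _ _), cellIntegral]
  simp; ring

/-- On one time cell the position is constant and the sojourn time is affine in `t`. The exponential
therefore splits into weights from the past cells, the character at `X_k`, and a decay at rate `l +
ν` or `l` according to the sign of `X_k`. -/
theorem transformTerm_eq {l ν : ℝ} (hl : 0 < l) (hν : 0 < ν) (μ : ℝ) (n k : ℕ) (x : Fin k → ℝ) :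
    transformTerm l μ ν n k x =
      (∏ j ∈ Finset.range k,
        (sideWeight (Real.exp (-(ν * (1 / 2 ^ n)))) (discretePath x j) : ℂ)) *
      ((Real.exp (-(l * (1 / 2 ^ n))) : ℂ) ^ k *
        (cellIntegral (l + ν) (1 / 2 ^ n) * charPlus μ (discretePath x k) +
          cellIntegral l (1 / 2 ^ n) * charMinus μ (discretePath x k))) := by
  set ω := discretePath x with hω
  set h : ℝ := 1 / 2 ^ n with hh
  have hh0 : 0 < h := by positivity
  set ind : ℝ → ℝ := (Set.Ici (0 : ℝ)).indicator (fun _ => (1 : ℝ)) with hind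
  set c : ℝ := l + ν * ind (ω k) with hc
  have hind0 : 0 ≤ ind (ω k) := Set.indicator_nonneg (fun _ _ => zero_le_one) _
  have hc0 : c ≠ 0 := by positivity
  have ha : ((k : ℝ) + 1) / 2 ^ n = (k : ℝ) / 2 ^ n + h := by rw [hh]; ring
  have hle : (k : ℝ) / 2 ^ n ≤ ((k : ℝ) + 1) / 2 ^ n := by rw [ha]; linarith
  have hW : (∏ j ∈ Finset.range k, (sideWeight (Real.exp (-(ν * h))) (ω j) : ℂ)) =
      Complex.exp (-(ν : ℂ) * ((∑ j ∈ Finset.range k, h * ind (ω j) : ℝ) : ℂ)) := by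
    rw [Complex.ofReal_sum, Finset.mul_sum, Complex.exp_sum]
    refine Finset.prod_congr rfl fun j _ => ?_
    rw [sideWeight, hind]
    by_cases hj : 0 ≤ ω j
    · rw [if_pos hj, Set.indicator_of_mem (by exact hj)]; push_cast; congr 1; ring
    · rw [if_neg hj, Set.indicator_of_notMem (by exact hj)]; simp
  have hz : (Real.exp (-(l * h)) : ℂ) ^ k = Complex.exp (-(l : ℂ) * ((k : ℝ) / 2 ^ n : ℝ)) := by
    rw [Complex.ofReal_exp, ← Complex.exp_nat_mul]
    congr 1; rw [hh]; push_cast; ring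
  have hcongr : Set.EqOn (fun t : ℝ => Complex.exp (-(l : ℂ) * t + Complex.I * μ *
      (stepProcess n ω t : ℂ) - ν * (sojournTime (stepProcess n ω) t : ℂ)))
      (fun t : ℝ => (∏ j ∈ Finset.range k, (sideWeight (Real.exp (-(ν * h))) (ω j) : ℂ)) *
        ((Real.exp (-(l * h)) : ℂ) ^ k * (Complex.exp (Complex.I * μ * (ω k : ℂ)) *
        (Real.exp (-(c * (t - (k : ℝ) / 2 ^ n))) : ℂ))))
      (Set.Ioo ((k : ℝ) / 2 ^ n) (((k : ℝ) + 1) / 2 ^ n)) := by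
    intro t ht
    have hsoj : sojournTime (stepProcess n ω) t = (∑ j ∈ Finset.range k, h * ind (ω j)) +
        (t - (k : ℝ) / 2 ^ n) * ind (ω k) := sojournTime_stepProcess ω ht.1.le ht.2.le
    simp only
    rw [stepProcess_eq ω ht.1.le ht.2, hsoj, hW, hz,
      Complex.ofReal_exp, ← Complex.exp_add, ← Complex.exp_add, ← Complex.exp_add]
    congr 1
    rw [hc]
    push_cast
    ring
  rw [transformTerm, intervalIntegral.integral_of_le hle, integral_Ioc_eq_integral_Ioo,
    setIntegral_congr_fun measurableSet_Ioo hcongr, ← integral_Ioc_eq_integral_Ioo,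
    ← intervalIntegral.integral_of_le hle, intervalIntegral.integral_const_mul,
    intervalIntegral.integral_const_mul, intervalIntegral.integral_const_mul, ha,
    integral_exp_cell hc0]
  congr 2
  rw [charPlus, charMinus, hc, hind]
  by_cases hj : 0 ≤ ω k
  · rw [if_pos hj, if_pos hj, Set.indicator_of_mem (by exact hj)]; simp; ring
  · rw [if_neg hj, if_neg hj, Set.indicator_of_notMem (by exact hj)]; simp; ring

theorem isBoundedMeasurable_transformTerm {l ν : ℝ} (hl : 0 < l) (hν : 0 < ν) (μ : ℝ) (n k : ℕ) :
    IsBoundedMeasurable (transformTerm l μ ν n k) := by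
  rw [funext (transformTerm_eq hl hν μ n k)]
  exact (isBoundedMeasurable_weight _ k).mul ((isBoundedMeasurable_const _).mul
    (((isBoundedMeasurable_const _).mul ((isBoundedMeasurable_charPlus μ).comp
      (measurable_discretePath k))).add ((isBoundedMeasurable_const _).mul
      ((isBoundedMeasurable_charMinus μ).comp (measurable_discretePath k)))))

theorem tameExpectation_transformTerm (hN : Even N) (hN2 : 2 ≤ N) {l ν : ℝ} (hl : 0 < l)
    (hν : 0 < ν) (μ : ℝ) (n k : ℕ) :
    tameExpectation N n k (transformTerm l μ ν n k) = (Real.exp (-(l * (1 / 2 ^ n))) : ℂ) ^ k *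
      (cellIntegral (l + ν) (1 / 2 ^ n) *
        weightedExpectation N n (Real.exp (-(ν * (1 / 2 ^ n)))) k (charPlus μ) +
      cellIntegral l (1 / 2 ^ n) *
        weightedExpectation N n (Real.exp (-(ν * (1 / 2 ^ n)))) k (charMinus μ)) := by
  rw [funext (transformTerm_eq hl hν μ n k), ← weightedExpectation_const_mul,
    ← weightedExpectation_const_mul, ← weightedExpectation_add hN hN2 n _ k
      ((isBoundedMeasurable_const _).mul (isBoundedMeasurable_charPlus μ))
      ((isBoundedMeasurable_const _).mul (isBoundedMeasurable_charMinus μ)),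
    ← weightedExpectation_const_mul]
  rfl

end Transform

/-! ### The limit of the transforms -/

section Limit

variable {N : ℕ}

/-- Right-endpoint Riemann sums of a function with exponential decay. -/
theorem tendsto_riemann_sum {g : ℝ → ℂ} (hg : ContinuousOn g (Set.Ioi 0)) {C l : ℝ} (hl : 0 < l)
    (hC : ∀ t, 0 < t → ‖g t‖ ≤ C * Real.exp (-l * t)) :
    Tendsto (fun n : ℕ => ∑' j : ℕ, ((1 / 2 ^ n : ℝ) : ℂ) * g ((j + 1) * (1 / 2 ^ n))) atTop
      (𝓝 (∫ t in Set.Ioi (0 : ℝ), g t)) := by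
  have hC0 : 0 ≤ C := by
    have := (norm_nonneg _).trans (hC 1 one_pos)
    exact nonneg_of_mul_nonneg_left this (Real.exp_pos _)
  -- The value of `g` at the right end of the dyadic cell of `t`. As this point lies to the right of
  -- `t`, the bound at `t` serves as a majorant for every `n`, and `g` is never evaluated at `0`.
  set F : ℕ → ℝ → ℂ := fun n t => g ((⌊t * 2 ^ n⌋₊ + 1) * (1 / 2 ^ n)) with hF
  have hlow : ∀ (n : ℕ) (t : ℝ), t ≤ (⌊t * 2 ^ n⌋₊ + 1) * (1 / 2 ^ n) := fun n t => by
    have := (Nat.lt_floor_add_one (t * 2 ^ n)).le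
    rw [mul_one_div, le_div_iff₀ (by positivity)]; exact this
  have hup : ∀ (n : ℕ) (t : ℝ), 0 ≤ t → (⌊t * 2 ^ n⌋₊ + 1) * (1 / 2 ^ n) ≤ t + 1 / 2 ^ n :=
    fun n t ht => by
    have := Nat.floor_le (a := t * 2 ^ n) (by positivity)
    rw [mul_one_div, add_div, add_le_add_iff_right, div_le_iff₀ (by positivity)]; exact this
  have hFm : ∀ n, Measurable (F n) := fun n => by
    have : Measurable fun j : ℕ => g (((j : ℝ) + 1) * (1 / 2 ^ n)) := measurable_from_top
    exact this.comp (Nat.measurable_floor.comp (measurable_id.mul_const _))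
  have hpos : ∀ (n : ℕ) (t : ℝ), (0 : ℝ) < (⌊t * 2 ^ n⌋₊ + 1) * (1 / 2 ^ n) := fun n t => by
    positivity
  have hFb : ∀ n t, ‖F n t‖ ≤ C * Real.exp (-l * t) := fun n t => by
    refine (hC _ (hpos n t)).trans (mul_le_mul_of_nonneg_left (Real.exp_le_exp.2 ?_) hC0)
    have := mul_le_mul_of_nonneg_left (hlow n t) hl.le
    linarith
  have hbi : IntegrableOn (fun t => C * Real.exp (-l * t)) (Set.Ioi 0) :=
    (integrableOn_exp_mul_Ioi (by linarith) 0).const_mul C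
  have hFi : ∀ n, IntegrableOn (F n) (Set.Ici 0) := fun n => by
    rw [integrableOn_Ici_iff_integrableOn_Ioi]
    exact hbi.mono' (hFm n).aestronglyMeasurable (Eventually.of_forall (hFb n))
  have hsum : ∀ n : ℕ, ∫ t in Set.Ioi (0 : ℝ), F n t =
      ∑' j : ℕ, ((1 / 2 ^ n : ℝ) : ℂ) * g ((j + 1) * (1 / 2 ^ n)) := by
    intro n
    have hp : (0 : ℝ) < 2 ^ n := by positivity
    have hU : Set.Ici (0 : ℝ) = ⋃ j : ℕ, Set.Ico ((j : ℝ) / 2 ^ n) ((j + 1) / 2 ^ n) := by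
      ext t
      simp only [Set.mem_Ici, Set.mem_iUnion, Set.mem_Ico]
      constructor
      · intro ht
        refine ⟨⌊t * 2 ^ n⌋₊, ?_, ?_⟩
        · rw [div_le_iff₀ hp]; exact Nat.floor_le (by positivity)
        · rw [lt_div_iff₀ hp]; exact Nat.lt_floor_add_one _
      · rintro ⟨j, hj, _⟩
        exact le_trans (by positivity) hj
    have hfl : ∀ (j : ℕ) (t : ℝ), t ∈ Set.Ico ((j : ℝ) / 2 ^ n) ((j + 1) / 2 ^ n) →
        ⌊t * 2 ^ n⌋₊ = j := by
      intro j t ht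
      have h1 := ht.1
      have h2 := ht.2
      rw [div_le_iff₀ hp] at h1
      rw [lt_div_iff₀ hp] at h2
      rw [Nat.floor_eq_iff (le_trans (Nat.cast_nonneg j) h1)]
      exact ⟨h1, h2⟩
    have hdisj : Pairwise (Function.onFun Disjoint
        fun j : ℕ => Set.Ico ((j : ℝ) / 2 ^ n) ((j + 1) / 2 ^ n)) := by
      intro i j hij
      rw [Function.onFun, Set.disjoint_left]
      intro t hi hj
      exact hij ((hfl i t hi).symm.trans (hfl j t hj))
    have hs := hasSum_integral_iUnion (f := F n) (μ := volume) (fun j => measurableSet_Ico) hdisj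
      (by rw [← hU]; exact hFi n)
    rw [← hU, integral_Ici_eq_integral_Ioi] at hs
    rw [← hs.tsum_eq]
    refine tsum_congr fun j => ?_
    rw [setIntegral_congr_fun (g := fun _ => g ((j + 1) * (1 / 2 ^ n))) measurableSet_Ico
      fun t ht => by simp only [hF]; rw [hfl j t ht]]
    rw [setIntegral_const, Measure.real, Real.volume_Ico, Complex.real_smul,
      ENNReal.toReal_ofReal (by rw [← sub_div]; simp)]
    congr 2
    rw [← sub_div]; simp
  simp only [← hsum]
  refine tendsto_integral_of_dominated_convergence (fun t => C * Real.exp (-l * t))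
    (fun n => (hFm n).aestronglyMeasurable) hbi (fun n => Eventually.of_forall (hFb n)) ?_
  filter_upwards [self_mem_ae_restrict measurableSet_Ioi] with t ht
  have ht' : (0 : ℝ) < t := ht
  have hlim : Tendsto (fun n : ℕ => ((⌊t * 2 ^ n⌋₊ : ℝ) + 1) * (1 / 2 ^ n)) atTop (𝓝 t) := by
    refine tendsto_of_tendsto_of_tendsto_of_le_of_le tendsto_const_nhds (?_ : Tendsto
      (fun n : ℕ => t + 1 / 2 ^ n) atTop (𝓝 t)) (fun n => hlow n t) fun n => hup n t ht'.le
    have := tendsto_pow_atTop_nhds_zero_of_lt_one (r := (1 / 2 : ℝ)) (by norm_num) (by norm_num)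
    have h2 := this.const_add t
    simpa [one_div, inv_pow] using h2
  exact ((hg.continuousAt (Ioi_mem_nhds ht')).tendsto).comp hlim

/-- The integrand of the logarithm of the limiting Wiener-Hopf factor. -/
def frullani (N : ℕ) (l ν μ t : ℝ) : ℂ :=
  ((Real.exp (-l * t) - Real.exp (-(l + ν) * t)) / t : ℝ) * halfTransform N t μ

theorem continuousOn_frullani (hN : Even N) (hN2 : 2 ≤ N) (l ν μ : ℝ) :
    ContinuousOn (frullani N l ν μ) (Set.Ioi 0) := by
  refine ContinuousOn.mul ?_ (continuousOn_halfTransform hN hN2 μ)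
  refine Complex.continuous_ofReal.comp_continuousOn ?_
  exact ContinuousOn.div (by fun_prop) (by fun_prop) fun t ht => ne_of_gt ht

/-- The inequality `1 - e^{-νt} ≤ νt` removes the singularity at `t = 0`. -/
theorem frullani_coeff_nonneg_le {l ν t : ℝ} (hν : 0 < ν) (ht : 0 < t) :
    0 ≤ (Real.exp (-l * t) - Real.exp (-(l + ν) * t)) / t ∧
    (Real.exp (-l * t) - Real.exp (-(l + ν) * t)) / t ≤ ν * Real.exp (-l * t) := by
  have h1 : Real.exp (-(l + ν) * t) = Real.exp (-l * t) * Real.exp (-(ν * t)) := by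
    rw [← Real.exp_add]; congr 1; ring
  have h2 : Real.exp (-(ν * t)) ≤ 1 := Real.exp_le_one_iff.2 (by nlinarith)
  have h3 := Real.add_one_le_exp (-(ν * t))
  have h4 := Real.exp_pos (-l * t)
  rw [h1]
  constructor
  · apply div_nonneg _ ht.le
    nlinarith
  · rw [div_le_iff₀ ht]
    nlinarith

theorem norm_frullani_le (hN : Even N) (hN2 : 2 ≤ N) {l ν t : ℝ} (hν : 0 < ν) (μ : ℝ)
    (ht : 0 < t) : ‖frullani N l ν μ t‖ ≤ ν * totalVariation N * Real.exp (-l * t) := by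
  obtain ⟨h0, h1⟩ := frullani_coeff_nonneg_le (l := l) hν ht
  rw [frullani, norm_mul, Complex.norm_real, Real.norm_of_nonneg h0]
  have := mul_le_mul h1 (norm_halfTransform_le hN hN2 ht μ) (norm_nonneg _)
    (by positivity)
  linarith

/-- Frullani's device: `(e^{-lt} - e^{-(l+ν)t}) / t` is the integral of `e^{-rt}` over `r` from `l`
to `l + ν`. After exchanging the integrals, `integral_exp_mul_halfTransform` exhibits the inner one
as the `r`-derivative of `∑ log (θ r^{1/N} - iμ)`; the arguments stay in the right half-plane, so
the principal logarithm is smooth there. -/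
theorem integral_frullani (hN : Even N) (hN2 : 2 ≤ N) {l ν : ℝ} (hl : 0 < l) (hν : 0 < ν) (μ : ℝ) :
    ∫ t in Set.Ioi (0 : ℝ), frullani N l ν μ t =
      ∑ θ ∈ rootsJ N, (Complex.log (θ * ((l + ν) ^ (1 / N : ℝ) : ℝ) - Complex.I * μ) -
        Complex.log (θ * (l ^ (1 / N : ℝ) : ℝ) - Complex.I * μ)) := by
  have hlν : l ≤ l + ν := by linarith
  have h1 : ∀ t ∈ Set.Ioi (0 : ℝ), frullani N l ν μ t =
      ∫ r in Set.Ioc l (l + ν), (Real.exp (-r * t) : ℂ) * halfTransform N t μ := by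
    intro t ht
    have ht' : t ≠ 0 := ne_of_gt ht
    rw [integral_mul_const, ← intervalIntegral.integral_of_le hlν, intervalIntegral.integral_ofReal,
      frullani]
    congr 2
    have h2 : ∀ r : ℝ, HasDerivAt (fun r => -Real.exp (-r * t) / t) (Real.exp (-r * t)) r := by
      intro r
      have := ((((hasDerivAt_id r).neg).mul_const t).exp.neg).div_const t
      refine this.congr_deriv ?_
      simp; field_simp
    rw [intervalIntegral.integral_eq_sub_of_hasDerivAt (fun t _ => h2 t)
      (Continuous.intervalIntegrable (by fun_prop) _ _)]
    ring
  rw [setIntegral_congr_fun measurableSet_Ioi h1, integral_integral_swap]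
  · rw [← intervalIntegral.integral_of_le hlν]
    have h2 : ∀ r ∈ Set.uIcc l (l + ν), HasDerivAt
        (fun r : ℝ => ∑ θ ∈ rootsJ N, Complex.log (θ * (r ^ (1 / N : ℝ) : ℝ) - Complex.I * μ))
        (∫ t in Set.Ioi (0 : ℝ), (Real.exp (-r * t) : ℂ) * halfTransform N t μ) r := by
      intro r hr
      rw [Set.uIcc_of_le hlν] at hr
      have hr0 : 0 < r := hl.trans_le hr.1
      rw [integral_exp_mul_halfTransform hN hN2 hr0]
      refine HasDerivAt.fun_sum fun θ hθ => ?_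
      have h3 : HasDerivAt (fun r : ℝ => r ^ (1 / N : ℝ)) (1 / N * r ^ (1 / N - 1 : ℝ)) r :=
        Real.hasDerivAt_rpow_const (Or.inl hr0.ne')
      have h4 := ((h3.ofReal_comp.const_mul θ).sub_const (Complex.I * μ)).clog_real (by
        left
        have := mul_pos ((mem_rootsJ hN2).1 hθ).2 (Real.rpow_pos_of_pos hr0 (1 / N : ℝ))
        simpa [Complex.mul_re] using this)
      refine h4.congr_deriv ?_
      rw [div_eq_mul_inv]; ring
    have hcont : ContinuousOn (fun r : ℝ =>
        ∫ t in Set.Ioi (0 : ℝ), (Real.exp (-r * t) : ℂ) * halfTransform N t μ)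
        (Set.uIcc l (l + ν)) := by
      rw [Set.uIcc_of_le hlν]
      refine ContinuousOn.congr (f := fun r : ℝ =>
        ∑ θ ∈ rootsJ N, ((1 / N * r ^ (1 / N - 1 : ℝ) : ℝ) : ℂ) *
        (θ * (θ * (r ^ (1 / N : ℝ) : ℝ) - Complex.I * μ)⁻¹)) ?_ fun r hr =>
          integral_exp_mul_halfTransform hN hN2 (hl.trans_le hr.1) μ
      have hp : ∀ s : ℝ, ContinuousOn (fun r : ℝ => r ^ s) (Set.Icc l (l + ν)) := fun s r hr =>
        (Real.continuousAt_rpow_const r s (Or.inl (hl.trans_le hr.1).ne')).continuousWithinAt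
      refine continuousOn_finsetSum _ fun θ hθ => ?_
      refine (Complex.continuous_ofReal.comp_continuousOn ((hp _).const_mul _)).mul
        (continuousOn_const.mul (ContinuousOn.inv₀ ((continuousOn_const.mul
          (Complex.continuous_ofReal.comp_continuousOn (hp _))).sub continuousOn_const) ?_))
      intro r hr
      rw [sub_eq_add_neg]
      exact sub_I_mul_ne_zero hN2 hθ (Real.rpow_pos_of_pos (hl.trans_le hr.1) _) (by simp)
    rw [intervalIntegral.integral_eq_sub_of_hasDerivAt h2 hcont.intervalIntegrable,
      Finset.sum_sub_distrib]
  · have hb : Integrable (fun p : ℝ × ℝ => (Real.exp (-l * p.1) * totalVariation N) * 1)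
        ((volume.restrict (Set.Ioi (0 : ℝ))).prod (volume.restrict (Set.Ioc l (l + ν)))) :=
      Integrable.mul_prod (f := fun t => Real.exp (-l * t) * totalVariation N) (g := fun _ => (1 : ℝ))
        ((integrableOn_exp_mul_Ioi (by linarith) 0).mul_const _) (integrable_const _)
    refine hb.mono' ?_ ?_
    · exact (Continuous.aestronglyMeasurable (by fun_prop)).mul
        (((continuousOn_halfTransform hN hN2 μ).aestronglyMeasurable measurableSet_Ioi).comp_fst)
    · have h3 : ∀ᵐ p ∂((volume.restrict (Set.Ioi (0 : ℝ))).prod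
          (volume.restrict (Set.Ioc l (l + ν)))), p ∈ Set.Ioi (0 : ℝ) ×ˢ Set.Ioc l (l + ν) := by
        rw [Measure.prod_restrict]
        exact self_mem_ae_restrict (measurableSet_Ioi.prod measurableSet_Ioc)
      filter_upwards [h3] with p hp
      have hp1 : 0 < p.1 := hp.1
      simp only [Function.uncurry, mul_one]
      rw [norm_mul, Complex.norm_real, Real.norm_of_nonneg (Real.exp_pos _).le]
      refine mul_le_mul (Real.exp_le_exp.2 ?_) (norm_halfTransform_le hN hN2 hp1 μ)
        (norm_nonneg _) (Real.exp_pos _).le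
      have := mul_le_mul_of_nonneg_right hp.2.1.le hp1.le
      linarith

theorem exp_integral_frullani (hN : Even N) (hN2 : 2 ≤ N) {l ν : ℝ} (hl : 0 < l) (hν : 0 < ν)
    (μ : ℝ) : Complex.exp (∫ t in Set.Ioi (0 : ℝ), frullani N l ν μ t) =
      (∏ θ ∈ rootsJ N, (θ * ((l + ν) ^ (1 / N : ℝ) : ℝ) - Complex.I * μ)) *
        (∏ θ ∈ rootsJ N, (θ * (l ^ (1 / N : ℝ) : ℝ) - Complex.I * μ))⁻¹ := by
  rw [integral_frullani hN hN2 hl hν, Complex.exp_sum, ← Finset.prod_inv_distrib,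
    ← Finset.prod_mul_distrib]
  refine Finset.prod_congr rfl fun θ hθ => ?_
  have h : ∀ a : ℝ, 0 < a → θ * a - Complex.I * μ ≠ 0 := fun a ha => by
    rw [sub_eq_add_neg]; exact sub_I_mul_ne_zero hN2 hθ ha (by simp)
  rw [Complex.exp_sub, Complex.exp_log (h _ (Real.rpow_pos_of_pos (by linarith) _)),
    Complex.exp_log (h _ (Real.rpow_pos_of_pos hl _)), div_eq_mul_inv]

/-- The limiting transform. -/
def limitTransform (N : ℕ) (l μ ν : ℝ) : ℂ :=
  (∏ θ ∈ rootsJ N, (θ * (l ^ (1 / N : ℝ) : ℝ) + Complex.I * μ))⁻¹ *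
    (∏ θ ∈ rootsJ N, (θ * ((l + ν) ^ (1 / N : ℝ) : ℝ) - Complex.I * μ))⁻¹

/-- Over the common denominator, the difference of the two exponentials has numerator `(l + ν + μᴺ)
- (l + μᴺ) = ν`, by the factorization of `aᴺ + μᴺ` and `bᴺ + μᴺ`. -/
theorem limitTransform_eq (hN : Even N) (hN2 : 2 ≤ N) {l ν : ℝ} (hl : 0 < l) (hν : 0 < ν) (μ : ℝ) :
    limitTransform N l μ ν = (1 / ν : ℝ) *
      (Complex.exp (∫ t in Set.Ioi (0 : ℝ), frullani N l ν (-μ) t) -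
        Complex.exp (-∫ t in Set.Ioi (0 : ℝ), frullani N l ν μ t)) := by
  have ha : 0 < l ^ (1 / N : ℝ) := Real.rpow_pos_of_pos hl _
  have hb : 0 < (l + ν) ^ (1 / N : ℝ) := Real.rpow_pos_of_pos (by linarith) _
  have haN : (l ^ (1 / N : ℝ)) ^ N = l := rpow_inv_pow hN2 hl
  have hbN : ((l + ν) ^ (1 / N : ℝ)) ^ N = l + ν := rpow_inv_pow hN2 (by linarith)
  rw [Complex.exp_neg, exp_integral_frullani hN hN2 hl hν, exp_integral_frullani hN hN2 hl hν,
    limitTransform]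
  set a := l ^ (1 / N : ℝ)
  set b := (l + ν) ^ (1 / N : ℝ)
  have hsgn : ∀ c : ℝ, ∏ θ ∈ rootsJ N, (θ * c - Complex.I * ((-μ : ℝ) : ℂ)) =
      ∏ θ ∈ rootsJ N, (θ * c + Complex.I * μ) := fun c =>
    Finset.prod_congr rfl fun θ _ => by push_cast; ring
  rw [hsgn, hsgn]
  have hne : ∀ c : ℝ, 0 < c → (∏ θ ∈ rootsJ N, (θ * c + Complex.I * μ)) ≠ 0 := fun c hc =>
    Finset.prod_ne_zero_iff.2 fun θ hθ => sub_I_mul_ne_zero hN2 hθ hc (by simp)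
  have hne' : ∀ c : ℝ, 0 < c → (∏ θ ∈ rootsJ N, (θ * c - Complex.I * μ)) ≠ 0 := fun c hc =>
    Finset.prod_ne_zero_iff.2 fun θ hθ => by
      rw [sub_eq_add_neg]; exact sub_I_mul_ne_zero hN2 hθ hc (by simp)
  have hpr : ∀ c : ℝ, (∏ θ ∈ rootsJ N, (θ * c - Complex.I * μ)) *
      (∏ θ ∈ rootsJ N, (θ * c + Complex.I * μ)) = (c : ℂ) ^ N + μ ^ N := by
    intro c
    rw [← Finset.prod_mul_distrib, prod_rootsJ_mul hN hN2, mul_pow, I_pow_even hN, ← mul_assoc,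
      ← mul_pow]
    simp
  have e1 := hne a ha
  have e2 := hne b hb
  have e3 := hne' a ha
  have e4 := hne' b hb
  have pa := hpr a
  have pb := hpr b
  have haN' : (a : ℂ) ^ N = l := by exact_mod_cast haN
  have hbN' : (b : ℂ) ^ N = l + ν := by exact_mod_cast hbN
  rw [haN'] at pa
  rw [hbN'] at pb
  have hν' : (ν : ℂ) ≠ 0 := by exact_mod_cast hν.ne'
  generalize (∏ θ ∈ rootsJ N, (θ * a - Complex.I * μ)) = A1 at *
  generalize (∏ θ ∈ rootsJ N, (θ * a + Complex.I * μ)) = A2 at *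
  generalize (∏ θ ∈ rootsJ N, (θ * b - Complex.I * μ)) = B1 at *
  generalize (∏ θ ∈ rootsJ N, (θ * b + Complex.I * μ)) = B2 at *
  push_cast
  field_simp
  linear_combination pa - pb

theorem cellIntegral_div_tendsto {c ν : ℝ} (hc : 0 < c) (hν : 0 < ν) :
    Tendsto (fun n : ℕ => cellIntegral c (1 / 2 ^ n) / (1 - Real.exp (-(ν * (1 / 2 ^ n)))))
      atTop (𝓝 (1 / ν)) := by
  have hlim : Tendsto (fun n : ℕ => (1 / 2 ^ n : ℝ)) atTop (𝓝[≠] 0) := by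
    rw [tendsto_nhdsWithin_iff]
    constructor
    · have := tendsto_pow_atTop_nhds_zero_of_lt_one (r := (1 / 2 : ℝ)) (by norm_num) (by norm_num)
      simpa [one_div, inv_pow] using this
    · exact Eventually.of_forall fun n => by
        have : (0 : ℝ) < 1 / 2 ^ n := by positivity
        exact this.ne'
  have hd : ∀ d : ℝ, Tendsto (fun h : ℝ => h⁻¹ * (1 - Real.exp (-(d * h)))) (𝓝[≠] 0) (𝓝 d) := by
    intro d
    have h1 : HasDerivAt (fun h : ℝ => 1 - Real.exp (-(d * h))) d 0 := by
      have := (((hasDerivAt_id (0 : ℝ)).const_mul d).neg).exp.const_sub 1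
      refine this.congr_deriv ?_
      simp
    have h2 := h1.tendsto_slope_zero
    simpa using h2
  have h1 := ((hd c).comp hlim).div_const c
  have h2 := (hd ν).comp hlim
  have h3 := h1.div h2 hν.ne'
  rw [div_self hc.ne'] at h3
  refine h3.congr fun n => ?_
  have hp : (0 : ℝ) < 1 / 2 ^ n := by positivity
  simp only [Function.comp_apply, Pi.div_apply, cellIntegral]
  have he : 1 - Real.exp (-(ν * (1 / 2 ^ n))) ≠ 0 := by
    have : Real.exp (-(ν * (1 / 2 ^ n))) < 1 := Real.exp_lt_one_iff.2 (by
      have := mul_pos hν hp; linarith)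
    linarith
  field_simp

/-- The series of expectations at time step `2⁻ⁿ`. -/
theorem hasSum_tameExpectation (hN : Even N) (hN2 : 2 ≤ N) {l ν : ℝ} (hl : 0 < l) (hν : 0 < ν)
    (μ : ℝ) (n : ℕ) :
    (Summable fun k => ‖tameExpectation N n k (transformTerm l μ ν n k)‖) ∧
    ∑' k, tameExpectation N n k (transformTerm l μ ν n k) =
      ((cellIntegral (l + ν) (1 / 2 ^ n) / (1 - Real.exp (-(ν * (1 / 2 ^ n)))) : ℝ) : ℂ) *
        (1 - (Real.exp (-(ν * (1 / 2 ^ n))) : ℂ) * Complex.exp (-∑' j : ℕ,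
          ((1 / 2 ^ n : ℝ) : ℂ) * frullani N l ν μ ((j + 1) * (1 / 2 ^ n)))) +
      ((cellIntegral l (1 / 2 ^ n) / (1 - Real.exp (-(ν * (1 / 2 ^ n)))) : ℝ) : ℂ) *
        ((Real.exp (-(ν * (1 / 2 ^ n))) : ℂ) * (Complex.exp (∑' j : ℕ,
          ((1 / 2 ^ n : ℝ) : ℂ) * frullani N l ν (-μ) ((j + 1) * (1 / 2 ^ n))) - 1)) := by
  set h : ℝ := 1 / 2 ^ n with hh
  have hh0 : 0 < h := by positivity
  set w := Real.exp (-(ν * h)) with hw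
  set z := Real.exp (-(l * h)) with hz
  have hw0 : 0 < w := Real.exp_pos _
  have hw1 : w < 1 := Real.exp_lt_one_iff.2 (by have := mul_pos hν hh0; linarith)
  have hz1 : z < 1 := Real.exp_lt_one_iff.2 (by have := mul_pos hl hh0; linarith)
  have hzn : ‖(z : ℂ)‖ < 1 := by
    rw [Complex.norm_real, Real.norm_of_nonneg (Real.exp_pos _).le]; exact hz1
  have hw' : (1 - (w : ℂ)) ≠ 0 := by
    rw [sub_ne_zero]; exact_mod_cast hw1.ne'
  set g1 := cellIntegral (l + ν) h
  set g0 := cellIntegral l h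
  have hWH := fun k => wienerHopf_unique hN hN2 hh0 hw1.ne
    (Qp := fun k μ => weightedExpectation N n w k (charPlus μ))
    (Qm := fun k μ => weightedExpectation N n w k (charMinus μ))
    (by ext μ; rw [weightedExpectation_zero]; simp [charPlus])
    (by ext μ; rw [weightedExpectation_zero]; simp [charMinus])
    (fun k => isPlus_weightedExpectation hN hN2 n w k)
    (fun k => isPlus_weightedExpectation_neg hN hN2 n w k)
    (fun k μ => weightedExpectation_char_succ hN hN2 n w k μ) k
  set ep := expSeq fun j => whPlus N h w j μ with hep
  set em := expSeq fun j => whMinus N h w j μ with hem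
  have hterm : ∀ k, tameExpectation N n k (transformTerm l μ ν n k) =
      ((g1 / (1 - w) : ℝ) : ℂ) * ((if k = 0 then 1 else 0) - w * (ep k * (z : ℂ) ^ k)) +
      ((g0 / (1 - w) : ℝ) : ℂ) * (w * (em k * (z : ℂ) ^ k - if k = 0 then 1 else 0)) := by
    intro k
    rw [tameExpectation_transformTerm hN hN2 hl hν]
    have e1 := (hWH k).1 μ
    have e2 := (hWH k).2 μ
    rw [← eq_inv_mul_iff_mul_eq₀ hw'] at e1 e2
    rw [e1, e2]
    change (z : ℂ) ^ k * ((g1 : ℂ) * ((1 - (w : ℂ))⁻¹ * ((if k = 0 then 1 else 0) - w * ep k)) +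
      (g0 : ℂ) * ((1 - (w : ℂ))⁻¹ * (w * (em k - if k = 0 then 1 else 0)))) = _
    rw [Complex.ofReal_div, Complex.ofReal_div, Complex.ofReal_sub, Complex.ofReal_one]
    have hd : ∀ d : ℂ, (if k = 0 then d else 0) * (z : ℂ) ^ k = if k = 0 then d else 0 := by
      intro d
      split_ifs with hk
      · simp [hk]
      · simp
    have hd1 := hd 1
    field_simp
    linear_combination (g1 - g0 * w) * hd1
  -- The total variation bounds all logarithmic coefficients, which by `norm_expSeq_le` gives
  -- absolute convergence for `|z| < 1`.
  obtain ⟨m, hm⟩ := exists_nat_ge (totalVariation N)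
  have hpow : ∀ j : ℕ, ‖((w : ℂ) ^ (j + 1) - 1)‖ ≤ 1 := by
    intro j
    have h1 : w ^ (j + 1) ≤ 1 := pow_le_one₀ hw0.le hw1.le
    have h2 : 0 ≤ w ^ (j + 1) := by positivity
    rw [← Complex.ofReal_pow, ← Complex.ofReal_one, ← Complex.ofReal_sub, Complex.norm_real,
      Real.norm_eq_abs, abs_le]
    constructor <;> linarith
  have hcp : ∀ j, ‖whPlus N h w j μ‖ ≤ m + 1 := fun j => by
    rw [whPlus, norm_mul]
    have := mul_le_mul (hpow j) (norm_halfTransform_le hN hN2 (t := (j + 1) * h)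
      (by positivity) μ) (norm_nonneg _) zero_le_one
    linarith
  have hcm : ∀ j, ‖whMinus N h w j μ‖ ≤ m + 1 := fun j => by
    rw [whMinus, norm_mul, norm_sub_rev]
    have := mul_le_mul (hpow j) (norm_halfTransform_le hN hN2 (t := (j + 1) * h)
      (by positivity) (-μ)) (norm_nonneg _) zero_le_one
    linarith
  have sp := summable_mul_pow_of_le (norm_expSeq_le hcp) hzn
  have sm := summable_mul_pow_of_le (norm_expSeq_le hcm) hzn
  have sd : Summable fun k : ℕ => ‖(if k = 0 then (1 : ℂ) else 0)‖ :=
    summable_of_ne_finset_zero (s := {0}) fun k hk => by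
      simp only [Finset.mem_singleton] at hk; simp [hk]
  have hsum0 : ∑' k : ℕ, (if k = 0 then (1 : ℂ) else 0) = 1 := tsum_ite_eq 0 _
  -- The terms of the logarithm of the generating function are `h` times samples of the Frullani
  -- coefficient at the times `(j + 1) h`, so the logarithm is a Riemann sum.
  have hzz : ∀ j : ℕ, (z : ℂ) ^ (j + 1) * (1 - (w : ℂ) ^ (j + 1)) / (j + 1) =
      (h : ℂ) * (((Real.exp (-l * ((j + 1) * h)) - Real.exp (-(l + ν) * ((j + 1) * h))) /
        ((j + 1) * h) : ℝ) : ℂ) := by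
    intro j
    have e1 : Real.exp (-l * ((j + 1) * h)) = z ^ (j + 1) := by
      rw [hz, ← Real.exp_nat_mul]; congr 1; push_cast; ring
    have e2 : Real.exp (-(l + ν) * ((j + 1) * h)) = z ^ (j + 1) * w ^ (j + 1) := by
      rw [hz, hw, ← mul_pow, ← Real.exp_add, ← Real.exp_nat_mul]; congr 1; push_cast; ring
    rw [e1, e2]
    have e3 : (h : ℂ) ≠ 0 := by exact_mod_cast hh0.ne'
    have e4 : ((j : ℂ) + 1) ≠ 0 := by exact_mod_cast Nat.succ_ne_zero j
    push_cast
    field_simp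
  have hSp : ∑' j : ℕ, whPlus N h w j μ / (j + 1) * (z : ℂ) ^ (j + 1) =
      -∑' j : ℕ, (h : ℂ) * frullani N l ν μ ((j + 1) * h) := by
    rw [← tsum_neg]
    refine tsum_congr fun j => ?_
    rw [frullani, ← mul_assoc, ← hzz, whPlus]
    ring
  have hSm : ∑' j : ℕ, whMinus N h w j μ / (j + 1) * (z : ℂ) ^ (j + 1) =
      ∑' j : ℕ, (h : ℂ) * frullani N l ν (-μ) ((j + 1) * h) := by
    refine tsum_congr fun j => ?_
    rw [frullani, ← mul_assoc, ← hzz, whMinus]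
    ring
  have tp := tsum_expSeq hcp hzn
  have tm := tsum_expSeq hcm hzn
  rw [hSp] at tp
  rw [hSm] at tm
  have A : Summable fun k : ℕ => ((g1 / (1 - w) : ℝ) : ℂ) *
      ((if k = 0 then 1 else 0) - w * (ep k * (z : ℂ) ^ k)) :=
    (sd.of_norm.sub (sp.of_norm.mul_left _)).mul_left _
  have B : Summable fun k : ℕ => ((g0 / (1 - w) : ℝ) : ℂ) *
      (w * (em k * (z : ℂ) ^ k - if k = 0 then 1 else 0)) :=
    ((sm.of_norm.sub sd.of_norm).mul_left _).mul_left _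
  constructor
  · simp only [hterm]
    exact (A.add B).norm
  · simp only [hterm]
    rw [A.tsum_add B, tsum_mul_left, tsum_mul_left, tsum_mul_left,
      sd.of_norm.tsum_sub (sp.of_norm.mul_left _), sm.of_norm.tsum_sub sd.of_norm, tsum_mul_left,
      hsum0, tp, tm]

theorem hasPseudoExpectation_transformTerm (hN : Even N) (hN2 : 2 ≤ N) {l ν : ℝ} (hl : 0 < l)
    (hν : 0 < ν) (μ : ℝ) :
    HasPseudoExpectation N (transformTerm l μ ν) (limitTransform N l μ ν) where
  measurable n k := (isBoundedMeasurable_transformTerm hl hν μ n k).1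
  bounded n k := (isBoundedMeasurable_transformTerm hl hν μ n k).2
  summable n := (hasSum_tameExpectation hN hN2 hl hν μ n).1
  tendsto := by
    simp only [(hasSum_tameExpectation hN hN2 hl hν μ _).2]
    have hR : ∀ μ, _ := fun μ => tendsto_riemann_sum (continuousOn_frullani hN hN2 l ν μ) hl
      (fun t ht => norm_frullani_le hN hN2 (l := l) hν μ ht)
    have hC1 := (Complex.continuous_ofReal.tendsto _).comp
      (cellIntegral_div_tendsto (c := l + ν) (by linarith) hν)
    have hC0 := (Complex.continuous_ofReal.tendsto _).comp (cellIntegral_div_tendsto (c := l) hl hν)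
    have hw : Tendsto (fun n : ℕ => (Real.exp (-(ν * (1 / 2 ^ n))) : ℂ)) atTop (𝓝 1) := by
      have h1 := tendsto_pow_atTop_nhds_zero_of_lt_one (r := (1 / 2 : ℝ)) (by norm_num)
        (by norm_num)
      have h2 := (Complex.continuous_ofReal.comp
        (by fun_prop : Continuous fun h : ℝ => Real.exp (-(ν * h)))).tendsto 0 |>.comp h1
      have h3 : Complex.ofReal (Real.exp (-(ν * 0))) = 1 := by simp
      rw [Function.comp_apply, h3] at h2
      refine h2.congr fun n => ?_
      simp [one_div, inv_pow]
    rw [limitTransform_eq hN hN2 hl hν]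
    have key := (hC1.mul ((tendsto_const_nhds (x := (1 : ℂ))).sub (hw.mul (hR μ).neg.cexp))).add
      (hC0.mul (hw.mul ((hR (-μ)).cexp.sub (tendsto_const_nhds (x := (1 : ℂ))))))
    refine (key.congr fun n => rfl).mono_right (le_of_eq ?_)
    congr 1
    ring

end Limit

/-! ### Contour integrals over strips and sectors -/

section Strip

variable {φ φ₁ φ₂ : ℝ} {F G : ℂ → ℂ}

/-- The closed horizontal strip `φ₁ ≤ Im w ≤ φ₂`. -/
def strip (φ₁ φ₂ : ℝ) : Set ℂ := {w | w.im ∈ Set.Icc φ₁ φ₂}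

/-- The filter of the points of the strip whose real part tends to infinity. -/
def stripTop (φ₁ φ₂ : ℝ) : Filter ℂ := comap Complex.re atTop ⊓ 𝓟 (strip φ₁ φ₂)

/-- The filter of the points of the strip whose real part tends to minus infinity. -/
def stripBot (φ₁ φ₂ : ℝ) : Filter ℂ := comap Complex.re atBot ⊓ 𝓟 (strip φ₁ φ₂)

theorem tendsto_vertical_of_eventually (hφ : φ₁ ≤ φ₂) {l : Filter ℝ} {c : ℝ → ℝ}
    (h : Tendsto F (comap Complex.re l ⊓ 𝓟 (strip φ₁ φ₂)) (𝓝 0)) {l' : Filter ℝ}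
    (hc : Tendsto c l' l) :
    Tendsto (fun R => ∫ y in φ₁..φ₂, F ((c R : ℝ) + y * Complex.I)) l' (𝓝 0) := by
  rw [Metric.tendsto_nhds] at h ⊢
  intro ε hε
  have hpos : 0 < ε / (φ₂ - φ₁ + 1) := div_pos hε (by linarith)
  have h1 := h _ hpos
  rw [eventually_inf_principal, eventually_comap] at h1
  filter_upwards [hc.eventually h1] with R hR
  rw [dist_zero_right]
  have h2 := intervalIntegral.norm_integral_le_of_norm_le_const (a := φ₁) (b := φ₂)
    (f := fun y => F ((c R : ℝ) + y * Complex.I)) (C := ε / (φ₂ - φ₁ + 1)) (fun y hy => by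
      rw [Set.uIoc_of_le hφ] at hy
      have h3 := hR (((c R : ℝ) : ℂ) + y * Complex.I) (by simp) (by
        simp only [strip, Set.mem_ofPred_eq]
        simpa using ⟨hy.1.le, hy.2⟩)
      rw [dist_zero_right] at h3
      exact h3.le)
  refine h2.trans_lt ?_
  rw [abs_of_nonneg (by linarith), div_mul_eq_mul_div, div_lt_iff₀ (by linarith)]
  nlinarith

/-- Cauchy's theorem in a strip. -/
theorem tendsto_integral_sub_integral_strip (hφ : φ₁ ≤ φ₂) (hd : DifferentiableOn ℂ F (strip φ₁ φ₂))
    (ht : Tendsto F (stripTop φ₁ φ₂) (𝓝 0)) (hb : Tendsto F (stripBot φ₁ φ₂) (𝓝 0)) :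
    Tendsto (fun R : ℝ => (∫ x in (-R)..R, F (x + φ₁ * Complex.I)) -
      ∫ x in (-R)..R, F (x + φ₂ * Complex.I)) atTop (𝓝 0) := by
  have h1 := tendsto_vertical_of_eventually hφ ht tendsto_id
  have h2 := tendsto_vertical_of_eventually hφ hb tendsto_neg_atTop_atBot
  have h3 := (h2.sub h1).const_mul Complex.I
  rw [sub_zero, mul_zero] at h3
  refine h3.congr fun R => ?_
  have h4 := Complex.integral_boundary_rect_eq_zero_of_differentiableOn F
    (((-R : ℝ) : ℂ) + φ₁ * Complex.I) ((R : ℂ) + φ₂ * Complex.I) (hd.mono fun w hw => by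
      have := hw.2
      simp only [Set.mem_preimage] at this
      simpa [strip, Set.uIcc_of_le hφ] using this)
  have e1 : (((-R : ℝ) : ℂ) + φ₁ * Complex.I).re = -R := by simp
  have e2 : (((-R : ℝ) : ℂ) + φ₁ * Complex.I).im = φ₁ := by simp
  have e3 : ((R : ℂ) + φ₂ * Complex.I).re = R := by simp
  have e4 : ((R : ℂ) + φ₂ * Complex.I).im = φ₂ := by simp
  rw [e1, e2, e3, e4] at h4
  simp only [smul_eq_mul, id_eq] at h4 ⊢
  linear_combination -h4

theorem integral_strip_eq (hφ : φ₁ ≤ φ₂) (hd : DifferentiableOn ℂ F (strip φ₁ φ₂))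
    (ht : Tendsto F (stripTop φ₁ φ₂) (𝓝 0)) (hb : Tendsto F (stripBot φ₁ φ₂) (𝓝 0))
    (h1 : Integrable fun x : ℝ => F (x + φ₁ * Complex.I))
    (h2 : Integrable fun x : ℝ => F (x + φ₂ * Complex.I)) :
    ∫ x : ℝ, F (x + φ₁ * Complex.I) = ∫ x : ℝ, F (x + φ₂ * Complex.I) := by
  have e := tendsto_integral_sub_integral_strip hφ hd ht hb
  have e' := (intervalIntegral_tendsto_integral h1 tendsto_neg_atTop_atBot tendsto_id).sub
    (intervalIntegral_tendsto_integral h2 tendsto_neg_atTop_atBot tendsto_id)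
  exact sub_eq_zero.1 (tendsto_nhds_unique e' e)

theorem tendsto_inv_sub_strip (x₀ : ℝ) : Tendsto (fun w : ℂ => (w - x₀)⁻¹) (stripTop φ₁ φ₂) (𝓝 0) ∧
    Tendsto (fun w : ℂ => (w - x₀)⁻¹) (stripBot φ₁ φ₂) (𝓝 0) := by
  have key : ∀ l : Filter ℝ, Tendsto (fun x : ℝ => |x - x₀|) l atTop →
      Tendsto (fun w : ℂ => (w - x₀)⁻¹) (comap Complex.re l ⊓ 𝓟 (strip φ₁ φ₂)) (𝓝 0) := by
    intro l hl
    refine tendsto_inv₀_cobounded.comp (tendsto_norm_atTop_iff_cobounded.1 ?_)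
    refine tendsto_atTop_mono (fun w => ?_) (hl.comp (tendsto_comap.mono_left inf_le_left))
    simpa using Complex.abs_re_le_norm (w - x₀)
  refine ⟨key _ ?_, key _ ?_⟩
  · exact tendsto_abs_atTop_atTop.comp (tendsto_atTop_add_const_right _ _ tendsto_id)
  · exact tendsto_abs_atBot_atTop.comp (tendsto_atBot_add_const_right _ _ tendsto_id)

theorem integrable_div_sq_add_sq (hφ : 0 < φ) (x₀ : ℝ) :
    Integrable fun x : ℝ => φ / ((x - x₀) ^ 2 + φ ^ 2) := by
  have h := ((integrable_inv_one_add_sq.comp_div (R := φ) hφ.ne').comp_sub_right x₀).const_mul φ⁻¹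
  refine h.congr (Eventually.of_forall fun x => ?_)
  field_simp
  ring

/-- On the lines `Im w = ∓φ` the values of `1 / (w - x₀)` differ by `2i` times this integrand; this
is the source of the residue `2πi`. -/
theorem integral_div_sq_add_sq (hφ : 0 < φ) (x₀ : ℝ) :
    ∫ x : ℝ, φ / ((x - x₀) ^ 2 + φ ^ 2) = Real.pi := by
  have h : ∀ x : ℝ, φ / ((x - x₀) ^ 2 + φ ^ 2) = φ⁻¹ * (1 + ((x - x₀) / φ) ^ 2)⁻¹ := by
    intro x
    field_simp
    ring
  simp_rw [h]
  rw [integral_const_mul, integral_sub_right_eq_self (fun x => (1 + (x / φ) ^ 2)⁻¹) x₀,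
    Measure.integral_comp_div (fun x => (1 + x ^ 2)⁻¹) φ, integral_univ_inv_one_add_sq,
    abs_of_pos hφ, smul_eq_mul]
  field_simp

/-- The residue theorem in a strip, for a simple pole on the real axis. -/
theorem integral_strip_sub_of_pole (hφ : 0 < φ) (x₀ : ℝ) (hd : DifferentiableOn ℂ G (strip (-φ) φ))
    (hF : ∀ w : ℂ, w ∈ strip (-φ) φ → w ≠ x₀ → F w = G w / (w - x₀))
    (ht : Tendsto F (stripTop (-φ) φ) (𝓝 0)) (hb : Tendsto F (stripBot (-φ) φ) (𝓝 0))
    (h1 : Integrable fun x : ℝ => F (x + (-φ : ℝ) * Complex.I))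
    (h2 : Integrable fun x : ℝ => F (x + φ * Complex.I)) :
    (∫ x : ℝ, F (x + (-φ : ℝ) * Complex.I)) - ∫ x : ℝ, F (x + φ * Complex.I) =
      2 * Real.pi * Complex.I * G x₀ := by
  have hnhds : strip (-φ) φ ∈ 𝓝 (x₀ : ℂ) := by
    have : strip (-φ) φ = Complex.im ⁻¹' Set.Icc (-φ) φ := rfl
    rw [this]
    refine Complex.continuous_im.continuousAt.preimage_mem_nhds ?_
    rw [Complex.ofReal_im]
    exact Icc_mem_nhds (by linarith) hφ
  -- Subtracting the polar part `G x₀ / (w - x₀)` leaves the divided difference of `G`, which is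
  -- holomorphic on the whole strip.
  have hdd := (Complex.differentiableOn_dslope hnhds).2 hd
  have heq : ∀ w ∈ strip (-φ) φ, w ≠ x₀ → dslope G x₀ w = F w - G x₀ * (w - x₀)⁻¹ := by
    intro w hw hne
    rw [dslope_of_ne _ hne, slope_def_field, hF w hw hne]
    ring
  have hne : ∀ (l : Filter ℝ), (∀ᶠ x in l, x ≠ x₀) →
      ∀ᶠ w in comap Complex.re l ⊓ 𝓟 (strip (-φ) φ), F w - G x₀ * (w - x₀)⁻¹ = dslope G x₀ w := by
    intro l hl
    rw [eventually_inf_principal, eventually_comap]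
    filter_upwards [hl] with x hx w hw hws
    exact (heq w hws fun h => hx (by rw [← hw, h, Complex.ofReal_re])).symm
  have ht' : Tendsto (dslope G x₀) (stripTop (-φ) φ) (𝓝 0) := by
    have := ht.sub ((tendsto_inv_sub_strip x₀).1.const_mul (G x₀))
    rw [mul_zero, sub_zero] at this
    exact this.congr' (hne _ (eventually_ne_atTop x₀))
  have hb' : Tendsto (dslope G x₀) (stripBot (-φ) φ) (𝓝 0) := by
    have := hb.sub ((tendsto_inv_sub_strip x₀).2.const_mul (G x₀))
    rw [mul_zero, sub_zero] at this
    exact this.congr' (hne _ (eventually_ne_atBot x₀))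
  -- The polar part is not absolutely integrable along either line, so everything is compared on
  -- `[-R, R]`; only the difference of the two lines has an integrable polar part.
  have e := tendsto_integral_sub_integral_strip (by linarith) hdd ht' hb'
  have hi := integrable_ofReal_comp (integrable_div_sq_add_sq hφ x₀)
  have e' := ((intervalIntegral_tendsto_integral h1 tendsto_neg_atTop_atBot tendsto_id).sub
    (intervalIntegral_tendsto_integral h2 tendsto_neg_atTop_atBot tendsto_id)).sub
    ((intervalIntegral_tendsto_integral hi tendsto_neg_atTop_atBot tendsto_id).const_mul
      (2 * Complex.I * G x₀))
  have key := tendsto_nhds_unique (e'.congr fun R => ?_) e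
  · rw [integral_complex_ofReal, integral_div_sq_add_sq hφ] at key
    linear_combination key
  · have hm : ∀ ψ : ℝ, ψ ∈ Set.Icc (-φ) φ → ψ ≠ 0 → ∀ x : ℝ,
        dslope G x₀ (x + ψ * Complex.I) = F (x + ψ * Complex.I) -
          G x₀ * ((x + ψ * Complex.I) - x₀)⁻¹ := by
      intro ψ hψ h0 x
      refine heq _ (by simpa [strip] using hψ) fun h => h0 ?_
      simpa using congrArg Complex.im h
    have hne0 : ∀ ψ : ℝ, ψ ≠ 0 → ∀ x : ℝ, ((x : ℂ) + ψ * Complex.I) - x₀ ≠ 0 := by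
      intro ψ h0 x h
      exact h0 (by simpa using congrArg Complex.im h)
    have hci : ∀ ψ : ℝ, ψ ≠ 0 → ∀ a b : ℝ, IntervalIntegrable
        (fun x : ℝ => G x₀ * (((x : ℂ) + ψ * Complex.I) - x₀)⁻¹) volume a b := by
      intro ψ h0 a b
      refine Continuous.intervalIntegrable ?_ a b
      exact continuous_const.mul (Continuous.inv₀ (by fun_prop) (hne0 ψ h0))
    simp_rw [hm (-φ) (by simp; linarith) (by linarith), hm φ (by simp; linarith) hφ.ne']
    rw [intervalIntegral.integral_sub h1.intervalIntegrable (hci _ (by linarith) _ _),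
      intervalIntegral.integral_sub h2.intervalIntegrable (hci _ hφ.ne' _ _)]
    have h5 : (∫ x in (-R)..R, G x₀ * (((x : ℂ) + (-φ : ℝ) * Complex.I) - x₀)⁻¹) -
        (∫ x in (-R)..R, G x₀ * (((x : ℂ) + φ * Complex.I) - x₀)⁻¹) =
        (2 * Complex.I * G x₀) * ∫ x in (-R)..R, ((φ / ((x - x₀) ^ 2 + φ ^ 2) : ℝ) : ℂ) := by
      rw [← intervalIntegral.integral_sub (hci _ (by linarith) _ _) (hci _ hφ.ne' _ _),
        ← intervalIntegral.integral_const_mul]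
      congr 1
      ext x
      have a1 := hne0 (-φ) (by linarith) x
      have a2 := hne0 φ hφ.ne' x
      have a3 : ((x - x₀ : ℝ) : ℂ) ^ 2 + (φ : ℂ) ^ 2 ≠ 0 := by
        have : (x - x₀) ^ 2 + φ ^ 2 ≠ 0 := by positivity
        exact_mod_cast this
      push_cast at a1 a2 a3 ⊢
      rw [inv_eq_one_div, inv_eq_one_div, mul_one_div, mul_one_div, div_sub_div _ _ a1 a2,
        mul_div_assoc', div_eq_div_iff (mul_ne_zero a1 a2) a3]
      have hI := Complex.I_sq
      linear_combination (2 * G x₀ * Complex.I * φ ^ 3) * hI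
    simp only [id_eq]
    linear_combination h5

end Strip

/-! ### Rays and sectors, as images of lines and strips under the exponential map. -/

section Sector

variable {φ φ₁ φ₂ : ℝ} {g G : ℂ → ℂ}

/-- The integral of `G` along the ray of argument `φ`, from the origin to infinity. -/
def rayIntegral (φ : ℝ) (G : ℂ → ℂ) : ℂ :=
  ∫ r in Set.Ioi (0 : ℝ), G (r * Complex.exp (φ * Complex.I)) * Complex.exp (φ * Complex.I)

theorem exp_ofReal_add_mul_I (x φ : ℝ) : Complex.exp (x + φ * Complex.I) =
    (Real.exp x : ℂ) * Complex.exp (φ * Complex.I) := by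
  rw [Complex.exp_add, Complex.ofReal_exp]

/-- The substitution `r = e^x` turns the ray of argument `φ` into the line `Im w = φ`, so Cauchy's
theorem in a sector reduces to the strip. -/
theorem rayIntegral_eq_integral_exp (φ : ℝ) (G : ℂ → ℂ) : rayIntegral φ G =
    ∫ x : ℝ, G (Complex.exp (x + φ * Complex.I)) * Complex.exp (x + φ * Complex.I) := by
  have h := integral_image_eq_integral_abs_deriv_smul (s := Set.univ) MeasurableSet.univ
    (fun x _ => (Real.hasDerivAt_exp x).hasDerivWithinAt) Real.exp_injective.injOn
    (fun r : ℝ => G (r * Complex.exp (φ * Complex.I)) * Complex.exp (φ * Complex.I))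
  rw [Set.image_univ, Real.range_exp, setIntegral_univ] at h
  rw [rayIntegral, h]
  congr 1
  ext x
  rw [exp_ofReal_add_mul_I, abs_of_pos (Real.exp_pos x), Complex.real_smul]
  ring

theorem integrable_comp_exp_mul_exp
    (h : IntegrableOn (fun r : ℝ => G (r * Complex.exp (φ * Complex.I))) (Set.Ioi 0)) :
    Integrable fun x : ℝ =>
      G (Complex.exp (x + φ * Complex.I)) * Complex.exp (x + φ * Complex.I) := by
  have h1 := (integrableOn_image_iff_integrableOn_abs_deriv_smul (s := Set.univ) MeasurableSet.univ
    (fun x _ => (Real.hasDerivAt_exp x).hasDerivWithinAt) Real.exp_injective.injOn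
    (fun r : ℝ => G (r * Complex.exp (φ * Complex.I)))).1 (by
      rw [Set.image_univ, Real.range_exp]; exact h)
  rw [integrableOn_univ] at h1
  refine (h1.mul_const (Complex.exp (φ * Complex.I))).congr (Eventually.of_forall fun x => ?_)
  simp only
  rw [exp_ofReal_add_mul_I, abs_of_pos (Real.exp_pos x), Complex.real_smul]
  ring

theorem tendsto_re_stripTop : Tendsto (fun w : ℂ => Real.exp w.re) (stripTop φ₁ φ₂) atTop :=
  Real.tendsto_exp_atTop.comp (tendsto_comap.mono_left inf_le_left)

theorem tendsto_re_stripBot :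
    Tendsto (fun w : ℂ => Real.exp w.re) (stripBot φ₁ φ₂) (𝓝[>] 0) :=
  Real.tendsto_exp_atBot_nhdsGT.comp (tendsto_comap.mono_left inf_le_left)

/-- Rotation of the ray of integration in a sector. -/
theorem rayIntegral_eq_rayIntegral (hφ : φ₁ ≤ φ₂)
    (hd : ∀ w ∈ strip φ₁ φ₂, DifferentiableAt ℂ G (Complex.exp w)) {b : ℝ → ℝ}
    (hb : ∀ w ∈ strip φ₁ φ₂, ‖G (Complex.exp w)‖ * Real.exp w.re ≤ b (Real.exp w.re))
    (hb0 : Tendsto b (𝓝[>] 0) (𝓝 0)) (hbt : Tendsto b atTop (𝓝 0))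
    (h1 : IntegrableOn (fun r : ℝ => G (r * Complex.exp (φ₁ * Complex.I))) (Set.Ioi 0))
    (h2 : IntegrableOn (fun r : ℝ => G (r * Complex.exp (φ₂ * Complex.I))) (Set.Ioi 0)) :
    rayIntegral φ₁ G = rayIntegral φ₂ G := by
  rw [rayIntegral_eq_integral_exp, rayIntegral_eq_integral_exp]
  have key : ∀ l : Filter ℝ, Tendsto (fun w : ℂ => b (Real.exp w.re))
      (comap Complex.re l ⊓ 𝓟 (strip φ₁ φ₂)) (𝓝 0) →
      Tendsto (fun w => G (Complex.exp w) * Complex.exp w)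
        (comap Complex.re l ⊓ 𝓟 (strip φ₁ φ₂)) (𝓝 0) := by
    intro l hl
    refine squeeze_zero_norm' ?_ hl
    rw [eventually_inf_principal]
    refine Eventually.of_forall fun w hw => ?_
    rw [norm_mul, Complex.norm_exp w]
    exact hb w hw
  exact integral_strip_eq (F := fun w => G (Complex.exp w) * Complex.exp w) hφ
    (fun w hw => (((hd w hw).comp w Complex.differentiableAt_exp).mul
      Complex.differentiableAt_exp).differentiableWithinAt)
    (key _ (hbt.comp tendsto_re_stripTop)) (key _ (hb0.comp tendsto_re_stripBot))
    (integrable_comp_exp_mul_exp h1) (integrable_comp_exp_mul_exp h2)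

/-- Ensures that a narrow enough sector contains only one zero of `aᴺ - ζᴺ`. -/
theorem exp_nat_mul_ne_one {N : ℕ} (hN : 0 < N) {w : ℂ} (hw : |w.im| * N < 2 * Real.pi)
    (h0 : w ≠ 0) : Complex.exp (N * w) ≠ 1 := by
  intro h
  obtain ⟨n, hn⟩ := Complex.exp_eq_one_iff.1 h
  have hre := congrArg Complex.re hn
  have him := congrArg Complex.im hn
  have hN' : (0 : ℝ) < N := by exact_mod_cast hN
  simp at hre him
  have hn0 : n = 0 := by
    by_contra hne
    have h1 : (1 : ℝ) ≤ |(n : ℝ)| := by exact_mod_cast Int.one_le_abs hne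
    have h2 := congrArg abs him
    rw [abs_mul, abs_mul, abs_of_pos hN', abs_of_pos Real.two_pi_pos] at h2
    nlinarith [Real.pi_pos]
  rw [hn0] at him
  simp at him
  refine h0 (Complex.ext ?_ ?_)
  · rcases hre with h | h
    · omega
    · simpa using h
  · rcases him with h | h
    · omega
    · simpa using h

theorem tendsto_pow_div_sub_pow {N n : ℕ} (hn : n + 1 < N) {a : ℝ} (ha : 0 < a) (C : ℝ) :
    Tendsto (fun r : ℝ => C * (r ^ (n + 1) / |a ^ N - r ^ N|)) (𝓝[>] 0) (𝓝 0) ∧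
    Tendsto (fun r : ℝ => C * (r ^ (n + 1) / |a ^ N - r ^ N|)) atTop (𝓝 0) := by
  have haN : 0 < a ^ N := by positivity
  constructor
  · have h : ContinuousAt (fun r : ℝ => C * (r ^ (n + 1) / |a ^ N - r ^ N|)) 0 := by
      refine continuousAt_const.mul (ContinuousAt.div (by fun_prop) (by fun_prop) ?_)
      rw [zero_pow (by omega), sub_zero]
      exact abs_ne_zero.2 haN.ne'
    have h' := h.tendsto.mono_left (nhdsWithin_le_nhds (s := Set.Ioi 0))
    simpa using h'
  · have h := (Polynomial.div_tendsto_atTop_zero_of_degree_lt (Polynomial.X ^ (n + 1) : Polynomial ℝ)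
      (Polynomial.X ^ N - Polynomial.C (a ^ N)) (by
        rw [Polynomial.degree_X_pow_sub_C (by omega), Polynomial.degree_X_pow]
        exact_mod_cast hn)).norm.const_mul C
    rw [norm_zero, mul_zero] at h
    refine h.congr' ?_
    filter_upwards [eventually_gt_atTop 0] with r hr
    simp only [Polynomial.eval_pow, Polynomial.eval_X, Polynomial.eval_sub, Polynomial.eval_C,
      norm_div, norm_pow, Real.norm_eq_abs, abs_of_pos hr]
    rw [abs_sub_comm]

/-- The residue theorem in a sector, for the pole of `1 / (aᴺ - ζᴺ)` at `a > 0`. -/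
theorem rayIntegral_sub_of_pole {N n : ℕ} (hn : n + 1 < N) {a : ℝ} (ha : 0 < a) (hφ : 0 < φ)
    (hφN : φ * N < 2 * Real.pi)
    (hd : ∀ w ∈ strip (-φ) φ, DifferentiableAt ℂ g (Complex.exp w)) {C : ℝ}
    (hb : ∀ w ∈ strip (-φ) φ, ‖g (Complex.exp w)‖ ≤ C * Real.exp w.re ^ n)
    (h1 : IntegrableOn (fun r : ℝ => g (r * Complex.exp ((-φ : ℝ) * Complex.I)) /
      (a ^ N - (r * Complex.exp ((-φ : ℝ) * Complex.I)) ^ N)) (Set.Ioi 0))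
    (h2 : IntegrableOn (fun r : ℝ => g (r * Complex.exp (φ * Complex.I)) /
      (a ^ N - (r * Complex.exp (φ * Complex.I)) ^ N)) (Set.Ioi 0)) :
    N * a ^ N * (rayIntegral φ (fun ζ => g ζ / (a ^ N - ζ ^ N)) -
      rayIntegral (-φ) (fun ζ => g ζ / (a ^ N - ζ ^ N))) = 2 * Real.pi * Complex.I * (g a * a) := by
  have hN : 0 < N := by omega
  have hN0 : (N : ℂ) ≠ 0 := by exact_mod_cast hN.ne'
  have ha0 : (a : ℂ) ^ N ≠ 0 := by exact_mod_cast (pow_pos ha N).ne'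
  set x₀ := Real.log a with hx₀
  have hax : Complex.exp x₀ = a := by rw [← Complex.ofReal_exp, Real.exp_log ha]
  -- `E` is the entire extension of `(e^{Nv} - 1) / v`, with `E 0 = N`. Since `aᴺ - e^{Nw} = -aᴺ E(w
  -- - x₀)(w - x₀)` and `E` has no zero in the relevant strip, the pole at `x₀ = log a` is isolated
  -- explicitly.
  set E : ℂ → ℂ := dslope (fun v : ℂ => Complex.exp (N * v) - 1) 0 with hE
  have hE0 : E 0 = N := by
    rw [hE, dslope_same]
    have : HasDerivAt (fun v : ℂ => Complex.exp (N * v) - 1)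
        (Complex.exp (N * 0) * (N * 1)) 0 :=
      (((hasDerivAt_id (0 : ℂ)).const_mul (N : ℂ)).cexp).sub_const 1
    rw [this.deriv]
    simp
  have hEd : Differentiable ℂ E := by
    rw [← differentiableOn_univ, hE, Complex.differentiableOn_dslope Filter.univ_mem,
      differentiableOn_univ]
    fun_prop
  have hEv : ∀ v : ℂ, v ≠ 0 → E v = (Complex.exp (N * v) - 1) / v := by
    intro v hv
    rw [hE, dslope_of_ne _ hv, slope_def_field]
    simp
  have him : ∀ w ∈ strip (-φ) φ, |(w - x₀).im| * N < 2 * Real.pi := by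
    intro w hw
    have h3 : |(w - x₀).im| ≤ φ := by
      rw [Complex.sub_im, Complex.ofReal_im, sub_zero, abs_le]
      exact hw
    exact (mul_le_mul_of_nonneg_right h3 (Nat.cast_nonneg N)).trans_lt hφN
  have hEne : ∀ w ∈ strip (-φ) φ, E (w - x₀) ≠ 0 := by
    intro w hw
    by_cases h : w - x₀ = 0
    · rw [h, hE0]; exact hN0
    · rw [hEv _ h]
      exact div_ne_zero (sub_ne_zero.2 (exp_nat_mul_ne_one hN (him w hw) h)) h
  have hpow : ∀ w : ℂ, a ^ N - Complex.exp w ^ N =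
      -((a : ℂ) ^ N * (Complex.exp (N * (w - x₀)) - 1)) := by
    intro w
    rw [mul_sub (N : ℂ), Complex.exp_sub, Complex.exp_nat_mul, Complex.exp_nat_mul, hax]
    field_simp
    ring
  have hbb := tendsto_pow_div_sub_pow hn ha C
  have key : ∀ l : Filter ℝ, Tendsto (fun w : ℂ => C * (Real.exp w.re ^ (n + 1) /
      |a ^ N - Real.exp w.re ^ N|)) (comap Complex.re l ⊓ 𝓟 (strip (-φ) φ)) (𝓝 0) →
      (∀ᶠ x in l, x ≠ x₀) →
      Tendsto (fun w => g (Complex.exp w) / (a ^ N - Complex.exp w ^ N) * Complex.exp w)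
        (comap Complex.re l ⊓ 𝓟 (strip (-φ) φ)) (𝓝 0) := by
    intro l hl hne
    refine squeeze_zero_norm' ?_ hl
    rw [eventually_inf_principal, eventually_comap]
    filter_upwards [hne] with x hx w hwx hw
    have h3 : |a ^ N - Real.exp w.re ^ N| ≤ ‖(a : ℂ) ^ N - Complex.exp w ^ N‖ := by
      have := abs_norm_sub_norm_le ((a : ℂ) ^ N) (Complex.exp w ^ N)
      rwa [norm_pow, norm_pow, Complex.norm_exp w, Complex.norm_real, Real.norm_of_nonneg ha.le]
        at this
    have h4 : 0 < |a ^ N - Real.exp w.re ^ N| := by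
      rw [abs_pos, sub_ne_zero]
      intro h
      have := (pow_left_inj₀ ha.le (Real.exp_pos _).le hN.ne').1 h
      rw [hwx] at this
      exact hx (by rw [hx₀, this, Real.log_exp])
    have h5 := hb w hw
    rw [norm_mul, norm_div, Complex.norm_exp w, div_mul_eq_mul_div, mul_div_assoc', pow_succ,
      ← mul_assoc]
    exact div_le_div₀ (mul_nonneg ((norm_nonneg _).trans h5) (Real.exp_pos _).le)
      (mul_le_mul_of_nonneg_right h5 (Real.exp_pos _).le) h4 h3
  have main := integral_strip_sub_of_pole (φ := φ)
    (F := fun w => g (Complex.exp w) / (a ^ N - Complex.exp w ^ N) * Complex.exp w)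
    (G := fun w => -(g (Complex.exp w) * Complex.exp w / (a ^ N * E (w - x₀)))) hφ x₀
    (fun w hw => ((((hd w hw).comp w Complex.differentiableAt_exp).mul
      Complex.differentiableAt_exp).div ((hEd.comp (differentiable_id.sub_const _)).const_mul
        ((a : ℂ) ^ N) w) (mul_ne_zero ha0 (hEne w hw))).neg.differentiableWithinAt)
    (fun w hw hne => by
      have h3 := hEne w hw
      have h4 : w - x₀ ≠ 0 := sub_ne_zero.2 hne
      have h5 : Complex.exp (N * (w - x₀)) - 1 = E (w - x₀) * (w - x₀) := by
        rw [hEv _ h4, div_mul_cancel₀ _ h4]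
      rw [hpow, h5]
      field_simp)
    (key _ (hbb.2.comp tendsto_re_stripTop) (eventually_ne_atTop x₀))
    (key _ (hbb.1.comp tendsto_re_stripBot) (eventually_ne_atBot x₀))
    (integrable_comp_exp_mul_exp (G := fun ζ => g ζ / (a ^ N - ζ ^ N)) h1)
    (integrable_comp_exp_mul_exp (G := fun ζ => g ζ / (a ^ N - ζ ^ N)) h2)
  rw [rayIntegral_eq_integral_exp, rayIntegral_eq_integral_exp]
  simp only [hax, sub_self, hE0] at main
  have : (N : ℂ) * a ^ N * (2 * Real.pi * Complex.I * -(g a * a / (a ^ N * N))) =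
      -(2 * Real.pi * Complex.I * (g a * a)) := by
    field_simp
  linear_combination (-(N : ℂ) * a ^ N) * main - this

end Sector

/-! ### The kernel with Laplace transform `1 / ∏ (θ a + c)` -/

section Kernel

variable {N : ℕ}

/-- Lebesgue measure on the positive half line. -/
abbrev halfLine : Measure ℝ := volume.restrict (Set.Ioi 0)

/-- The argument `3π/(4N)` of the ray of integration. -/
def contourArg (N : ℕ) : ℝ := 3 * Real.pi / (4 * N)

/-- A positive lower bound for `Re (θ e^{iψ})` with `θ ∈ J` and `|ψ| ≤ 3π/(4N)`. -/
def contourSlope (N : ℕ) : ℝ := Real.sin (Real.pi / (4 * N))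

/-- The integrand of the contour integral that represents the kernel. -/
def contourIntegrand (N : ℕ) (u y : ℝ) (ζ : ℂ) : ℂ :=
  ζ ^ (N / 2) * Complex.exp (u * ζ ^ N) *
    ∑ θ ∈ rootsJ N, coeffA N θ * θ * Complex.exp (-(θ * ζ * y))

/-- The sum of the norms of the coefficients of the contour integrand. -/
def coeffNorm (N : ℕ) : ℝ := ∑ θ ∈ rootsJ N, ‖coeffA N θ * θ‖

theorem coeffNorm_nonneg : 0 ≤ coeffNorm N := Finset.sum_nonneg fun _ _ => norm_nonneg _

theorem contourArg_pos (hN2 : 2 ≤ N) : 0 < contourArg N := by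
  have : (0 : ℝ) < N := by exact_mod_cast (by omega : 0 < N)
  have := Real.pi_pos
  unfold contourArg; positivity

theorem contourArg_mul (hN2 : 2 ≤ N) : contourArg N * N = 3 * Real.pi / 4 := by
  have : (N : ℝ) ≠ 0 := by exact_mod_cast (by omega : N ≠ 0)
  unfold contourArg; field_simp

theorem contourArg_le (hN2 : 2 ≤ N) : contourArg N ≤ Real.pi / N := by
  have h : (0 : ℝ) < N := by exact_mod_cast (by omega : 0 < N)
  rw [le_div_iff₀ h, contourArg_mul hN2]
  linarith [Real.pi_pos]

theorem contourSlope_pos (hN2 : 2 ≤ N) : 0 < contourSlope N := by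
  have h : (2 : ℝ) ≤ N := by exact_mod_cast hN2
  have hpi := Real.pi_pos
  refine Real.sin_pos_of_pos_of_lt_pi (by positivity) ?_
  rw [div_lt_iff₀ (by positivity)]
  nlinarith

/-- The argument `3π/(4N)` stays `π/(4N)` below the critical `π/N`, so all factors `e^{-θζy}` decay
at a uniform rate. -/
theorem contourSlope_le (hN : Even N) (hN2 : 2 ≤ N) {θ : ℂ} (h : θ ∈ rootsJ N) {ψ : ℝ}
    (hψ : |ψ| ≤ contourArg N) : contourSlope N ≤ (θ * Complex.exp (ψ * Complex.I)).re := by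
  refine le_trans ?_ (re_mul_exp_ge hN hN2 h (hψ.trans (contourArg_le hN2)))
  have hN0 : (2 : ℝ) ≤ N := by exact_mod_cast hN2
  have hpi := Real.pi_pos
  have e : Real.pi / N - contourArg N = Real.pi / (4 * N) := by unfold contourArg; field_simp; ring
  have h1 : Real.pi / N ≤ Real.pi / 2 := div_le_div_of_nonneg_left hpi.le two_pos hN0
  have h2 : 0 < Real.pi / (4 * N) := by positivity
  exact Real.sin_le_sin_of_le_of_le_pi_div_two (by linarith) (by linarith [abs_nonneg ψ])
    (by linarith)

/-- For these arguments `N|ψ|` lies between `3π/4` and `π`, so `e^{uζᴺ}` decays along the ray. -/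
theorem cos_mul_le (hN2 : 2 ≤ N) {ψ : ℝ} (h1 : contourArg N ≤ |ψ|) (h2 : |ψ| ≤ Real.pi / N) :
    Real.cos (N * ψ) ≤ -(1 / 2) := by
  have h : (0 : ℝ) < N := by exact_mod_cast (by omega : 0 < N)
  have e : Real.cos (N * ψ) = Real.cos (N * |ψ|) := by
    rcases abs_choice ψ with h | h <;> rw [h]
    rw [mul_neg, Real.cos_neg]
  have h3 := mul_le_mul_of_nonneg_right h1 h.le
  rw [contourArg_mul hN2] at h3
  rw [le_div_iff₀ h] at h2
  have hpi := Real.pi_pos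
  have h4 := Real.cos_le_cos_of_nonneg_of_le_pi (x := 3 * Real.pi / 4) (y := N * |ψ|) (by positivity)
    (by linarith) (by linarith)
  have h5 : Real.cos (3 * Real.pi / 4) = -(√2 / 2) := by
    rw [show 3 * Real.pi / 4 = Real.pi - Real.pi / 4 by ring, Real.cos_pi_sub, Real.cos_pi_div_four]
  have h6 : (1 : ℝ) ≤ √2 := Real.one_le_sqrt.2 (by norm_num)
  rw [e]
  linarith

theorem polar_pow (r ψ : ℝ) (n : ℕ) : ((r : ℂ) * Complex.exp (ψ * Complex.I)) ^ n =
    (r ^ n : ℝ) * Complex.exp ((n * ψ : ℝ) * Complex.I) := by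
  rw [mul_pow, ← Complex.exp_nat_mul]
  push_cast
  ring_nf

theorem re_polar_pow (r ψ : ℝ) (n : ℕ) : (((r : ℂ) * Complex.exp (ψ * Complex.I)) ^ n).re =
    r ^ n * Real.cos (n * ψ) := by
  rw [polar_pow, Complex.re_ofReal_mul, Complex.exp_ofReal_mul_I_re]

theorem re_mul_polar_add_ge {θ c : ℂ} {r ψ δ : ℝ} (hr : 0 ≤ r) (hc : 0 ≤ c.re)
    (hδ : δ ≤ (θ * Complex.exp (ψ * Complex.I)).re) :
    δ * r ≤ (θ * ((r : ℂ) * Complex.exp (ψ * Complex.I)) + c).re := by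
  rw [Complex.add_re, mul_left_comm, Complex.re_ofReal_mul]
  nlinarith

/-- The slope `δ` is left free: `contourSlope` is used on the rays `±3π/(4N)`, and `δ = 0` on rays
up to `±π/N`, where decay comes from `u` alone. -/
theorem norm_contourIntegrand_le {ψ δ r u y : ℝ}
    (hδ : ∀ θ ∈ rootsJ N, δ ≤ (θ * Complex.exp (ψ * Complex.I)).re)
    (hcos : Real.cos (N * ψ) ≤ -(1 / 2)) (hr : 0 ≤ r) (hu : 0 ≤ u) (hy : 0 ≤ y) :
    ‖contourIntegrand N u y (r * Complex.exp (ψ * Complex.I))‖ ≤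
      coeffNorm N * (r ^ (N / 2) * Real.exp (-(u * r ^ N / 2)) * Real.exp (-(δ * r * y))) := by
  have h1 : ‖((r : ℂ) * Complex.exp (ψ * Complex.I)) ^ (N / 2)‖ = r ^ (N / 2) := by
    rw [norm_pow, norm_mul, Complex.norm_exp_ofReal_mul_I, mul_one, Complex.norm_real,
      Real.norm_of_nonneg hr]
  have h2 : ‖Complex.exp (u * ((r : ℂ) * Complex.exp (ψ * Complex.I)) ^ N)‖ ≤
      Real.exp (-(u * r ^ N / 2)) := by
    rw [Complex.norm_exp, Complex.re_ofReal_mul, re_polar_pow, Real.exp_le_exp]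
    have : 0 ≤ u * r ^ N := by positivity
    nlinarith
  have h3 : ‖∑ θ ∈ rootsJ N, coeffA N θ * θ *
      Complex.exp (-(θ * ((r : ℂ) * Complex.exp (ψ * Complex.I)) * y))‖ ≤
      coeffNorm N * Real.exp (-(δ * r * y)) := by
    rw [coeffNorm, Finset.sum_mul]
    refine norm_sum_le_of_le _ fun θ hθ => ?_
    rw [norm_mul]
    refine mul_le_mul_of_nonneg_left ?_ (norm_nonneg _)
    rw [Complex.norm_exp, Real.exp_le_exp, Complex.neg_re, Complex.re_mul_ofReal, neg_le_neg_iff]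
    have := re_mul_polar_add_ge hr (c := 0) (by simp) (hδ θ hθ)
    rw [add_zero] at this
    exact mul_le_mul_of_nonneg_right this hy
  rw [contourIntegrand, norm_mul, norm_mul, h1]
  calc _ ≤ r ^ (N / 2) * Real.exp (-(u * r ^ N / 2)) * (coeffNorm N * Real.exp (-(δ * r * y))) := by
        gcongr
    _ = _ := by ring

theorem integrable_exp_neg_mul {b : ℝ} (hb : 0 < b) :
    Integrable (fun x : ℝ => Real.exp (-(b * x))) halfLine := by
  refine (integrableOn_exp_mul_Ioi (neg_lt_zero.2 hb) 0).congr (Eventually.of_forall fun x => ?_)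
  simp [neg_mul]

theorem integral_exp_neg_mul {b : ℝ} (hb : 0 < b) :
    ∫ x, Real.exp (-(b * x)) ∂halfLine = b⁻¹ := by
  have := integral_exp_mul_Ioi (neg_lt_zero.2 hb) 0
  simp only [neg_mul, mul_zero, Real.exp_zero] at this
  rw [this, neg_div_neg_eq, one_div]

theorem integrable_pow_div (hN2 : 2 ≤ N) {l : ℝ} (hl : 0 < l) :
    Integrable (fun r : ℝ => r ^ (N / 2 - 1) * (l + r ^ N / 2)⁻¹) halfLine := by
  refine ((integrable_inv_one_add_sq.integrableOn (s := Set.Ioi 0)).const_mul (2 / l + 4)).mono'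
    ?_ ?_
  · refine (ContinuousOn.mul (by fun_prop) (ContinuousOn.inv₀ (by fun_prop) ?_)).aestronglyMeasurable
      measurableSet_Ioi
    intro r hr
    have : (0 : ℝ) < r := hr
    positivity
  · refine (ae_restrict_iff' measurableSet_Ioi).2 (Eventually.of_forall fun r hr => ?_)
    have hr : (0 : ℝ) < r := hr
    have hp : ∀ k ≤ N, r ^ k ≤ 1 + r ^ N := by
      intro k hk
      rcases le_total r 1 with h | h
      · exact (pow_le_one₀ hr.le h).trans (by have := pow_pos hr N; linarith)
      · exact (pow_le_pow_right₀ h hk).trans (by linarith)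
    have h1 := hp (N / 2 - 1) (by omega)
    have h2 := hp (N / 2 - 1 + 2) (by omega)
    have hN' := pow_pos hr N
    have h3 : r ^ (N / 2 - 1) * (1 + r ^ 2) ≤ (2 / l + 4) * (l + r ^ N / 2) := by
      have h4 : r ^ (N / 2 - 1) * (1 + r ^ 2) ≤ 2 + 2 * r ^ N := by
        rw [mul_add, mul_one, ← pow_add]; linarith
      have h5 : (2 / l + 4) * (l + r ^ N / 2) = 2 + 4 * l + r ^ N / l + 2 * r ^ N := by
        field_simp; ring
      have h6 : 0 < r ^ N / l := by positivity
      linarith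
    rw [Real.norm_of_nonneg (by positivity), ← div_eq_mul_inv, ← div_eq_mul_inv,
      div_le_div_iff₀ (by positivity) (by positivity)]
    exact h3

/-- Integrating `u` and `y` first leaves `δ⁻¹ r^{N/2-1} / (l + rᴺ/2)`; since `N/2 ≥ 1` the factor
`1/r` from the `y`-integral is harmless at the origin. -/
theorem integrable_contour_majorant (hN2 : 2 ≤ N) {l δ : ℝ} (hl : 0 < l) (hδ : 0 < δ) :
    Integrable (fun p : (ℝ × ℝ) × ℝ => Real.exp (-(l * p.1.1)) *
      (p.2 ^ (N / 2) * Real.exp (-(p.1.1 * p.2 ^ N / 2)) * Real.exp (-(δ * p.2 * p.1.2))))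
      ((halfLine.prod halfLine).prod halfLine) := by
  have hc : Continuous fun p : (ℝ × ℝ) × ℝ => Real.exp (-(l * p.1.1)) *
      (p.2 ^ (N / 2) * Real.exp (-(p.1.1 * p.2 ^ N / 2)) * Real.exp (-(δ * p.2 * p.1.2))) := by
    fun_prop
  have he : ∀ (r : ℝ) (p : ℝ × ℝ), Real.exp (-(l * p.1)) *
      (r ^ (N / 2) * Real.exp (-(p.1 * r ^ N / 2)) * Real.exp (-(δ * r * p.2))) =
      r ^ (N / 2) * (Real.exp (-((l + r ^ N / 2) * p.1)) * Real.exp (-((δ * r) * p.2))) := by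
    intro r p
    have : Real.exp (-((l + r ^ N / 2) * p.1)) =
        Real.exp (-(l * p.1)) * Real.exp (-(p.1 * r ^ N / 2)) := by
      rw [← Real.exp_add]; ring_nf
    rw [this]; ring
  rw [integrable_prod_iff' hc.aestronglyMeasurable]
  simp only [he]
  constructor
  · refine (ae_restrict_iff' measurableSet_Ioi).2 (Eventually.of_forall fun r hr => ?_)
    have hr : (0 : ℝ) < r := hr
    exact ((integrable_exp_neg_mul (b := l + r ^ N / 2) (by positivity)).mul_prod
      (integrable_exp_neg_mul (b := δ * r) (by positivity))).const_mul _
  · refine ((integrable_pow_div hN2 hl).const_mul δ⁻¹).congr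
      ((ae_restrict_iff' measurableSet_Ioi).2 (Eventually.of_forall fun r hr => ?_))
    have hr : (0 : ℝ) < r := hr
    have hnn : ∀ p : ℝ × ℝ, ‖r ^ (N / 2) *
        (Real.exp (-((l + r ^ N / 2) * p.1)) * Real.exp (-((δ * r) * p.2)))‖ =
        r ^ (N / 2) * (Real.exp (-((l + r ^ N / 2) * p.1)) * Real.exp (-((δ * r) * p.2))) :=
      fun p => Real.norm_of_nonneg (by positivity)
    simp only [hnn]
    rw [integral_const_mul, integral_prod_mul (fun u => Real.exp (-((l + r ^ N / 2) * u)))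
      (fun y => Real.exp (-((δ * r) * y))), integral_exp_neg_mul (by positivity),
      integral_exp_neg_mul (by positivity), mul_inv]
    have : r ^ (N / 2) = r ^ (N / 2 - 1) * r := by
      rw [← pow_succ]; congr 1; omega
    rw [this]
    field_simp

theorem ae_halfLine_prod : ∀ᵐ p : ℝ × ℝ ∂(halfLine.prod halfLine), 0 < p.1 ∧ 0 < p.2 := by
  rw [Measure.prod_restrict]
  exact (ae_restrict_iff' (measurableSet_Ioi.prod measurableSet_Ioi)).2
    (Eventually.of_forall fun p hp => hp)

theorem ae_halfLine_prod_prod : ∀ᵐ p : (ℝ × ℝ) × ℝ ∂((halfLine.prod halfLine).prod halfLine),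
    0 < p.1.1 ∧ 0 < p.1.2 ∧ 0 < p.2 := by
  rw [Measure.prod_restrict, Measure.prod_restrict]
  exact (ae_restrict_iff' ((measurableSet_Ioi.prod measurableSet_Ioi).prod measurableSet_Ioi)).2
    (Eventually.of_forall fun p hp => ⟨hp.1.1, hp.1.2, hp.2⟩)

/-! ### The double Laplace transform of a single ray integral. -/

section Ray

variable {ψ l : ℝ} {c : ℂ}

theorem integrable_laplace_contour (hN : Even N) (hN2 : 2 ≤ N) (hψ : |ψ| = contourArg N)
    (hl : 0 < l) (hc : 0 ≤ c.re) :
    Integrable (fun p : (ℝ × ℝ) × ℝ => Complex.exp (-(l * p.1.1)) * Complex.exp (-(c * p.1.2)) *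
      (contourIntegrand N p.1.1 p.1.2 (p.2 * Complex.exp (ψ * Complex.I)) *
        Complex.exp (ψ * Complex.I))) ((halfLine.prod halfLine).prod halfLine) := by
  refine ((integrable_contour_majorant hN2 hl (contourSlope_pos hN2)).const_mul (coeffNorm N)).mono'
    ?_ ?_
  · refine Continuous.aestronglyMeasurable ?_
    unfold contourIntegrand
    fun_prop
  · filter_upwards [ae_halfLine_prod_prod] with p hp
    have h := norm_contourIntegrand_le (fun θ hθ => contourSlope_le hN hN2 hθ hψ.le)
      (cos_mul_le hN2 hψ.ge (hψ.le.trans (contourArg_le hN2))) hp.2.2.le hp.1.le hp.2.1.le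
    have h1 : ‖Complex.exp (-((l : ℂ) * p.1.1))‖ = Real.exp (-(l * p.1.1)) := by
      rw [Complex.norm_exp]; simp
    have h2 : ‖Complex.exp (-(c * p.1.2))‖ ≤ 1 := by
      rw [Complex.norm_exp, Real.exp_le_one_iff, Complex.neg_re, Complex.re_mul_ofReal]
      have := mul_nonneg hc hp.2.1.le
      linarith
    rw [norm_mul, norm_mul, norm_mul, Complex.norm_exp_ofReal_mul_I, mul_one, h1]
    have h3 := mul_le_mul (mul_le_mul_of_nonneg_left h2 (Real.exp_pos (-(l * p.1.1))).le) h
      (norm_nonneg _) (by rw [mul_one]; exact (Real.exp_pos _).le)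
    rw [mul_one, mul_left_comm] at h3
    exact h3

theorem integrable_laplace_ray (hN : Even N) (hN2 : 2 ≤ N) (hψ : |ψ| = contourArg N)
    (hl : 0 < l) (hc : 0 ≤ c.re) :
    Integrable (fun p : ℝ × ℝ => Complex.exp (-(l * p.1)) * Complex.exp (-(c * p.2)) *
      rayIntegral ψ (contourIntegrand N p.1 p.2)) (halfLine.prod halfLine) := by
  refine (integrable_laplace_contour hN hN2 hψ hl hc).integral_prod_left.congr
    (Eventually.of_forall fun p => ?_)
  simp only [rayIntegral, integral_const_mul]

theorem integral_exp_neg_mul_complex {b : ℂ} (hb : 0 < b.re) :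
    ∫ x : ℝ, Complex.exp (-(b * x)) ∂halfLine = b⁻¹ := by
  have := integral_exp_mul_complex_Ioi (a := -b) (by simpa using hb) 0
  simp only [neg_mul, Complex.ofReal_zero, mul_zero, Complex.exp_zero] at this
  rw [this, neg_div_neg_eq, one_div]

theorem integrable_exp_neg_mul_complex {b : ℂ} (hb : 0 < b.re) :
    Integrable (fun x : ℝ => Complex.exp (-(b * x))) halfLine := by
  have := integrableOn_exp_mul_complex_Ioi (a := -b) (by simpa using hb) 0
  simp only [neg_mul] at this
  exact this

/-- The `u`-integral gives `1 / (l - ζᴺ)` and the `y`-integral gives `∑ A_θ θ / (θζ + c)`, which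
`sum_coeffA_inv` reassembles into `1 / ∏ (θζ + c)`. -/
theorem integral_laplace_contour (hN : Even N) (hN2 : 2 ≤ N) (hψ : |ψ| = contourArg N)
    (hl : 0 < l) (hc : 0 ≤ c.re) {r : ℝ} (hr : 0 < r) :
    ∫ p : ℝ × ℝ, Complex.exp (-(l * p.1)) * Complex.exp (-(c * p.2)) *
      (contourIntegrand N p.1 p.2 (r * Complex.exp (ψ * Complex.I)) *
        Complex.exp (ψ * Complex.I)) ∂(halfLine.prod halfLine) =
      (r * Complex.exp (ψ * Complex.I)) ^ (N - 1) *
        (∏ θ ∈ rootsJ N, (θ * (r * Complex.exp (ψ * Complex.I)) + c))⁻¹ /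
        (l - (r * Complex.exp (ψ * Complex.I)) ^ N) * Complex.exp (ψ * Complex.I) := by
  set ζ := (r : ℂ) * Complex.exp (ψ * Complex.I) with hζ
  have hζ0 : ζ ≠ 0 := mul_ne_zero (by exact_mod_cast hr.ne') (Complex.exp_ne_zero _)
  have hre : ∀ θ ∈ rootsJ N, 0 < (θ * ζ + c).re := fun θ hθ =>
    (mul_pos (contourSlope_pos hN2) hr).trans_le
      (re_mul_polar_add_ge hr.le hc (contourSlope_le hN hN2 hθ hψ.le))
  have hlre : 0 < ((l : ℂ) - ζ ^ N).re := by
    rw [Complex.sub_re, hζ, re_polar_pow, Complex.ofReal_re]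
    have := cos_mul_le hN2 hψ.ge (hψ.le.trans (contourArg_le hN2))
    have := pow_pos hr N
    nlinarith
  have he : ∀ p : ℝ × ℝ, Complex.exp (-(l * p.1)) * Complex.exp (-(c * p.2)) *
      (contourIntegrand N p.1 p.2 ζ * Complex.exp (ψ * Complex.I)) =
      Complex.exp (-(((l : ℂ) - ζ ^ N) * p.1)) * ((ζ ^ (N / 2) * Complex.exp (ψ * Complex.I)) *
        ∑ θ ∈ rootsJ N, coeffA N θ * θ * Complex.exp (-((θ * ζ + c) * p.2))) := by
    intro p
    have e1 : Complex.exp (-(((l : ℂ) - ζ ^ N) * p.1)) =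
        Complex.exp (-(l * p.1)) * Complex.exp (p.1 * ζ ^ N) := by
      rw [← Complex.exp_add]; ring_nf
    have e2 : ∀ θ : ℂ, Complex.exp (-((θ * ζ + c) * p.2)) =
        Complex.exp (-(c * p.2)) * Complex.exp (-(θ * ζ * p.2)) := by
      intro θ
      rw [← Complex.exp_add]; ring_nf
    simp_rw [e1, e2, contourIntegrand, mul_left_comm _ (Complex.exp (-(c * p.2))), ← Finset.mul_sum]
    ring
  simp_rw [he]
  rw [integral_prod_mul (fun u : ℝ => Complex.exp (-(((l : ℂ) - ζ ^ N) * u)))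
    (fun y : ℝ => (ζ ^ (N / 2) * Complex.exp (ψ * Complex.I)) *
        ∑ θ ∈ rootsJ N, coeffA N θ * θ * Complex.exp (-((θ * ζ + c) * y))),
    integral_exp_neg_mul_complex hlre, integral_const_mul,
    integral_finsetSum _ fun θ hθ => (integrable_exp_neg_mul_complex (hre θ hθ)).const_mul _]
  have hs : ∑ θ ∈ rootsJ N, ∫ y : ℝ, coeffA N θ * θ * Complex.exp (-((θ * ζ + c) * y)) ∂halfLine =
      ∑ θ ∈ rootsJ N, coeffA N θ * θ * (θ * ζ + c)⁻¹ :=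
    Finset.sum_congr rfl fun θ hθ => by
      rw [integral_const_mul, integral_exp_neg_mul_complex (hre θ hθ)]
  have hp := sum_coeffA_inv hN hN2 (y := -c) hζ0 fun θ hθ h => by
    have := hre θ hθ
    rw [sub_neg_eq_add] at h
    rw [h] at this
    simp at this
  simp only [sub_neg_eq_add] at hp
  rw [hs]
  have hpow : ζ ^ (N - 1) * ζ = ζ ^ (N / 2) * ζ ^ (N / 2) := by
    obtain ⟨k, hk⟩ := hN
    rw [← pow_succ, ← pow_add]
    congr 1
    omega
  rw [← mul_left_inj' hζ0, div_eq_mul_inv]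
  linear_combination ((l - ζ ^ N)⁻¹ * ζ ^ (N / 2) * Complex.exp (ψ * Complex.I)) * hp -
    (∏ θ ∈ rootsJ N, (θ * ζ + c))⁻¹ * (l - ζ ^ N)⁻¹ * Complex.exp (ψ * Complex.I) * hpow

theorem integral_laplace_ray (hN : Even N) (hN2 : 2 ≤ N) (hψ : |ψ| = contourArg N)
    (hl : 0 < l) (hc : 0 ≤ c.re) :
    ∫ p : ℝ × ℝ, Complex.exp (-(l * p.1)) * Complex.exp (-(c * p.2)) *
      rayIntegral ψ (contourIntegrand N p.1 p.2) ∂(halfLine.prod halfLine) =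
      rayIntegral ψ fun ζ => ζ ^ (N - 1) * (∏ θ ∈ rootsJ N, (θ * ζ + c))⁻¹ / (l - ζ ^ N) := by
  have hi := integrable_laplace_contour hN hN2 hψ hl hc
  have h := (integral_prod _ hi).symm.trans (integral_prod_symm _ hi)
  simp only [integral_const_mul] at h
  refine h.trans (setIntegral_congr_fun measurableSet_Ioi fun r hr => ?_)
  exact integral_laplace_contour hN hN2 hψ hl hc hr

theorem integrable_laplace_ray_right (hN : Even N) (hN2 : 2 ≤ N) (hψ : |ψ| = contourArg N)
    (hl : 0 < l) (hc : 0 ≤ c.re) :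
    IntegrableOn (fun r : ℝ => (r * Complex.exp (ψ * Complex.I)) ^ (N - 1) *
        (∏ θ ∈ rootsJ N, (θ * (r * Complex.exp (ψ * Complex.I)) + c))⁻¹ /
        (l - (r * Complex.exp (ψ * Complex.I)) ^ N)) (Set.Ioi 0) := by
  have h := (integrable_laplace_contour hN hN2 hψ hl hc).integral_prod_right.mul_const
    (Complex.exp (ψ * Complex.I))⁻¹
  refine h.congr ((ae_restrict_iff' measurableSet_Ioi).2 (Eventually.of_forall fun r hr => ?_))
  simp only
  rw [integral_laplace_contour hN hN2 hψ hl hc hr, mul_assoc, mul_inv_cancel₀ (Complex.exp_ne_zero _),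
    mul_one]

/-- Between the two rays the only pole is `ζ = a`: each `θζ + c` has positive real part there, and
`N` times the half-angle is `3π/4 < 2π`. -/
theorem rayIntegral_sub_rayIntegral (hN : Even N) (hN2 : 2 ≤ N) {a : ℝ} (ha : 0 < a)
    (hc : 0 ≤ c.re) :
    N / (2 * Real.pi * Complex.I) * (rayIntegral (contourArg N) (fun ζ => ζ ^ (N - 1) *
        (∏ θ ∈ rootsJ N, (θ * ζ + c))⁻¹ / ((a ^ N : ℝ) - ζ ^ N)) -
      rayIntegral (-contourArg N) (fun ζ => ζ ^ (N - 1) *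
        (∏ θ ∈ rootsJ N, (θ * ζ + c))⁻¹ / ((a ^ N : ℝ) - ζ ^ N))) =
      (∏ θ ∈ rootsJ N, (θ * a + c))⁻¹ := by
  have hφ := contourArg_pos hN2
  have hδ := contourSlope_pos hN2
  have haN : 0 < a ^ N := pow_pos ha N
  have e : ∀ w : ℂ, Complex.exp w = (Real.exp w.re : ℂ) * Complex.exp (w.im * Complex.I) := by
    intro w
    rw [← exp_ofReal_add_mul_I, Complex.re_add_im]
  have hre : ∀ w ∈ strip (-contourArg N) (contourArg N), ∀ θ ∈ rootsJ N,
      contourSlope N * Real.exp w.re ≤ (θ * Complex.exp w + c).re := by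
    intro w hw θ hθ
    rw [e w]
    exact re_mul_polar_add_ge (Real.exp_pos _).le hc (contourSlope_le hN hN2 hθ (abs_le.2 hw))
  have hne : ∀ w ∈ strip (-contourArg N) (contourArg N), ∏ θ ∈ rootsJ N, (θ * Complex.exp w + c) ≠ 0 := by
    intro w hw
    refine Finset.prod_ne_zero_iff.2 fun θ hθ h => ?_
    have h1 := hre w hw θ hθ
    rw [h, Complex.zero_re] at h1
    exact (mul_pos hδ (Real.exp_pos _)).not_ge h1
  have hint := fun (ψ : ℝ) (hψ : |ψ| = contourArg N) =>
    integrable_laplace_ray_right hN hN2 hψ haN hc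
  have hcast : ((a ^ N : ℝ) : ℂ) = (a : ℂ) ^ N := by push_cast; rfl
  rw [hcast] at hint ⊢
  -- Each of the `N/2` factors of the product is at least of order `|ζ|`, so the numerator grows
  -- like `|ζ|^(N - 1 - N/2)`.
  have main := rayIntegral_sub_of_pole (N := N) (n := N / 2 - 1) (by omega) ha hφ
    (by rw [contourArg_mul hN2]; linarith [Real.pi_pos])
    (g := fun ζ => ζ ^ (N - 1) * (∏ θ ∈ rootsJ N, (θ * ζ + c))⁻¹)
    (fun w hw => (differentiableAt_id.pow _).mul
      (DifferentiableAt.inv (by fun_prop) (hne w hw)))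
    (C := (contourSlope N ^ (N / 2))⁻¹)
    (fun w hw => by
      have h1 : (contourSlope N * Real.exp w.re) ^ (N / 2) ≤
          ‖∏ θ ∈ rootsJ N, (θ * Complex.exp w + c)‖ := by
        rw [norm_prod, ← card_rootsJ hN hN2, ← Finset.prod_const]
        exact Finset.prod_le_prod (fun θ _ => (mul_pos hδ (Real.exp_pos _)).le)
          fun θ hθ => (hre w hw θ hθ).trans (Complex.re_le_norm _)
      have hx := Real.exp_pos w.re
      rw [norm_mul, norm_pow, norm_inv, Complex.norm_exp w]
      calc _ ≤ Real.exp w.re ^ (N - 1) * ((contourSlope N * Real.exp w.re) ^ (N / 2))⁻¹ := by gcongr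
        _ = _ := by
          have : Real.exp w.re ^ (N - 1) = Real.exp w.re ^ (N / 2 - 1) * Real.exp w.re ^ (N / 2) := by
            obtain ⟨k, hk⟩ := hN
            rw [← pow_add]; congr 1; omega
          rw [this, mul_pow]
          field_simp)
    (hint _ (by rw [abs_neg, abs_of_pos hφ]))
    (hint _ (abs_of_pos hφ))
  have ha0 : (a : ℂ) ≠ 0 := by exact_mod_cast ha.ne'
  have hN0 : (N : ℂ) ≠ 0 := by exact_mod_cast (by omega : N ≠ 0)
  have hpi : (Real.pi : ℂ) ≠ 0 := by exact_mod_cast Real.pi_ne_zero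
  have hap : (a : ℂ) ^ (N - 1) * a = a ^ N := by rw [← pow_succ]; congr 1; omega
  rw [mul_right_comm _ _ (a : ℂ), hap] at main
  have haN0 : (a : ℂ) ^ N ≠ 0 := pow_ne_zero _ ha0
  rw [div_mul_eq_mul_div, div_eq_iff (mul_ne_zero (mul_ne_zero two_ne_zero hpi) Complex.I_ne_zero)]
  refine mul_left_cancel₀ haN0 ?_
  linear_combination main

end Ray

end Kernel

/-! ### The kernel `q_u(y)`: its transform, bounds and continuity. -/

section SojournKernel

variable {N : ℕ}

/-- The kernel `q_u(y)`, for `u, y > 0`, whose double Laplace transform is `1 / ∏ (θ a + c)`. -/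
def sojournKernel (N : ℕ) (u y : ℝ) : ℝ :=
  if 0 < y then N / Real.pi * (rayIntegral (contourArg N) (contourIntegrand N u y)).im else 0

/-- Conjugation permutes `J`. The integrals along the two conjugate rays are therefore conjugate,
and their difference is `2i` times an imaginary part, which makes the kernel real. -/
theorem contourIntegrand_conj (hN2 : 2 ≤ N) (u y : ℝ) (ζ : ℂ) :
    contourIntegrand N u y (starRingEnd ℂ ζ) = starRingEnd ℂ (contourIntegrand N u y ζ) := by
  simp only [contourIntegrand, map_mul, map_pow, map_sum, ← Complex.exp_conj, Complex.conj_ofReal,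
    map_neg]
  congr 1
  rw [← sum_rootsJ_conj hN2]
  refine Finset.sum_congr rfl fun θ _ => ?_
  rw [coeffA_conj hN2]

theorem conj_exp_mul_I (ψ : ℝ) : Complex.exp ((-ψ : ℝ) * Complex.I) =
    starRingEnd ℂ (Complex.exp (ψ * Complex.I)) := by
  rw [← Complex.exp_conj, map_mul, Complex.conj_I, Complex.conj_ofReal]
  push_cast
  ring_nf

theorem rayIntegral_neg (hN2 : 2 ≤ N) (ψ u y : ℝ) : rayIntegral (-ψ) (contourIntegrand N u y) =
    starRingEnd ℂ (rayIntegral ψ (contourIntegrand N u y)) := by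
  rw [rayIntegral, rayIntegral, ← integral_conj]
  congr 1
  ext r
  rw [map_mul, ← contourIntegrand_conj hN2, map_mul, ← conj_exp_mul_I, Complex.conj_ofReal]

theorem ofReal_mul_im (hN2 : 2 ≤ N) (ψ u y : ℝ) :
    ((N / Real.pi * (rayIntegral ψ (contourIntegrand N u y)).im : ℝ) : ℂ) =
      N / (2 * Real.pi * Complex.I) * (rayIntegral ψ (contourIntegrand N u y) -
        rayIntegral (-ψ) (contourIntegrand N u y)) := by
  have hpi : (Real.pi : ℂ) ≠ 0 := by exact_mod_cast Real.pi_ne_zero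
  rw [rayIntegral_neg hN2, Complex.sub_conj]
  push_cast
  field_simp [Complex.I_ne_zero]

theorem ofReal_sojournKernel (hN2 : 2 ≤ N) (u : ℝ) {y : ℝ} (hy : 0 < y) :
    (sojournKernel N u y : ℂ) = N / (2 * Real.pi * Complex.I) *
      (rayIntegral (contourArg N) (contourIntegrand N u y) -
        rayIntegral (-contourArg N) (contourIntegrand N u y)) := by
  rw [sojournKernel, if_pos hy, ofReal_mul_im hN2]

theorem sojournKernel_of_nonpos (u : ℝ) {y : ℝ} (hy : y ≤ 0) : sojournKernel N u y = 0 :=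
  if_neg hy.not_gt

theorem laplace_sojournKernel_ae (hN2 : 2 ≤ N) (l : ℝ) (c : ℂ) :
    (fun p : ℝ × ℝ => Complex.exp (-(l * p.1)) * Complex.exp (-(c * p.2)) *
      (sojournKernel N p.1 p.2 : ℂ)) =ᵐ[halfLine.prod halfLine] fun p =>
      N / (2 * Real.pi * Complex.I) * (Complex.exp (-(l * p.1)) * Complex.exp (-(c * p.2)) *
      rayIntegral (contourArg N) (contourIntegrand N p.1 p.2) -
      Complex.exp (-(l * p.1)) * Complex.exp (-(c * p.2)) *
      rayIntegral (-contourArg N) (contourIntegrand N p.1 p.2)) := by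
  filter_upwards [ae_halfLine_prod] with p hp
  rw [ofReal_sojournKernel hN2 _ hp.2]
  ring

theorem integrable_laplace_sojournKernel (hN : Even N) (hN2 : 2 ≤ N) {l : ℝ} {c : ℂ} (hl : 0 < l)
    (hc : 0 ≤ c.re) : Integrable (fun p : ℝ × ℝ => Complex.exp (-(l * p.1)) *
      Complex.exp (-(c * p.2)) * (sojournKernel N p.1 p.2 : ℂ)) (halfLine.prod halfLine) := by
  have hφ := abs_of_pos (contourArg_pos hN2)
  exact (((integrable_laplace_ray hN hN2 hφ hl hc).sub (integrable_laplace_ray hN hN2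
    (by rwa [abs_neg]) hl hc)).const_mul _).congr (laplace_sojournKernel_ae hN2 l c).symm

theorem integral_laplace_sojournKernel (hN : Even N) (hN2 : 2 ≤ N) {a : ℝ} {c : ℂ} (ha : 0 < a)
    (hc : 0 ≤ c.re) : ∫ p : ℝ × ℝ, Complex.exp (-((a ^ N : ℝ) * p.1)) *
      Complex.exp (-(c * p.2)) * (sojournKernel N p.1 p.2 : ℂ) ∂(halfLine.prod halfLine) =
      (∏ θ ∈ rootsJ N, (θ * a + c))⁻¹ := by
  have hφ := abs_of_pos (contourArg_pos hN2)
  have hφ' : |-contourArg N| = contourArg N := by rwa [abs_neg]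
  have hl : 0 < a ^ N := pow_pos ha N
  rw [integral_congr_ae (laplace_sojournKernel_ae hN2 _ c), integral_const_mul,
    integral_sub (integrable_laplace_ray hN hN2 hφ hl hc) (integrable_laplace_ray hN hN2 hφ' hl hc),
    integral_laplace_ray hN hN2 hφ hl hc, integral_laplace_ray hN hN2 hφ' hl hc]
  exact rayIntegral_sub_rayIntegral hN hN2 ha hc

/-! ### Bounds and continuity -/

theorem integrable_pow_mul_exp_neg (hN2 : 2 ≤ N) (k : ℕ) {b : ℝ} (hb : 0 < b) :
    Integrable (fun r : ℝ => r ^ k * Real.exp (-(b * r ^ N))) halfLine := by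
  have hN0 : (0 : ℝ) < N := by exact_mod_cast (by omega : 0 < N)
  have h := integrableOn_rpow_mul_exp_neg_mul_rpow (p := N) (s := k) (b := b)
    (by linarith [(Nat.cast_nonneg k : (0 : ℝ) ≤ k)]) hN0 hb
  refine h.congr (Eventually.of_forall fun r => ?_)
  simp only [Real.rpow_natCast, neg_mul]

/-- A decreasing majorant of the kernel. -/
def kernelBound (N : ℕ) (u y : ℝ) : ℝ := N / Real.pi * (coeffNorm N *
  ∫ r, r ^ (N / 2) * Real.exp (-(u * r ^ N / 2)) * Real.exp (-(contourSlope N * r * y)) ∂halfLine)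

theorem integrable_kernelBound_integrand (hN2 : 2 ≤ N) {u y : ℝ} (hu : 0 < u) (hy : 0 ≤ y) :
    Integrable (fun r : ℝ => r ^ (N / 2) * Real.exp (-(u * r ^ N / 2)) *
      Real.exp (-(contourSlope N * r * y))) halfLine := by
  refine (integrable_pow_mul_exp_neg hN2 (N / 2) (half_pos hu)).mono'
    (Continuous.aestronglyMeasurable (by fun_prop)) ?_
  refine (ae_restrict_iff' measurableSet_Ioi).2 (Eventually.of_forall fun r hr => ?_)
  have hr : (0 : ℝ) < r := hr
  have hδ := contourSlope_pos hN2
  rw [Real.norm_of_nonneg (by positivity), div_mul_eq_mul_div]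
  refine mul_le_of_le_one_right (by positivity) (Real.exp_le_one_iff.2 ?_)
  have : 0 ≤ contourSlope N * r * y := by positivity
  linarith

theorem norm_rayIntegral_le (hN : Even N) (hN2 : 2 ≤ N) {u y : ℝ} (hu : 0 < u) (hy : 0 ≤ y) :
    ‖rayIntegral (contourArg N) (contourIntegrand N u y)‖ ≤ coeffNorm N *
      ∫ r, r ^ (N / 2) * Real.exp (-(u * r ^ N / 2)) *
        Real.exp (-(contourSlope N * r * y)) ∂halfLine := by
  have hφ := abs_of_pos (contourArg_pos hN2)
  rw [rayIntegral, ← integral_const_mul]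
  refine norm_integral_le_of_norm_le ((integrable_kernelBound_integrand hN2 hu hy).const_mul _) ?_
  refine (ae_restrict_iff' measurableSet_Ioi).2 (Eventually.of_forall fun r hr => ?_)
  rw [norm_mul, Complex.norm_exp_ofReal_mul_I, mul_one]
  exact norm_contourIntegrand_le (fun θ hθ => contourSlope_le hN hN2 hθ hφ.le)
    (cos_mul_le hN2 hφ.ge (hφ.le.trans (contourArg_le hN2))) (le_of_lt hr) hu.le hy

/-- Monotonicity makes the bound at `u₀` valid for all `u ≥ u₀`, as dominated convergence in `u`
requires. -/
theorem kernelBound_anti (hN2 : 2 ≤ N) {u u₀ y y₀ : ℝ} (hu₀ : 0 < u₀) (hu : u₀ ≤ u) (hy₀ : 0 ≤ y₀)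
    (hy : y₀ ≤ y) : kernelBound N u y ≤ kernelBound N u₀ y₀ := by
  have hδ := contourSlope_pos hN2
  refine mul_le_mul_of_nonneg_left (mul_le_mul_of_nonneg_left ?_ coeffNorm_nonneg)
    (by have := Real.pi_pos; positivity)
  refine setIntegral_mono_on (integrable_kernelBound_integrand hN2 (hu₀.trans_le hu) (hy₀.trans hy))
    (integrable_kernelBound_integrand hN2 hu₀ hy₀) measurableSet_Ioi fun r hr => ?_
  have hr : (0 : ℝ) < r := hr
  gcongr

theorem kernelBound_nonneg (u y : ℝ) : 0 ≤ kernelBound N u y := by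
  refine mul_nonneg (by have := Real.pi_pos; positivity) (mul_nonneg coeffNorm_nonneg ?_)
  refine setIntegral_nonneg measurableSet_Ioi fun r hr => ?_
  have hr : (0 : ℝ) < r := hr
  positivity

theorem abs_sojournKernel_le (hN : Even N) (hN2 : 2 ≤ N) {u u₀ y : ℝ} (hu₀ : 0 < u₀) (hu : u₀ ≤ u)
    (hy : 0 ≤ y) : |sojournKernel N u y| ≤ kernelBound N u₀ y := by
  refine le_trans ?_ (kernelBound_anti hN2 hu₀ hu hy le_rfl)
  unfold sojournKernel
  split_ifs with h
  · rw [abs_mul, abs_of_nonneg (by have := Real.pi_pos; positivity : (0 : ℝ) ≤ N / Real.pi)]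
    exact mul_le_mul_of_nonneg_left ((Complex.abs_im_le_norm _).trans
      (norm_rayIntegral_le hN hN2 (hu₀.trans_le hu) hy)) (by have := Real.pi_pos; positivity)
  · rw [abs_zero]
    exact kernelBound_nonneg _ _

theorem abs_sojournKernel_le_const (hN : Even N) (hN2 : 2 ≤ N) {u u₀ : ℝ} (hu₀ : 0 < u₀)
    (hu : u₀ ≤ u) (y : ℝ) : |sojournKernel N u y| ≤ kernelBound N u₀ 0 := by
  rcases le_or_gt y 0 with h | h
  · rw [sojournKernel_of_nonpos u h, abs_zero]
    exact kernelBound_nonneg _ _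
  · exact (abs_sojournKernel_le hN hN2 hu₀ hu h.le).trans (kernelBound_anti hN2 hu₀ le_rfl le_rfl h.le)

theorem integrable_kernelBound (hN2 : 2 ≤ N) {u : ℝ} (hu : 0 < u) :
    Integrable (kernelBound N u) halfLine := by
  have hδ := contourSlope_pos hN2
  refine (Integrable.const_mul ?_ _).const_mul _
  refine Integrable.integral_prod_left (f := fun p : ℝ × ℝ => p.2 ^ (N / 2) *
    Real.exp (-(u * p.2 ^ N / 2)) * Real.exp (-(contourSlope N * p.2 * p.1))) ?_
  rw [integrable_prod_iff' (Continuous.aestronglyMeasurable (by fun_prop))]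
  constructor
  · refine (ae_restrict_iff' measurableSet_Ioi).2 (Eventually.of_forall fun r hr => ?_)
    exact (integrable_exp_neg_mul (mul_pos hδ hr)).const_mul (r ^ (N / 2) * Real.exp (-(u * r ^ N / 2)))
  · refine ((integrable_pow_mul_exp_neg hN2 (N / 2 - 1) (half_pos hu)).const_mul
      (contourSlope N)⁻¹).congr
      ((ae_restrict_iff' measurableSet_Ioi).2 (Eventually.of_forall fun r hr => ?_))
    have hr : (0 : ℝ) < r := hr
    have hnn : ∀ y : ℝ, ‖r ^ (N / 2) * Real.exp (-(u * r ^ N / 2)) *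
        Real.exp (-(contourSlope N * r * y))‖ =
        r ^ (N / 2) * Real.exp (-(u * r ^ N / 2)) * Real.exp (-(contourSlope N * r * y)) :=
      fun y => Real.norm_of_nonneg (by positivity)
    simp only [hnn]
    rw [integral_const_mul, integral_exp_neg_mul (mul_pos hδ hr), mul_inv, div_mul_eq_mul_div]
    have : r ^ (N / 2) = r ^ (N / 2 - 1) * r := by
      rw [← pow_succ]; congr 1; omega
    rw [this]
    field_simp

theorem continuousAt_sojournKernel (hN : Even N) (hN2 : 2 ≤ N) {u y : ℝ} (hu : 0 < u) (hy : y ≠ 0) :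
    ContinuousAt (fun p : ℝ × ℝ => sojournKernel N p.1 p.2) (u, y) := by
  rcases hy.lt_or_gt with h | h
  · have : ∀ᶠ p : ℝ × ℝ in 𝓝 (u, y), sojournKernel N p.1 p.2 = 0 := by
      filter_upwards [continuous_snd.continuousAt.preimage_mem_nhds (Iio_mem_nhds h)] with p hp
      exact sojournKernel_of_nonpos _ (le_of_lt hp)
    exact continuousAt_const.congr (EventuallyEq.symm this)
  · have hpos : ∀ᶠ p : ℝ × ℝ in 𝓝 (u, y), u / 2 < p.1 ∧ 0 < p.2 := by
      filter_upwards [continuous_snd.continuousAt.preimage_mem_nhds (Ioi_mem_nhds h),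
        continuous_fst.continuousAt.preimage_mem_nhds
          (Ioi_mem_nhds (show u / 2 < (u, y).1 by simp only; linarith))] with p h1 h2
      exact ⟨h2, h1⟩
    have hφ := abs_of_pos (contourArg_pos hN2)
    have hc : ContinuousAt (fun p : ℝ × ℝ =>
        rayIntegral (contourArg N) (contourIntegrand N p.1 p.2)) (u, y) := by
      refine continuousAt_of_dominated (bound := fun r => coeffNorm N * (r ^ (N / 2) *
        Real.exp (-((u / 2) * r ^ N / 2)) * Real.exp (-(contourSlope N * r * 0)))) ?_ ?_
        ((integrable_kernelBound_integrand hN2 (half_pos hu) le_rfl).const_mul _) ?_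
      · refine Eventually.of_forall fun p => Continuous.aestronglyMeasurable ?_
        unfold contourIntegrand; fun_prop
      · filter_upwards [hpos] with p hp
        refine (ae_restrict_iff' measurableSet_Ioi).2 (Eventually.of_forall fun r hr => ?_)
        have hr : (0 : ℝ) < r := hr
        have hδ := contourSlope_pos hN2
        rw [norm_mul, Complex.norm_exp_ofReal_mul_I, mul_one]
        refine (norm_contourIntegrand_le (fun θ hθ => contourSlope_le hN hN2 hθ hφ.le)
          (cos_mul_le hN2 hφ.ge (hφ.le.trans (contourArg_le hN2))) hr.le
          ((half_pos hu).trans hp.1).le hp.2.le).trans ?_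
        have h1 := hp.1.le
        have h2 := hp.2.le
        have := coeffNorm_nonneg (N := N)
        gcongr
      · refine Eventually.of_forall fun r => Continuous.continuousAt ?_
        unfold contourIntegrand; fun_prop
    have h2 := (Complex.continuous_im.continuousAt.comp hc).const_mul (N / Real.pi)
    refine h2.congr ?_
    filter_upwards [hpos] with p hp
    simp [sojournKernel, hp.2]

end SojournKernel

/-! ### A convolution of functions of two variables -/

section Convolution

/-- The map `((t, s, x), y) ↦ ((s, y), (t - s, y - x))` is composed of permutations of coordinates,
a reflection and shears. -/
theorem measurePreserving_shear : MeasurePreserving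
    (fun p : (ℝ × ℝ × ℝ) × ℝ => ((p.1.2.1, p.2), (p.1.1 - p.1.2.1, p.2 - p.1.2.2))) := by
  have h1 : MeasurePreserving (fun q : ℝ × ℝ => (q.2, q.2 - q.1)) :=
    (MeasurePreserving.skew_product (g := fun a b : ℝ => a - b) (MeasurePreserving.id volume)
      (by fun_prop) (Eventually.of_forall fun a => (Measure.measurePreserving_sub_left volume a).map_eq)).comp
      Measure.measurePreserving_swap
  have h2 := ((volume_preserving_prodAssoc (α₁ := ℝ) (β₁ := ℝ) (γ₁ := ℝ)).symm.comp
    ((MeasurePreserving.id volume).prod h1)).comp volume_preserving_prodAssoc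
  have h3 := h2.skew_product (g := fun (a : (ℝ × ℝ) × ℝ) (t : ℝ) => t - a.1.1) (by fun_prop)
    (Eventually.of_forall fun a => (measurePreserving_sub_right volume a.1.1).map_eq)
  have h4 : MeasurePreserving (fun p : (ℝ × ℝ × ℝ) × ℝ => (((p.1.2.1, p.1.2.2), p.2), p.1.1)) :=
    (Measure.measurePreserving_swap (μ := (volume : Measure ℝ))
      (ν := (volume : Measure ((ℝ × ℝ) × ℝ)))).comp
      (volume_preserving_prodAssoc (α₁ := ℝ) (β₁ := ℝ × ℝ) (γ₁ := ℝ))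
  have h5 : MeasurePreserving (fun p : ((ℝ × ℝ) × ℝ) × ℝ => (p.1.1, (p.2, p.1.2))) :=
    ((MeasurePreserving.id (volume : Measure (ℝ × ℝ))).prod
      (Measure.measurePreserving_swap (μ := (volume : Measure ℝ)) (ν := (volume : Measure ℝ)))).comp
      (volume_preserving_prodAssoc (α₁ := ℝ × ℝ) (β₁ := ℝ) (γ₁ := ℝ))
  exact h5.comp (h3.comp h4)

/-- Fubini after the shear: `t` is split as `s + (t - s)` and `x` as `y - (y - x)`, with only the
intermediate position `y` integrated out. -/
theorem integrable_convolution {F G : ℝ × ℝ → ℂ} (hF : Integrable F) (hG : Integrable G) :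
    Integrable (fun p : ℝ × ℝ × ℝ => ∫ y, F (p.2.1, y) * G (p.1 - p.2.1, y - p.2.2)) ∧
    ∫ p : ℝ × ℝ × ℝ, ∫ y, F (p.2.1, y) * G (p.1 - p.2.1, y - p.2.2) =
      (∫ q, F q) * ∫ q, G q := by
  have h := hF.mul_prod hG
  have h' : Integrable (fun p : (ℝ × ℝ × ℝ) × ℝ =>
      F (p.1.2.1, p.2) * G (p.1.1 - p.1.2.1, p.2 - p.1.2.2)) :=
    (measurePreserving_shear.integrable_comp h.aestronglyMeasurable).2 h
  refine ⟨h'.integral_prod_left, ?_⟩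
  rw [← integral_prod_mul F G]
  refine (integral_prod _ h').symm.trans ?_
  have e := integral_map (μ := (volume : Measure ((ℝ × ℝ × ℝ) × ℝ)))
    measurePreserving_shear.aemeasurable (f := fun z : (ℝ × ℝ) × (ℝ × ℝ) => F z.1 * G z.2)
    (by rw [measurePreserving_shear.map_eq]; exact h.aestronglyMeasurable)
  rw [measurePreserving_shear.map_eq] at e
  exact e.symm

end Convolution

/-! ### The joint density -/

section Density

variable {N : ℕ}

/-- The joint density of the couple `(T(t), X(t))`. -/
def jointDensity (N : ℕ) (t s x : ℝ) : ℝ :=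
  ∫ y, sojournKernel N s y * sojournKernel N (t - s) (y - x)

/-- The integrand of the double Laplace transform of the kernel, on the whole plane. -/
def laplaceIntegrand (N : ℕ) (l : ℝ) (c : ℂ) : ℝ × ℝ → ℂ :=
  (Set.Ioi 0 ×ˢ Set.Ioi 0).indicator fun p =>
    Complex.exp (-(l * p.1)) * Complex.exp (-(c * p.2)) * (sojournKernel N p.1 p.2 : ℂ)

theorem integrable_laplaceIntegrand (hN : Even N) (hN2 : 2 ≤ N) {l : ℝ} {c : ℂ} (hl : 0 < l)
    (hc : 0 ≤ c.re) : Integrable (laplaceIntegrand N l c) := by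
  have h := integrable_laplace_sojournKernel hN hN2 hl hc
  rw [Measure.prod_restrict] at h
  exact (integrable_indicator_iff (measurableSet_Ioi.prod measurableSet_Ioi)).2 h

theorem integral_laplaceIntegrand (hN : Even N) (hN2 : 2 ≤ N) {l : ℝ} {c : ℂ} (hl : 0 < l)
    (hc : 0 ≤ c.re) : ∫ p, laplaceIntegrand N l c p =
      (∏ θ ∈ rootsJ N, (θ * (l ^ (1 / N : ℝ) : ℝ) + c))⁻¹ := by
  have h := integral_laplace_sojournKernel hN hN2 (Real.rpow_pos_of_pos hl (1 / N : ℝ)) hc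
  rw [rpow_inv_pow hN2 hl, Measure.prod_restrict] at h
  rw [← h]
  exact integral_indicator (measurableSet_Ioi.prod measurableSet_Ioi)

/-- The exponent splits as `-lt + iμx - νs = -(l+ν)s + iμy - l(t-s) - iμ(y-x)`. The cut-offs in the
two times produce `timeDomain`; those in space agree with the vanishing of the kernel. -/
theorem integral_laplaceIntegrand_mul (l μ ν : ℝ) (p : ℝ × ℝ × ℝ) :
    ∫ y, laplaceIntegrand N (l + ν) (-(Complex.I * μ)) (p.2.1, y) *
      laplaceIntegrand N l (Complex.I * μ) (p.1 - p.2.1, y - p.2.2) =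
    timeDomain.indicator (fun p : ℝ × ℝ × ℝ =>
      Complex.exp (-(l : ℂ) * p.1 + Complex.I * μ * p.2.2 - ν * p.2.1) *
        (jointDensity N p.1 p.2.1 p.2.2 : ℂ)) p := by
  obtain ⟨t, s, x⟩ := p
  by_cases hp : (t, s, x) ∈ timeDomain
  · have h1 : 0 < s := hp.1
    have h2 : s < t := hp.2
    rw [Set.indicator_of_mem hp, jointDensity, ← integral_complex_ofReal, ← integral_const_mul]
    congr 1
    ext y
    have h3 : 0 < t - s := sub_pos.2 h2
    by_cases hy : 0 < y
    · by_cases hyx : 0 < y - x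
      · rw [laplaceIntegrand, laplaceIntegrand, Set.indicator_of_mem
          (show (s, y) ∈ Set.Ioi (0 : ℝ) ×ˢ Set.Ioi (0 : ℝ) from ⟨h1, hy⟩), Set.indicator_of_mem
          (show (t - s, y - x) ∈ Set.Ioi (0 : ℝ) ×ˢ Set.Ioi (0 : ℝ) from ⟨h3, hyx⟩)]
        have e : Complex.exp (-(l : ℂ) * t + Complex.I * μ * x - ν * s) =
            Complex.exp (-((l + ν : ℝ) * s)) * Complex.exp (-(-(Complex.I * μ) * y)) *
            (Complex.exp (-(l * (t - s : ℝ))) * Complex.exp (-(Complex.I * μ * (y - x : ℝ)))) := by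
          rw [← Complex.exp_add, ← Complex.exp_add, ← Complex.exp_add]
          congr 1
          push_cast
          ring
        simp only
        rw [e]
        push_cast
        ring
      · rw [laplaceIntegrand, laplaceIntegrand, Set.indicator_of_notMem
          (a := (t - s, y - x)) fun h => hyx h.2]
        simp [sojournKernel_of_nonpos _ (not_lt.1 hyx)]
    · rw [laplaceIntegrand, laplaceIntegrand, Set.indicator_of_notMem (a := (s, y)) fun h => hy h.2]
      simp [sojournKernel_of_nonpos _ (not_lt.1 hy)]
  · rw [Set.indicator_of_notMem hp]
    refine integral_eq_zero_of_ae (Eventually.of_forall fun y => ?_)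
    simp only [laplaceIntegrand, Pi.zero_apply, mul_eq_zero]
    by_cases hs : 0 < s
    · refine Or.inr (Set.indicator_of_notMem (fun h => hp ⟨hs, ?_⟩) _)
      exact sub_pos.1 h.1
    · exact Or.inl (Set.indicator_of_notMem (fun h => hs h.1) _)

/-- The convolution identity with `c = -iμ` at rate `l + ν` and `c = iμ` at rate `l`. The case `ν =
0`, `μ = 0` is included because it yields integrability of `e^{-lt} f`. -/
theorem laplaceFourier_jointDensity (hN : Even N) (hN2 : 2 ≤ N) {l ν : ℝ} (hl : 0 < l) (hν : 0 ≤ ν)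
    (μ : ℝ) : IntegrableOn (fun p : ℝ × ℝ × ℝ =>
      Complex.exp (-(l : ℂ) * p.1 + Complex.I * μ * p.2.2 - ν * p.2.1) *
        (jointDensity N p.1 p.2.1 p.2.2 : ℂ)) timeDomain ∧
    ∫ p in timeDomain, Complex.exp (-(l : ℂ) * p.1 + Complex.I * μ * p.2.2 - ν * p.2.1) *
        (jointDensity N p.1 p.2.1 p.2.2 : ℂ) = limitTransform N l μ ν := by
  have hlν : 0 < l + ν := by linarith
  have h1 := integrable_laplaceIntegrand hN hN2 (c := -(Complex.I * μ)) hlν (by simp)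
  have h2 := integrable_laplaceIntegrand hN hN2 (c := Complex.I * μ) hl (by simp)
  have h := integrable_convolution h1 h2
  simp only [integral_laplaceIntegrand_mul] at h
  rw [integrable_indicator_iff measurableSet_timeDomain] at h
  refine ⟨h.1, (integral_indicator measurableSet_timeDomain).symm.trans (h.2.trans ?_)⟩
  rw [integral_laplaceIntegrand hN hN2 hlν (by simp), integral_laplaceIntegrand hN hN2 hl (by simp),
    limitTransform, mul_comm]
  simp only [sub_eq_add_neg]

theorem isJointDensity_jointDensity (hN : Even N) (hN2 : 2 ≤ N) :
    IsJointDensity N (jointDensity N) where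
  integrable l hl := by
    refine (laplaceFourier_jointDensity hN hN2 hl le_rfl 0).1.re.congr
      (Eventually.of_forall fun p => ?_)
    have : -(l : ℂ) * p.1 + Complex.I * (0 : ℝ) * p.2.2 - (0 : ℝ) * p.2.1 = ((-l * p.1 : ℝ) : ℂ) := by
      push_cast; ring
    simp only
    rw [this, ← Complex.ofReal_exp, ← Complex.ofReal_mul]
    rfl
  transform l μ ν hl hν := by
    rw [(laplaceFourier_jointDensity hN hN2 hl hν.le μ).2]
    exact hasPseudoExpectation_transformTerm hN hN2 hl hν μ

theorem IsJointDensity.integrable_mul {g : ℝ → ℝ → ℝ → ℝ} (hg : IsJointDensity N g) {l ν : ℝ}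
    (hl : 0 < l) (hν : 0 ≤ ν) (μ : ℝ) : IntegrableOn (fun p : ℝ × ℝ × ℝ =>
      Complex.exp (-(l : ℂ) * p.1 + Complex.I * μ * p.2.2 - ν * p.2.1) *
        (g p.1 p.2.1 p.2.2 : ℂ)) timeDomain := by
  have h := integrable_ofReal_comp (hg.integrable l hl)
  refine (h.bdd_mul (c := 1) (f := fun p : ℝ × ℝ × ℝ =>
    Complex.exp (Complex.I * μ * p.2.2 - ν * p.2.1))
    (Continuous.aestronglyMeasurable (by fun_prop)) ?_).congr (Eventually.of_forall fun p => ?_)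
  · filter_upwards [self_mem_ae_restrict measurableSet_timeDomain] with p hp
    rw [Complex.norm_exp, Real.exp_le_one_iff]
    have := mul_nonneg hν hp.1.le
    simpa using this
  · simp only
    push_cast
    rw [← mul_assoc, ← Complex.exp_add]
    congr 2
    ring

/-- Joint densities are unique almost everywhere. -/
theorem IsJointDensity.ae_eq {f g : ℝ → ℝ → ℝ → ℝ} (hf : IsJointDensity N f)
    (hg : IsJointDensity N g) : ∀ᵐ p : ℝ × ℝ × ℝ, p ∈ timeDomain →
      g p.1 p.2.1 p.2.2 = f p.1 p.2.1 p.2.2 := by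
  set E : ℝ → ℝ → ℝ → ℝ × ℝ × ℝ → ℂ := fun l μ ν p =>
    Complex.exp (-(l : ℂ) * p.1 + Complex.I * μ * p.2.2 - ν * p.2.1) with hE
  have hi : ∀ {l ν : ℝ}, 0 < l → 0 ≤ ν → ∀ μ, IntegrableOn (fun p : ℝ × ℝ × ℝ => E l μ ν p *
      ((g p.1 p.2.1 p.2.2 : ℂ) - f p.1 p.2.1 p.2.2)) timeDomain := by
    intro l ν hl hν μ
    simp only [mul_sub]
    exact (hg.integrable_mul hl hν μ).sub (hf.integrable_mul hl hν μ)
  have hz : ∀ {l ν : ℝ}, 0 < l → 0 < ν → ∀ μ, ∫ p in timeDomain, E l μ ν p *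
      ((g p.1 p.2.1 p.2.2 : ℂ) - f p.1 p.2.1 p.2.2) = 0 := by
    intro l ν hl hν μ
    simp only [mul_sub]
    rw [integral_sub (hg.integrable_mul hl hν.le μ) (hf.integrable_mul hl hν.le μ), sub_eq_zero]
    exact tendsto_nhds_unique (hg.transform l μ ν hl hν).tendsto (hf.transform l μ ν hl hν).tendsto
  -- The weight `e^{-t-s}` makes the difference integrable and shifts the exponents `j, k ≥ 0` to
  -- the admissible values `l = j + 1`, `ν = k + 1`.
  have h := ae_eq_zero_of_laplaceFourier (hi one_pos zero_le_one 0) fun j k μ => by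
    rw [← hz (l := j + 1) (ν := k + 1) (by positivity) (by positivity) μ]
    congr 1
    ext p
    rw [← mul_assoc, hE]
    simp only [← Complex.exp_add]
    congr 2
    push_cast
    ring
  filter_upwards [(ae_restrict_iff' measurableSet_timeDomain).1 h] with p hp hmem
  have h1 := hp hmem
  rw [Pi.zero_apply, mul_eq_zero, or_iff_right (Complex.exp_ne_zero _), sub_eq_zero] at h1
  exact_mod_cast h1

theorem aestronglyMeasurable_sojournKernel (hN : Even N) (hN2 : 2 ≤ N) {u : ℝ} (hu : 0 < u) :
    AEStronglyMeasurable (sojournKernel N u) := by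
  have h : ContinuousOn (sojournKernel N u) {0}ᶜ := fun y hy => by
    have := (continuousAt_sojournKernel hN hN2 hu hy).comp
      (f := fun y : ℝ => (u, y)) (by fun_prop)
    exact this.continuousWithinAt
  have h1 := h.aestronglyMeasurable (μ := volume) (measurableSet_singleton (0 : ℝ)).compl
  rwa [restrict_compl_singleton] at h1

theorem aestronglyMeasurable_jointDensity_integrand (hN : Even N) (hN2 : 2 ≤ N) {s u : ℝ}
    (hs : 0 < s) (hu : 0 < u) (x : ℝ) :
    AEStronglyMeasurable (fun y => sojournKernel N s y * sojournKernel N u (y - x)) :=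
  (aestronglyMeasurable_sojournKernel hN hN2 hs).mul
    ((aestronglyMeasurable_sojournKernel hN hN2 hu).comp_quasiMeasurePreserving
      (measurePreserving_sub_right volume x).quasiMeasurePreserving)

theorem continuousOn_jointDensity (hN : Even N) (hN2 : 2 ≤ N) :
    ContinuousOn (fun p : ℝ × ℝ × ℝ => jointDensity N p.1 p.2.1 p.2.2) timeDomain := by
  rintro ⟨t₀, s₀, x₀⟩ ⟨h1, h2⟩
  have hs₀ : 0 < s₀ := h1
  have hu₀ : 0 < t₀ - s₀ := sub_pos.2 h2
  refine ContinuousAt.continuousWithinAt ?_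
  have ev : ∀ᶠ p : ℝ × ℝ × ℝ in 𝓝 (t₀, s₀, x₀), s₀ / 2 < p.2.1 ∧ (t₀ - s₀) / 2 < p.1 - p.2.1 := by
    have c1 : ContinuousAt (fun p : ℝ × ℝ × ℝ => p.2.1) (t₀, s₀, x₀) := by fun_prop
    have c2 : ContinuousAt (fun p : ℝ × ℝ × ℝ => p.1 - p.2.1) (t₀, s₀, x₀) := by fun_prop
    exact (c1.eventually (lt_mem_nhds (half_lt_self hs₀))).and
      (c2.eventually (lt_mem_nhds (half_lt_self hu₀)))
  -- Near the base point both times stay above half their values; the first kernel supplies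
  -- integrability in `y`, the second only needs to be bounded.
  refine continuousAt_of_dominated (bound := (Set.Ioi 0).indicator fun y =>
    kernelBound N (s₀ / 2) y * kernelBound N ((t₀ - s₀) / 2) 0) ?_ ?_ ?_ ?_
  · filter_upwards [ev] with p hp
    exact aestronglyMeasurable_jointDensity_integrand hN hN2 ((half_pos hs₀).trans hp.1)
      ((half_pos hu₀).trans hp.2) _
  · filter_upwards [ev] with p hp
    refine Eventually.of_forall fun y => ?_
    rw [norm_mul]
    rcases le_or_gt y 0 with hy | hy
    · rw [sojournKernel_of_nonpos _ hy, norm_zero, zero_mul,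
        Set.indicator_of_notMem (show y ∉ Set.Ioi 0 from hy.not_gt)]
    · rw [Set.indicator_of_mem (show y ∈ Set.Ioi 0 from hy)]
      exact mul_le_mul (abs_sojournKernel_le hN hN2 (half_pos hs₀) hp.1.le hy.le)
        (abs_sojournKernel_le_const hN hN2 (half_pos hu₀) hp.2.le _) (norm_nonneg _)
        (kernelBound_nonneg _ _)
  · rw [integrable_indicator_iff measurableSet_Ioi]
    exact (integrable_kernelBound hN2 (half_pos hs₀)).mul_const _
  -- Continuity of the two kernels is known only away from their cut-offs, which sit at the null set
  -- `y = 0`, `y = x₀`.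
  · have hae : ∀ᵐ y : ℝ, y ≠ 0 ∧ y ≠ x₀ := by
      have h : ∀ z : ℝ, ∀ᵐ y : ℝ, y ≠ z := fun z => by simp [ae_iff]
      exact (h 0).and (h x₀)
    filter_upwards [hae] with y hy
    have c1 := (continuousAt_sojournKernel hN hN2 hs₀ hy.1).comp (x := (t₀, s₀, x₀))
      (f := fun p : ℝ × ℝ × ℝ => (p.2.1, y)) (by fun_prop)
    have c2 := (continuousAt_sojournKernel hN hN2 hu₀ (sub_ne_zero.2 hy.2)).comp (x := (t₀, s₀, x₀))
      (f := fun p : ℝ × ℝ × ℝ => (p.1 - p.2.1, y - p.2.2)) (by fun_prop)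
    exact c1.mul c2

end Density

/-! ### The Mittag-Leffler function `E_{1,β}` -/

section MittagLeffler

variable {β : ℝ}

theorem factorial_mul_le_Gamma (hβ : 0 < β) (r : ℕ) :
    (r.factorial : ℝ) * Real.Gamma (β + 1) ≤ Real.Gamma (r + 1 + β) := by
  induction r with
  | zero => simp [add_comm]
  | succ r ih =>
    have h : ((r + 1 : ℕ) : ℝ) + 1 + β = (r + 1 + β) + 1 := by push_cast; ring
    have hr : (0 : ℝ) ≤ r := Nat.cast_nonneg r
    have h0 : 0 ≤ Real.Gamma (β + 1) := (Real.Gamma_pos_of_pos (by linarith)).le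
    rw [h, Real.Gamma_add_one (s := r + 1 + β) (by positivity), Nat.factorial_succ]
    push_cast
    rw [mul_assoc]
    exact mul_le_mul (by linarith) ih (mul_nonneg (Nat.cast_nonneg _) h0) (by linarith)

theorem summable_pow_div_Gamma (hβ : 0 < β) (x : ℝ) :
    Summable fun r : ℕ => |x| ^ r / Real.Gamma (r + β) := by
  refine (summable_nat_add_iff 1).1 ?_
  have hG : 0 < Real.Gamma (β + 1) := Real.Gamma_pos_of_pos (by linarith)
  refine Summable.of_nonneg_of_le (fun r => ?_) (fun r => ?_)
    ((Real.summable_pow_div_factorial |x|).mul_left (|x| / Real.Gamma (β + 1)))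
  · have : 0 < Real.Gamma (((r + 1 : ℕ) : ℝ) + β) := Real.Gamma_pos_of_pos (by positivity)
    positivity
  · have h := factorial_mul_le_Gamma hβ r
    have hf : (0 : ℝ) < r.factorial := by exact_mod_cast r.factorial_pos
    have e : |x| / Real.Gamma (β + 1) * (|x| ^ r / r.factorial) =
        |x| ^ (r + 1) / (r.factorial * Real.Gamma (β + 1)) := by
      field_simp
      ring
    rw [e]
    push_cast
    exact div_le_div_of_nonneg_left (by positivity) (by positivity) h

theorem norm_mittagLeffler_term (hβ : 0 < β) (z : ℂ) (r : ℕ) :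
    ‖z ^ r / (Real.Gamma (1 * r + β) : ℂ)‖ = |‖z‖| ^ r / Real.Gamma (r + β) := by
  have : 0 < Real.Gamma (r + β) := Real.Gamma_pos_of_pos (by positivity)
  rw [one_mul, norm_div, norm_pow, Complex.norm_real, Real.norm_of_nonneg this.le, abs_norm]

theorem summable_mittagLeffler (hβ : 0 < β) (z : ℂ) :
    Summable fun r : ℕ => z ^ r / (Real.Gamma (1 * r + β) : ℂ) :=
  Summable.of_norm (by
    simp only [norm_mittagLeffler_term hβ]
    exact summable_pow_div_Gamma hβ _)

theorem continuous_mittagLeffler (hβ : 0 < β) : Continuous (mittagLeffler 1 β) := by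
  rw [continuous_iff_continuousAt]
  intro z
  have h : ContinuousOn (mittagLeffler 1 β) (Metric.ball 0 (‖z‖ + 1)) := by
    refine continuousOn_tsum (fun r => by fun_prop) (summable_pow_div_Gamma hβ (‖z‖ + 1))
      fun r w hw => ?_
    rw [norm_mittagLeffler_term hβ]
    have : 0 < Real.Gamma (r + β) := Real.Gamma_pos_of_pos (by positivity)
    have hw' : ‖w‖ ≤ ‖z‖ + 1 := (mem_ball_zero_iff.1 hw).le
    have h2 : |‖w‖| ≤ |‖z‖ + 1| := by
      rw [abs_norm, abs_of_nonneg (by positivity)]; exact hw'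
    gcongr
  exact h.continuousAt (Metric.isOpen_ball.mem_nhds (by simp))

theorem mittagLeffler_eq_add (hβ : 0 < β) (z : ℂ) :
    mittagLeffler 1 β z = 1 / (Real.Gamma β : ℂ) + z * mittagLeffler 1 (β + 1) z := by
  rw [mittagLeffler, (summable_mittagLeffler hβ z).tsum_eq_zero_add, mittagLeffler,
    ← tsum_mul_left]
  congr 1
  · simp
  · refine tsum_congr fun r => ?_
    have : (1 : ℝ) * ((r + 1 : ℕ) : ℝ) + β = 1 * r + (β + 1) := by push_cast; ring
    rw [this, pow_succ]
    ring

/-- Beta integrals give `Γ(β) E_{1,β+1}(-x) = ∫₀¹ (1-τ)^{β-1} e^{-xτ} dτ`, bounded uniformly in `x ≥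
0`. The shift of the parameter by one makes the weight integrable for every `β > 0`. -/
theorem exists_norm_mittagLeffler_add_one_le (hβ : 0 < β) :
    ∃ C : ℝ, ∀ x : ℝ, 0 ≤ x → ‖mittagLeffler 1 (β + 1) ((-x : ℝ) : ℂ)‖ ≤ C := by
  set w : ℝ → ℂ := fun τ => (1 - (τ : ℂ)) ^ ((β : ℂ) - 1) with hw
  have hG : (Real.Gamma β : ℂ) ≠ 0 := by exact_mod_cast (Real.Gamma_pos_of_pos hβ).ne'
  have hwi : IntegrableOn w (Set.Ioc 0 1) := by
    have h := Complex.betaIntegral_convergent (u := 1) (v := β) (by simp) (by simpa using hβ)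
    rw [intervalIntegrable_iff_integrableOn_Ioc_of_le zero_le_one] at h
    simpa using h
  have hbeta : ∀ r : ℕ, ∫ τ in Set.Ioc (0 : ℝ) 1, (τ : ℂ) ^ r * w τ =
      (r.factorial : ℂ) * Real.Gamma β / Real.Gamma (1 * r + (β + 1)) := by
    intro r
    have hGr : (Real.Gamma (1 * r + (β + 1)) : ℂ) ≠ 0 := by
      exact_mod_cast (Real.Gamma_pos_of_pos (by positivity)).ne'
    have h := Complex.Gamma_mul_Gamma_eq_betaIntegral (s := (r : ℂ) + 1) (t := β)
      (by simp; positivity) (by simpa using hβ)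
    rw [Complex.Gamma_nat_eq_factorial, Complex.Gamma_ofReal] at h
    have e : ((r : ℂ) + 1 + β) = ((1 * r + (β + 1) : ℝ) : ℂ) := by push_cast; ring
    rw [e, Complex.Gamma_ofReal, Complex.betaIntegral,
      intervalIntegral.integral_of_le zero_le_one] at h
    rw [eq_div_iff hGr, mul_comm, h]
    congr 1
    refine setIntegral_congr_fun measurableSet_Ioc fun τ _ => ?_
    simp only [add_sub_cancel_right, Complex.cpow_natCast, hw]
  refine ⟨∫ τ in Set.Ioc (0 : ℝ) 1, ‖w τ‖ / Real.Gamma β, fun x hx => ?_⟩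
  set F : ℕ → ℝ → ℂ := fun r τ => ((-x : ℝ) * (τ : ℂ)) ^ r / r.factorial * (w τ / Real.Gamma β)
  have hFn : ∀ (r : ℕ) (τ : ℝ), τ ∈ Set.Ioc (0 : ℝ) 1 →
      ‖((-x : ℝ) * (τ : ℂ)) ^ r / r.factorial‖ ≤ x ^ r / r.factorial := by
    intro r τ hτ
    have hf : ‖(r.factorial : ℂ)‖ = r.factorial := by simp
    rw [norm_div, norm_pow, norm_mul, Complex.norm_real, Complex.norm_real, norm_neg,
      Real.norm_of_nonneg hx, Real.norm_of_nonneg hτ.1.le, hf]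
    have := mul_le_of_le_one_right hx hτ.2
    have := hτ.1.le
    gcongr
  have hFi : ∀ r, IntegrableOn (F r) (Set.Ioc 0 1) := fun r =>
    (hwi.div_const _).bdd_mul (c := x ^ r / r.factorial)
      (Continuous.aestronglyMeasurable (by fun_prop))
      ((ae_restrict_iff' measurableSet_Ioc).2 (Eventually.of_forall fun τ hτ => hFn r τ hτ))
  have hWi : IntegrableOn (fun τ => ‖w τ‖ / Real.Gamma β) (Set.Ioc 0 1) := hwi.norm.div_const _
  have hGp := Real.Gamma_pos_of_pos hβ
  have hnw : ∀ τ, ‖w τ / Real.Gamma β‖ = ‖w τ‖ / Real.Gamma β := by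
    intro τ
    rw [norm_div, Complex.norm_real, Real.norm_of_nonneg hGp.le]
  have hsum : Summable fun r => ∫ τ in Set.Ioc (0 : ℝ) 1, ‖F r τ‖ := by
    refine Summable.of_nonneg_of_le (fun r => integral_nonneg fun _ => norm_nonneg _) (fun r => ?_)
      ((Real.summable_pow_div_factorial x).mul_right
        (∫ τ in Set.Ioc (0 : ℝ) 1, ‖w τ‖ / Real.Gamma β))
    rw [← integral_const_mul]
    refine setIntegral_mono_on (hFi r).norm (hWi.const_mul _) measurableSet_Ioc fun τ hτ => ?_
    rw [norm_mul, hnw]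
    exact mul_le_mul_of_nonneg_right (hFn r τ hτ) (by positivity)
  have hs := (hasSum_integral_of_summable_integral_norm hFi hsum).tsum_eq
  have hE : mittagLeffler 1 (β + 1) ((-x : ℝ) : ℂ) = ∫ τ in Set.Ioc (0 : ℝ) 1, ∑' r, F r τ := by
    rw [← hs, mittagLeffler]
    refine tsum_congr fun r => ?_
    have hf : (r.factorial : ℂ) ≠ 0 := by exact_mod_cast r.factorial_ne_zero
    have e : ∀ τ, F r τ = ((-x : ℝ) : ℂ) ^ r / (r.factorial * Real.Gamma β) * ((τ : ℂ) ^ r * w τ) := by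
      intro τ
      simp only [F, mul_pow]
      field_simp
    simp only [e]
    rw [integral_const_mul, hbeta]
    field_simp
  rw [hE]
  refine norm_integral_le_of_norm_le hWi
    ((ae_restrict_iff' measurableSet_Ioc).2 (Eventually.of_forall fun τ hτ => ?_))
  have h1 : ∑' r, F r τ = Complex.exp ((-x : ℝ) * (τ : ℂ)) * (w τ / Real.Gamma β) := by
    rw [tsum_mul_right, Complex.exp_eq_exp_ℂ, NormedSpace.exp_eq_tsum_div]
  rw [h1, norm_mul, hnw, Complex.norm_exp]
  refine mul_le_of_le_one_left (by positivity) (Real.exp_le_one_iff.2 ?_)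
  have := mul_nonneg hx hτ.1.le
  simpa using this

/-- Linear growth is crude but enough: in the density it meets the factor `e^{-(t-s)ξᴺ}`. -/
theorem exists_norm_mittagLeffler_le (hβ : 0 < β) :
    ∃ C : ℝ, 0 ≤ C ∧ ∀ x : ℝ, 0 ≤ x → ‖mittagLeffler 1 β ((-x : ℝ) : ℂ)‖ ≤ C * (1 + x) := by
  obtain ⟨C, hC⟩ := exists_norm_mittagLeffler_add_one_le hβ
  have hC0 : 0 ≤ C := (norm_nonneg _).trans (hC 0 le_rfl)
  have hG := Real.Gamma_pos_of_pos hβ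
  refine ⟨1 / Real.Gamma β + C, by positivity, fun x hx => ?_⟩
  rw [mittagLeffler_eq_add hβ]
  refine (norm_add_le _ _).trans ?_
  rw [norm_mul, norm_div, norm_one, Complex.norm_real, Complex.norm_real, norm_neg,
    Real.norm_of_nonneg hx, Real.norm_of_nonneg hG.le]
  have h1 := mul_le_mul_of_nonneg_left (hC x hx) hx
  have h2 : 0 ≤ 1 / Real.Gamma β * x := by positivity
  nlinarith

theorem integrable_rpow_mul_exp_neg {l b : ℝ} (hl : 0 < l) (hb : 0 < b) :
    IntegrableOn (fun s : ℝ => s ^ (b - 1) * Real.exp (-(l * s))) (Set.Ioi 0) := by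
  have h := integrableOn_rpow_mul_exp_neg_mul_rpow (p := 1) (s := b - 1) (by linarith) one_pos hl
  simpa only [Real.rpow_one, neg_mul] using h

theorem integrable_laplace_mittagLeffler (hβ : 0 < β) {x l : ℝ} (hx : 0 ≤ x) (hl0 : 0 < l) :
    IntegrableOn (fun s : ℝ => Complex.exp (-(l * s)) * (((s ^ (β - 1) : ℝ) : ℂ) *
      mittagLeffler 1 β ((-s * x : ℝ) : ℂ))) (Set.Ioi 0) := by
  obtain ⟨C, hC0, hC⟩ := exists_norm_mittagLeffler_le hβ
  have hb := ((integrable_rpow_mul_exp_neg hl0 hβ).add ((integrable_rpow_mul_exp_neg hl0 (b := β + 1) (by linarith)).const_mul x)).const_mul C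
  refine hb.mono' ?_ ?_
  · refine ContinuousOn.aestronglyMeasurable (fun s hs => ContinuousAt.continuousWithinAt ?_)
      measurableSet_Ioi
    have h1 : ContinuousAt (fun s : ℝ => s ^ (β - 1)) s :=
      Real.continuousAt_rpow_const _ _ (Or.inl (ne_of_gt hs))
    have h2 : ContinuousAt (fun s : ℝ => mittagLeffler 1 β ((-s * x : ℝ) : ℂ)) s :=
      ((continuous_mittagLeffler hβ).comp
        (Complex.continuous_ofReal.comp (by fun_prop))).continuousAt
    exact (Continuous.continuousAt (by fun_prop)).mul
      ((Complex.continuous_ofReal.continuousAt.comp h1).mul h2)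
  · refine (ae_restrict_iff' measurableSet_Ioi).2 (Eventually.of_forall fun s hs => ?_)
    have hs : 0 < s := hs
    have h1 : ‖Complex.exp (-((l : ℂ) * s))‖ = Real.exp (-(l * s)) := by
      rw [Complex.norm_exp]; simp
    have h2 := hC (s * x) (by positivity)
    have h3 : s ^ (β + 1 - 1) = s ^ (β - 1) * s := by
      rw [← Real.rpow_add_one hs.ne']; ring_nf
    have h4 := Real.rpow_pos_of_pos hs (β - 1)
    rw [norm_mul, norm_mul, h1, Complex.norm_real, Real.norm_of_nonneg h4.le, neg_mul]
    simp only [Pi.add_apply, h3]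
    calc _ ≤ Real.exp (-(l * s)) * (s ^ (β - 1) * (C * (1 + s * x))) := by gcongr
      _ = _ := by ring

/-- The Laplace transform of `s^{β-1} E_{1,β}(-xs)`. -/
theorem integral_laplace_mittagLeffler (hβ : 0 < β) {x l : ℝ} (hx : 0 ≤ x) (hl : x < l) :
    ∫ s in Set.Ioi (0 : ℝ), Complex.exp (-(l * s)) * (((s ^ (β - 1) : ℝ) : ℂ) *
      mittagLeffler 1 β ((-s * x : ℝ) : ℂ)) = ((l ^ (1 - β) / (l + x) : ℝ) : ℂ) := by
  have hl0 : 0 < l := hx.trans_lt hl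
  set F : ℕ → ℝ → ℂ := fun r s => Complex.exp (-(l * s)) * (((s ^ (β - 1) : ℝ) : ℂ) *
    (((-s * x : ℝ) : ℂ) ^ r / (Real.Gamma (1 * r + β) : ℂ)))
  have hGr : ∀ r : ℕ, 0 < Real.Gamma (r + β) := fun r => Real.Gamma_pos_of_pos (by positivity)
  have hF : ∀ r s, 0 < s → F r s = (((-x) ^ r / Real.Gamma (r + β) *
      (s ^ ((r + β) - 1) * Real.exp (-(l * s))) : ℝ) : ℂ) := by
    intro r s hs
    have e : s ^ ((r : ℝ) + β - 1) = s ^ (β - 1) * s ^ r := by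
      rw [← Real.rpow_natCast, ← Real.rpow_add hs]; ring_nf
    simp only [F]
    rw [e, one_mul]
    have e2 : ((-s * x : ℝ) : ℂ) ^ r = (-(x : ℂ)) ^ r * (s : ℂ) ^ r := by
      rw [← mul_pow]; push_cast; ring_nf
    rw [e2]
    push_cast
    ring
  have hFi : ∀ r, IntegrableOn (F r) (Set.Ioi 0) := fun r =>
    (integrable_ofReal_comp ((integrable_rpow_mul_exp_neg hl0 (b := r + β) (by positivity)).const_mul
      ((-x) ^ r / Real.Gamma (r + β)))).congr
      ((ae_restrict_iff' measurableSet_Ioi).2 (Eventually.of_forall fun s hs => (hF r s hs).symm))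
  have hI : ∀ r : ℕ, ∫ s in Set.Ioi (0 : ℝ), s ^ (((r : ℝ) + β) - 1) * Real.exp (-(l * s)) =
      (1 / l) ^ r * l ^ (-β) * Real.Gamma (r + β) := by
    intro r
    rw [Real.integral_rpow_mul_exp_neg_mul_Ioi (by positivity) hl0,
      Real.rpow_add (by positivity), Real.rpow_natCast, one_div l, Real.inv_rpow hl0.le,
      Real.rpow_neg hl0.le]
  -- Termwise integration produces the geometric series of ratio `-x/l`; its absolute convergence is
  -- where `x < l` is needed.
  have hsum : Summable fun r => ∫ s in Set.Ioi (0 : ℝ), ‖F r s‖ := by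
    have hg : Summable fun r : ℕ => (x / l) ^ r :=
      summable_geometric_of_lt_one (by positivity) ((div_lt_one hl0).2 hl)
    refine (hg.mul_right (l ^ (-β))).congr fun r => ?_
    have e : ∀ s ∈ Set.Ioi (0 : ℝ), ‖F r s‖ = x ^ r / Real.Gamma (r + β) *
        (s ^ ((r + β) - 1) * Real.exp (-(l * s))) := by
      intro s hs
      have hs : 0 < s := hs
      have h1 := Real.rpow_pos_of_pos hs ((r + β) - 1)
      rw [hF r s hs, Complex.norm_real, norm_mul, norm_div, norm_pow, norm_neg,
        Real.norm_of_nonneg hx, Real.norm_of_nonneg (hGr r).le, Real.norm_of_nonneg (by positivity)]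
    rw [setIntegral_congr_fun measurableSet_Ioi e, integral_const_mul, hI]
    have := (hGr r).ne'
    rw [div_pow, div_pow, one_pow]
    field_simp
  have hs := hasSum_integral_of_summable_integral_norm hFi hsum
  have hterm : ∀ r, ∫ s in Set.Ioi (0 : ℝ), F r s = (((l ^ (-β) * (-x / l) ^ r : ℝ)) : ℂ) := by
    intro r
    rw [setIntegral_congr_fun measurableSet_Ioi fun s hs => hF r s hs, integral_complex_ofReal,
      integral_const_mul, hI]
    congr 1
    have := (hGr r).ne'
    rw [div_pow, div_pow, one_pow]
    field_simp
  simp only [hterm] at hs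
  have hgeo : HasSum (fun r : ℕ => (((l ^ (-β) * (-x / l) ^ r : ℝ)) : ℂ))
      ((l ^ (-β) * (1 - -x / l)⁻¹ : ℝ) : ℂ) := by
    have h0 : ‖-x / l‖ < 1 := by
      rw [norm_div, norm_neg, Real.norm_of_nonneg hx, Real.norm_of_nonneg hl0.le, div_lt_one hl0]
      exact hl
    have h1 : HasSum (fun r : ℕ => (-x / l) ^ r) (1 - -x / l)⁻¹ :=
      hasSum_geometric_of_norm_lt_one h0
    exact Complex.hasSum_ofReal.2 (h1.mul_left (l ^ (-β)))
  have e := hs.unique hgeo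
  have hE : ∀ s : ℝ, Complex.exp (-(l * s)) * (((s ^ (β - 1) : ℝ) : ℂ) *
      mittagLeffler 1 β ((-s * x : ℝ) : ℂ)) = ∑' r, F r s := by
    intro s
    rw [mittagLeffler, ← tsum_mul_left, ← tsum_mul_left]
  have hval : l ^ (-β) * (1 - -x / l)⁻¹ = l ^ (1 - β) / (l + x) := by
    have h1 : l ^ (1 - β) = l * l ^ (-β) := by
      rw [Real.rpow_sub hl0, Real.rpow_one, Real.rpow_neg hl0.le, div_eq_mul_inv]
    have h2 : 1 - -x / l = (l + x) / l := by field_simp; ring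
    rw [h1, h2, inv_div]
    ring
  rw [← hval]
  exact (integral_congr_ae (Eventually.of_forall hE)).trans e

end MittagLeffler

/-! ### The density on the negative half line -/

section NegativeHalfLine

variable {N : ℕ}

theorem norm_contourIntegrand_le_of_abs_le (hN : Even N) (hN2 : 2 ≤ N) {ψ r u y : ℝ}
    (h1 : contourArg N ≤ |ψ|) (h2 : |ψ| ≤ Real.pi / N) (hr : 0 ≤ r) (hu : 0 ≤ u) (hy : 0 ≤ y) :
    ‖contourIntegrand N u y (r * Complex.exp (ψ * Complex.I))‖ ≤
      coeffNorm N * (r ^ (N / 2) * Real.exp (-(u / 2 * r ^ N))) := by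
  have h := norm_contourIntegrand_le (fun θ hθ => re_mul_exp_nonneg hN hN2 hθ h2)
    (cos_mul_le hN2 h1 h2) hr hu hy
  rwa [zero_mul, zero_mul, neg_zero, Real.exp_zero, mul_one, ← div_mul_eq_mul_div] at h

theorem integrableOn_contourIntegrand (hN : Even N) (hN2 : 2 ≤ N) {ψ u y : ℝ}
    (h1 : contourArg N ≤ |ψ|) (h2 : |ψ| ≤ Real.pi / N) (hu : 0 < u) (hy : 0 ≤ y) :
    IntegrableOn (fun r : ℝ => contourIntegrand N u y (r * Complex.exp (ψ * Complex.I)))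
      (Set.Ioi 0) := by
  refine ((integrable_pow_mul_exp_neg hN2 (N / 2) (half_pos hu)).const_mul (coeffNorm N)).mono' ?_
    ((ae_restrict_iff' measurableSet_Ioi).2 (Eventually.of_forall fun r hr =>
      norm_contourIntegrand_le_of_abs_le hN hN2 h1 h2 (le_of_lt hr) hu.le hy))
  refine Continuous.aestronglyMeasurable ?_
  unfold contourIntegrand; fun_prop

theorem tendsto_pow_mul_exp_neg (hN2 : 2 ≤ N) (k : ℕ) {b : ℝ} (hb : 0 < b) :
    Tendsto (fun r : ℝ => r ^ k * Real.exp (-(b * r ^ N))) atTop (𝓝 0) := by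
  have h := (tendsto_rpow_mul_exp_neg_mul_atTop_nhds_zero k b hb).comp
    (tendsto_pow_atTop (α := ℝ) (n := N) (by omega))
  refine squeeze_zero' ?_ ?_ h
  · filter_upwards [eventually_gt_atTop 0] with r hr
    positivity
  · filter_upwards [eventually_ge_atTop 1] with r hr
    simp only [Function.comp_apply, Real.rpow_natCast, neg_mul]
    have : r ≤ r ^ N := le_self_pow₀ hr (by omega)
    gcongr

/-- The ray is turned to argument `π/N`, where `ζᴺ = -rᴺ` is real. The factors `e^{-θζy}` are then
merely bounded, so convergence rests on `e^{uζᴺ}` with `u > 0`; for the joint Laplace transform in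
`u` and `y` the smaller angle was required. -/
theorem rayIntegral_contourArg (hN : Even N) (hN2 : 2 ≤ N) {u y : ℝ} (hu : 0 < u) (hy : 0 ≤ y) :
    rayIntegral (contourArg N) (contourIntegrand N u y) =
      rayIntegral (Real.pi / N) (contourIntegrand N u y) := by
  have hφ := contourArg_pos hN2
  have hle := contourArg_le hN2
  refine rayIntegral_eq_rayIntegral hle (fun w _ => ?_)
    (b := fun r => coeffNorm N * (r ^ (N / 2 + 1) * Real.exp (-(u / 2 * r ^ N)))) (fun w hw => ?_) ?_ ?_
    (integrableOn_contourIntegrand hN hN2 (le_abs_self _) (by rwa [abs_of_pos hφ]) hu hy)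
    (integrableOn_contourIntegrand hN hN2 (hle.trans (le_abs_self _))
      (abs_of_pos (hφ.trans_le hle)).le hu hy)
  · unfold contourIntegrand; fun_prop
  · have hw0 : 0 ≤ w.im := hφ.le.trans hw.1
    have h := norm_contourIntegrand_le_of_abs_le hN hN2 (ψ := w.im) (by rw [abs_of_nonneg hw0]; exact hw.1)
      (by rw [abs_of_nonneg hw0]; exact hw.2) (Real.exp_pos w.re).le hu.le hy
    rw [← exp_ofReal_add_mul_I, Complex.re_add_im] at h
    calc _ ≤ _ := mul_le_mul_of_nonneg_right h (Real.exp_pos _).le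
      _ = _ := by ring
  · have h : Continuous fun r : ℝ => coeffNorm N * (r ^ (N / 2 + 1) * Real.exp (-(u / 2 * r ^ N))) := by
      fun_prop
    have h' := (h.tendsto 0).mono_left (nhdsWithin_le_nhds (s := Set.Ioi 0))
    simpa using h'
  · simpa using (tendsto_pow_mul_exp_neg hN2 (N / 2 + 1) (half_pos hu)).const_mul (coeffNorm N)

theorem ofReal_sojournKernel_eq (hN : Even N) (hN2 : 2 ≤ N) {u y : ℝ} (hu : 0 < u) (hy : 0 < y) :
    (sojournKernel N u y : ℂ) = N / (2 * Real.pi * Complex.I) *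
      (rayIntegral (Real.pi / N) (contourIntegrand N u y) -
        rayIntegral (-(Real.pi / N)) (contourIntegrand N u y)) := by
  rw [sojournKernel, if_pos hy, rayIntegral_contourArg hN hN2 hu hy.le, ofReal_mul_im hN2]

/-- The Laplace transform in `y` of the kernel `q_s(y)`. -/
def halfLaplace (N : ℕ) (s : ℝ) (c : ℂ) : ℂ :=
  ∫ y, Complex.exp (-(c * y)) * (sojournKernel N s y : ℂ) ∂halfLine

theorem integrable_sojournKernel (hN : Even N) (hN2 : 2 ≤ N) {s : ℝ} (hs : 0 < s) :
    Integrable (sojournKernel N s) halfLine :=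
  (integrable_kernelBound hN2 hs).mono' (aestronglyMeasurable_sojournKernel hN hN2 hs).restrict
    ((ae_restrict_iff' measurableSet_Ioi).2 (Eventually.of_forall fun _ hy =>
      abs_sojournKernel_le hN hN2 hs le_rfl (le_of_lt hy)))

theorem norm_exp_neg_mul_le_one {c : ℂ} (hc : 0 ≤ c.re) {y : ℝ} (hy : 0 ≤ y) :
    ‖Complex.exp (-(c * y))‖ ≤ 1 := by
  rw [Complex.norm_exp, Real.exp_le_one_iff, Complex.neg_re, Complex.re_mul_ofReal]
  have := mul_nonneg hc hy
  linarith

theorem integrable_exp_mul_sojournKernel (hN : Even N) (hN2 : 2 ≤ N) {s : ℝ} {c : ℂ} (hs : 0 < s)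
    (hc : 0 ≤ c.re) :
    Integrable (fun y : ℝ => Complex.exp (-(c * y)) * (sojournKernel N s y : ℂ)) halfLine :=
  (integrable_ofReal_comp (integrable_sojournKernel hN hN2 hs)).bdd_mul (c := 1)
    (Continuous.aestronglyMeasurable (by fun_prop))
    ((ae_restrict_iff' measurableSet_Ioi).2 (Eventually.of_forall fun _ hy =>
      norm_exp_neg_mul_le_one hc (le_of_lt hy)))

/-- Upgrades the a.e. identity given by Laplace uniqueness to one for every `s > 0`. -/
theorem continuousOn_halfLaplace (hN : Even N) (hN2 : 2 ≤ N) {c : ℂ} (hc : 0 ≤ c.re) :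
    ContinuousOn (fun s => halfLaplace N s c) (Set.Ioi 0) := by
  intro s₀ hs₀
  have hs₀ : 0 < s₀ := hs₀
  refine ContinuousAt.continuousWithinAt ?_
  have ev : ∀ᶠ s in 𝓝 s₀, s₀ / 2 < s := lt_mem_nhds (half_lt_self hs₀)
  refine continuousAt_of_dominated (bound := kernelBound N (s₀ / 2)) ?_ ?_
    (integrable_kernelBound hN2 (half_pos hs₀)) ?_
  · filter_upwards [ev] with s hs
    exact (integrable_exp_mul_sojournKernel hN hN2 ((half_pos hs₀).trans hs) hc).aestronglyMeasurable
  · filter_upwards [ev] with s hs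
    refine (ae_restrict_iff' measurableSet_Ioi).2 (Eventually.of_forall fun y hy => ?_)
    have hy : 0 < y := hy
    rw [norm_mul, Complex.norm_real]
    exact (mul_le_of_le_one_left (norm_nonneg _) (norm_exp_neg_mul_le_one hc hy.le)).trans
      (abs_sojournKernel_le hN hN2 (half_pos hs₀) hs.le hy.le)
  · refine (ae_restrict_iff' measurableSet_Ioi).2 (Eventually.of_forall fun y hy => ?_)
    have c1 := (continuousAt_sojournKernel hN hN2 hs₀ (ne_of_gt hy)).comp (x := s₀)
      (f := fun s : ℝ => (s, y)) (by fun_prop)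
    exact continuousAt_const.mul (Complex.continuous_ofReal.continuousAt.comp c1)

/-- The integrand of the contour integral for the density on the negative half line. -/
def densityContour (N : ℕ) (u s x : ℝ) (ζ : ℂ) : ℂ :=
  ζ ^ (N / 2) * Complex.exp (u * ζ ^ N) *
    ∑ θ ∈ rootsJ N, coeffA N θ * θ * (Complex.exp (θ * ζ * x) * halfLaplace N s (θ * ζ))

/-- Since `x ≤ 0`, the argument `y - x` is positive for all `y > 0`, and Fubini applies on the whole
half-line. The factorization `e^{-θζ(y-x)} = e^{θζx} e^{-θζy}` then leaves the Laplace transform of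
`q_s` at `θζ`. -/
theorem integral_mul_rayIntegral (hN : Even N) (hN2 : 2 ≤ N) {ψ u s x : ℝ}
    (hψ : |ψ| = Real.pi / N) (hu : 0 < u) (hs : 0 < s) (hx : x ≤ 0) :
    Integrable (fun y => (sojournKernel N s y : ℂ) * rayIntegral ψ (contourIntegrand N u (y - x)))
      halfLine ∧
    ∫ y, (sojournKernel N s y : ℂ) * rayIntegral ψ (contourIntegrand N u (y - x)) ∂halfLine =
      rayIntegral ψ (densityContour N u s x) := by
  have h1 : contourArg N ≤ |ψ| := hψ ▸ contourArg_le hN2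
  have hq := integrable_sojournKernel hN hN2 hs
  have hi : Integrable (fun p : ℝ × ℝ => (sojournKernel N s p.1 : ℂ) *
      (contourIntegrand N u (p.1 - x) (p.2 * Complex.exp (ψ * Complex.I)) *
        Complex.exp (ψ * Complex.I))) (halfLine.prod halfLine) := by
    refine (hq.norm.mul_prod ((integrable_pow_mul_exp_neg hN2 (N / 2) (half_pos hu)).const_mul
      (coeffNorm N))).mono' ?_ ?_
    · refine (Complex.continuous_ofReal.comp_aestronglyMeasurable
        hq.aestronglyMeasurable.comp_fst).mul (Continuous.aestronglyMeasurable ?_)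
      unfold contourIntegrand; fun_prop
    · filter_upwards [ae_halfLine_prod] with p hp
      rw [norm_mul, norm_mul, Complex.norm_exp_ofReal_mul_I, mul_one, Complex.norm_real]
      exact mul_le_mul_of_nonneg_left (norm_contourIntegrand_le_of_abs_le hN hN2 h1 hψ.le hp.2.le
        hu.le (by linarith [hp.1])) (norm_nonneg _)
  refine ⟨hi.integral_prod_left.congr (Eventually.of_forall fun y => by
    simp only [rayIntegral, integral_const_mul]), ?_⟩
  have h := (integral_prod _ hi).symm.trans (integral_prod_symm _ hi)
  simp only [integral_const_mul] at h
  refine h.trans (setIntegral_congr_fun measurableSet_Ioi fun r hr => ?_)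
  have hr : (0 : ℝ) < r := hr
  set ζ := (r : ℂ) * Complex.exp (ψ * Complex.I) with hζ
  have hre : ∀ θ ∈ rootsJ N, 0 ≤ (θ * ζ).re := fun θ hθ => by
    have := re_mul_polar_add_ge hr.le (c := 0) (by simp) (re_mul_exp_nonneg hN hN2 hθ hψ.le)
    rwa [zero_mul, add_zero] at this
  have e : ∀ y : ℝ, (sojournKernel N s y : ℂ) *
      (contourIntegrand N u (y - x) ζ * Complex.exp (ψ * Complex.I)) =
      ζ ^ (N / 2) * Complex.exp (u * ζ ^ N) * Complex.exp (ψ * Complex.I) *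
        ∑ θ ∈ rootsJ N, coeffA N θ * θ * Complex.exp (θ * ζ * x) *
          (Complex.exp (-(θ * ζ * y)) * (sojournKernel N s y : ℂ)) := by
    intro y
    have e1 : ∀ θ : ℂ, Complex.exp (-(θ * ζ * (y - x : ℝ))) =
        Complex.exp (θ * ζ * x) * Complex.exp (-(θ * ζ * y)) := by
      intro θ
      rw [← Complex.exp_add]
      push_cast
      ring_nf
    simp only [contourIntegrand, e1, ← mul_assoc]
    rw [← Finset.sum_mul]
    ring
  simp only [e]
  rw [integral_const_mul, integral_finsetSum _ fun θ hθ =>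
    (integrable_exp_mul_sojournKernel hN hN2 hs (hre θ hθ)).const_mul _]
  simp only [integral_const_mul, densityContour, halfLaplace, mul_assoc]
  ring

theorem ofReal_jointDensity (hN : Even N) (hN2 : 2 ≤ N) {t s x : ℝ} (hs : 0 < s) (hst : s < t)
    (hx : x ≤ 0) : (jointDensity N t s x : ℂ) = N / (2 * Real.pi * Complex.I) *
      (rayIntegral (Real.pi / N) (densityContour N (t - s) s x) -
        rayIntegral (-(Real.pi / N)) (densityContour N (t - s) s x)) := by
  have hu : 0 < t - s := sub_pos.2 hst
  have hψ : |Real.pi / N| = Real.pi / N := abs_of_nonneg (by have := Real.pi_pos; positivity)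
  have h1 := integral_mul_rayIntegral hN hN2 hψ hu hs hx
  have h2 := integral_mul_rayIntegral hN hN2 (ψ := -(Real.pi / N)) (by rwa [abs_neg]) hu hs hx
  have h0 : jointDensity N t s x = ∫ y, sojournKernel N s y * sojournKernel N (t - s) (y - x)
      ∂halfLine := by
    rw [jointDensity, ← integral_indicator measurableSet_Ioi]
    congr 1
    ext y
    by_cases hy : y ∈ Set.Ioi (0 : ℝ)
    · rw [Set.indicator_of_mem hy]
    · rw [Set.indicator_of_notMem hy, sojournKernel_of_nonpos _ (not_lt.1 hy), zero_mul]
  rw [h0, ← integral_complex_ofReal, ← h1.2, ← h2.2, ← integral_sub h1.1 h2.1, ← integral_const_mul]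
  refine setIntegral_congr_fun measurableSet_Ioi fun y hy => ?_
  have hy : 0 < y := hy
  rw [Complex.ofReal_mul, ofReal_sojournKernel_eq hN hN2 hu (y := y - x) (by linarith)]
  ring

/-! ### The Laplace transform of the kernel in terms of Mittag-Leffler functions -/

/-- The exponent `(m + #J) / N`. -/
def mittagExponent (N m : ℕ) : ℝ := ((m : ℝ) + (rootsJ N).card) / N

theorem mittagExponent_pos (hN : Even N) (hN2 : 2 ≤ N) (m : ℕ) : 0 < mittagExponent N m := by
  rw [mittagExponent, card_rootsJ hN hN2]
  have h1 : (0 : ℝ) < N := by exact_mod_cast (by omega : 0 < N)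
  have h2 : (0 : ℝ) < (N / 2 : ℕ) := by exact_mod_cast (by omega : 0 < N / 2)
  positivity

theorem natCast_eq_card_add_card (hN : Even N) (hN2 : 2 ≤ N) :
    (N : ℝ) = (rootsK N).card + (rootsJ N).card := by
  rw [card_rootsK hN hN2, card_rootsJ hN hN2]
  obtain ⟨k, rfl⟩ := hN
  have : (k + k) / 2 = k := by omega
  rw [this]
  push_cast
  ring

theorem mittagExponent_sub_one (hN : Even N) (hN2 : 2 ≤ N) (m : ℕ) :
    mittagExponent N m - 1 = ((m : ℝ) - (rootsK N).card) / N := by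
  have h1 : (N : ℝ) ≠ 0 := by exact_mod_cast (by omega : N ≠ 0)
  rw [mittagExponent, div_sub_one h1]
  congr 1
  linarith [natCast_eq_card_add_card hN hN2]

/-- Multiplying by `∏ (θa - c)` turns the denominator into `l + X`, and `prod_one_add_div_eq`
expands the numerator in powers of `c/a`. The remaining power `a^{N/2-m}` equals `l^{1-β}` with `β =
(m + #J)/N`. -/
theorem prod_inv_eq_sum (hN : Even N) (hN2 : 2 ≤ N) {c : ℂ} {X l : ℝ} (hc : c ^ N = -(kappa N * X))
    (hl : 0 < l) (hX : 0 ≤ X) :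
    (∏ θ ∈ rootsJ N, (θ * (l ^ (1 / N : ℝ) : ℝ) + c))⁻¹ =
      ∑ m ∈ Finset.range ((rootsK N).card + 1), alpha N (-(m : ℤ)) * (-c) ^ m *
        ((l ^ (1 - mittagExponent N m) / (l + X) : ℝ) : ℂ) := by
  set a : ℝ := l ^ (1 / N : ℝ) with ha
  have ha0 : 0 < a := Real.rpow_pos_of_pos hl _
  have haC : (a : ℂ) ≠ 0 := by exact_mod_cast ha0.ne'
  have hlX : ((l + X : ℝ) : ℂ) ≠ 0 := by
    have : l + X ≠ 0 := by positivity
    exact_mod_cast this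
  have haN : (a : ℂ) ^ N = l := by
    rw [← Complex.ofReal_pow, ha, rpow_inv_pow hN2 hl]
  have hk : ((-1 : ℂ) ^ (N / 2)) * (kappa N : ℂ) = -1 := by
    rw [kappa_eq]
    push_cast
    rw [mul_neg, ← mul_pow]
    simp
  have h1 := prod_rootsJ_mul hN hN2 (a : ℂ) c
  rw [Finset.prod_mul_distrib, haN, hc] at h1
  have h2 : (∏ θ ∈ rootsJ N, (θ * (a : ℂ) - c)) * ∏ θ ∈ rootsJ N, (θ * (a : ℂ) + c) =
      ((l + X : ℝ) : ℂ) := by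
    rw [h1]
    push_cast
    linear_combination (-(X : ℂ)) * hk
  have h3 : ∏ θ ∈ rootsJ N, (θ * (a : ℂ) - c) = (a : ℂ) ^ (N / 2) *
      ∑ m ∈ Finset.range ((rootsK N).card + 1), alpha N (-(m : ℤ)) * (-c / a) ^ m := by
    rw [← prod_one_add_div_eq hN hN2, ← card_rootsJ hN hN2, ← Finset.prod_const,
      ← Finset.prod_mul_distrib]
    have h4 : ∏ θ ∈ rootsJ N, (θ * (a : ℂ) - c) =
        ∏ θ ∈ rootsJ N, θ * ((a : ℂ) * (1 + θ⁻¹ * (-c / a))) := by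
      refine Finset.prod_congr rfl fun θ hθ => ?_
      have := rootsJ_ne_zero hN2 hθ
      field_simp
      ring
    rw [h4, Finset.prod_mul_distrib, prod_rootsJ hN2, one_mul]
  have hp : ∏ θ ∈ rootsJ N, (θ * (a : ℂ) + c) ≠ 0 := fun h => by
    rw [h, mul_zero] at h2
    exact hlX h2.symm
  have h5 : (∏ θ ∈ rootsJ N, (θ * (a : ℂ) + c))⁻¹ =
      (∏ θ ∈ rootsJ N, (θ * (a : ℂ) - c)) / ((l + X : ℝ) : ℂ) := by
    rw [eq_div_iff hlX, ← h2, inv_mul_eq_iff_eq_mul₀ hp, mul_comm]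
  rw [h5, h3, Finset.mul_sum, Finset.sum_div]
  refine Finset.sum_congr rfl fun m hm => ?_
  have hm' : m ≤ N / 2 := by
    rw [Finset.mem_range, card_rootsK hN hN2, card_rootsJ hN hN2] at hm
    omega
  have h6 : l ^ (1 - mittagExponent N m) = a ^ (N / 2 - m) := by
    rw [ha, ← Real.rpow_natCast, ← Real.rpow_mul hl.le]
    congr 1
    have h7 := mittagExponent_sub_one hN hN2 m
    have h8 : ((N / 2 - m : ℕ) : ℝ) = ((rootsK N).card : ℝ) - m := by
      rw [Nat.cast_sub hm', card_rootsK hN hN2, card_rootsJ hN hN2]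
    rw [h8]
    linear_combination -h7
  have h9 : (a : ℂ) ^ (N / 2) = (a : ℂ) ^ (N / 2 - m) * (a : ℂ) ^ m := by
    rw [← pow_add]; congr 1; omega
  rw [h6, h9, div_pow]
  push_cast at hlX ⊢
  field_simp

/-- Both sides have Laplace transform `1 / ∏ (θ l^{1/N} + c)` in `s`, the right one because
`l^{1-β}/(l+X)` is the transform of `s^{β-1} E_{1,β}(-sX)`. -/
theorem halfLaplace_eq (hN : Even N) (hN2 : 2 ≤ N) {c : ℂ} {X : ℝ} (hcre : 0 ≤ c.re)
    (hc : c ^ N = -(kappa N * X)) (hX : 0 ≤ X) {s : ℝ} (hs : 0 < s) :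
    halfLaplace N s c = ∑ m ∈ Finset.range ((rootsK N).card + 1), alpha N (-(m : ℤ)) * (-c) ^ m *
      (((s ^ (mittagExponent N m - 1) : ℝ) : ℂ) *
        mittagLeffler 1 (mittagExponent N m) ((-s * X : ℝ) : ℂ)) := by
  set R : ℝ → ℂ := fun s => ∑ m ∈ Finset.range ((rootsK N).card + 1),
    alpha N (-(m : ℤ)) * (-c) ^ m * (((s ^ (mittagExponent N m - 1) : ℝ) : ℂ) *
      mittagLeffler 1 (mittagExponent N m) ((-s * X : ℝ) : ℂ)) with hR
  have hβ := fun m => mittagExponent_pos hN hN2 m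
  have hLi : ∀ l : ℝ, 0 < l →
      IntegrableOn (fun s : ℝ => Complex.exp (-(l * s)) * halfLaplace N s c) (Set.Ioi 0) ∧
      ∫ s in Set.Ioi (0 : ℝ), Complex.exp (-(l * s)) * halfLaplace N s c =
        (∏ θ ∈ rootsJ N, (θ * (l ^ (1 / N : ℝ) : ℝ) + c))⁻¹ := by
    intro l hl
    have hi := integrable_laplace_sojournKernel hN hN2 hl hcre
    have h := integral_laplace_sojournKernel hN hN2 (Real.rpow_pos_of_pos hl (1 / N : ℝ)) hcre
    rw [rpow_inv_pow hN2 hl, integral_prod _ hi] at h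
    have hi' := hi.integral_prod_left
    simp only [mul_assoc, integral_const_mul] at h hi'
    exact ⟨hi', h⟩
  have hRe : ∀ l s : ℝ, Complex.exp (-(l * s)) * R s =
      ∑ m ∈ Finset.range ((rootsK N).card + 1), alpha N (-(m : ℤ)) * (-c) ^ m *
        (Complex.exp (-(l * s)) * (((s ^ (mittagExponent N m - 1) : ℝ) : ℂ) *
          mittagLeffler 1 (mittagExponent N m) ((-s * X : ℝ) : ℂ))) := by
    intro l s
    rw [hR, Finset.mul_sum]
    refine Finset.sum_congr rfl fun m _ => ?_
    ring
  have hRi : ∀ l : ℝ, X < l →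
      IntegrableOn (fun s : ℝ => Complex.exp (-(l * s)) * R s) (Set.Ioi 0) ∧
      ∫ s in Set.Ioi (0 : ℝ), Complex.exp (-(l * s)) * R s =
        (∏ θ ∈ rootsJ N, (θ * (l ^ (1 / N : ℝ) : ℝ) + c))⁻¹ := by
    intro l hl
    have hl0 : 0 < l := hX.trans_lt hl
    have hi := fun m => (integrable_laplace_mittagLeffler (hβ m) hX hl0).const_mul
      (alpha N (-(m : ℤ)) * (-c) ^ m)
    simp only [hRe]
    refine ⟨integrable_finsetSum _ fun m _ => hi m, ?_⟩
    rw [integral_finsetSum _ fun m _ => hi m, prod_inv_eq_sum hN hN2 hc hl0 hX]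
    refine Finset.sum_congr rfl fun m _ => ?_
    rw [integral_const_mul, integral_laplace_mittagLeffler (hβ m) hX hl]
  have hXl : ∀ n : ℕ, X < X + 1 + n := fun n => by
    have : (0 : ℝ) ≤ n := Nat.cast_nonneg n
    linarith
  -- The Mittag-Leffler transforms are known for `l > X` only, so both sides are tested at `l = X +
  -- 1 + n`; the factor `e^{-(X+1)s}` also provides integrability.
  have hz := ae_eq_zero_of_laplace (g := fun s : ℝ =>
    Complex.exp (-((X + 1 : ℝ) * s)) * (halfLaplace N s c - R s))
    (by
      simp only [mul_sub]
      exact (hLi _ (by linarith)).1.sub (hRi _ (by linarith)).1)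
    (fun n => by
      have hn := hXl n
      have e : ∀ s : ℝ, Complex.exp (-(n : ℂ) * s) *
          (Complex.exp (-((X + 1 : ℝ) * s)) * (halfLaplace N s c - R s)) =
          Complex.exp (-((X + 1 + n : ℝ) * s)) * halfLaplace N s c -
          Complex.exp (-((X + 1 + n : ℝ) * s)) * R s := by
        intro s
        rw [← mul_assoc, ← Complex.exp_add, ← mul_sub]
        congr 2
        push_cast
        ring
      simp only [e]
      rw [integral_sub (hLi _ (hX.trans_lt hn)).1 (hRi _ hn).1, (hLi _ (hX.trans_lt hn)).2,
        (hRi _ hn).2, sub_self])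
  have hae : (fun s => halfLaplace N s c) =ᵐ[volume.restrict (Set.Ioi 0)] R := by
    filter_upwards [hz] with s h
    rw [Pi.zero_apply, mul_eq_zero, or_iff_right (Complex.exp_ne_zero _), sub_eq_zero] at h
    exact h
  have hRc : ContinuousOn R (Set.Ioi 0) := by
    refine continuousOn_finsetSum _ fun m _ => continuousOn_const.mul (ContinuousOn.mul ?_ ?_)
    · exact Complex.continuous_ofReal.comp_continuousOn fun s hs =>
        (Real.continuousAt_rpow_const _ _ (Or.inl (ne_of_gt hs))).continuousWithinAt
    · exact ((continuous_mittagLeffler (hβ m)).comp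
        (Complex.continuous_ofReal.comp (by fun_prop))).continuousOn
  exact Measure.eqOn_open_of_ae_eq hae isOpen_Ioi (continuousOn_halfLaplace hN hN2 hcre) hRc hs

end NegativeHalfLine

/-! ### The integral formula for the density -/

section Formula

variable {N : ℕ}

/-- The contribution of the ray of argument `ψ` to the function `kernelK`. -/
def rayKernel (N m : ℕ) (ψ z : ℝ) : ℂ :=
  Complex.exp ((N / 2 + 1 + m : ℕ) * (ψ * Complex.I)) *
    ∑ θ ∈ rootsJ N, coeffA N θ * θ * (-θ) ^ m * Complex.exp (θ * Complex.exp (ψ * Complex.I) * z)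

/-- The contribution of the ray of argument `ψ` to the integrand of the density. -/
def rayIntegrand (N m : ℕ) (ψ t s x ξ : ℝ) : ℂ :=
  (ξ : ℂ) ^ (m + (rootsJ N).card) * (Real.exp (-(t - s) * ξ ^ N) : ℂ) * rayKernel N m ψ (x * ξ) *
    mittagLeffler 1 (mittagExponent N m) ((-s * ξ ^ N : ℝ) : ℂ)

/-- As `#K = N/2`, the angle `(N/2 + 1 + m)π/N` equals `π - (#K - m - 1)π/N`, and the extra `π`
accounts for the sign. -/
theorem neg_exp_eq (hN : Even N) (hN2 : 2 ≤ N) (m : ℕ) {ε : ℂ} (hε : ε = 1 ∨ ε = -1) :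
    -Complex.exp (-(ε * Complex.I) * ((((rootsK N).card : ℂ) - m - 1) / N) * Real.pi) =
      Complex.exp ((N / 2 + 1 + m : ℕ) * (ε * (Real.pi / N) * Complex.I)) := by
  have hN0 : (N : ℂ) ≠ 0 := by exact_mod_cast (by omega : N ≠ 0)
  have h1 : ((N / 2 : ℕ) : ℂ) = N / 2 := by
    obtain ⟨k, rfl⟩ := hN
    have : (k + k) / 2 = k := by omega
    rw [this]
    push_cast
    ring
  have h2 : ((N / 2 + 1 + m : ℕ) : ℂ) * (ε * (Real.pi / N) * Complex.I) =
      -(ε * Complex.I) * ((((rootsK N).card : ℂ) - m - 1) / N) * Real.pi +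
        ε * (Real.pi * Complex.I) := by
    rw [card_rootsK hN hN2, card_rootsJ hN hN2]
    push_cast [h1]
    field_simp
    ring
  have h3 : Complex.exp (ε * (Real.pi * Complex.I)) = -1 := by
    rcases hε with rfl | rfl
    · rw [one_mul, Complex.exp_pi_mul_I]
    · rw [neg_one_mul, Complex.exp_neg, Complex.exp_pi_mul_I]
      norm_num
  rw [h2, Complex.exp_add, h3]
  ring

/-- The phases in `rayKernel` collect `ζ^{N/2}`, `dζ` and `(θζ)^m` along each ray. Passing from `K`
to `J = -K` changes the sign of `θ^{m+1}`, which cancels the sign in `neg_exp_eq`. -/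
theorem kernelK_eq (hN : Even N) (hN2 : 2 ≤ N) (m : ℕ) (z : ℝ) :
    kernelK N m z = rayKernel N m (Real.pi / N) z - rayKernel N m (-(Real.pi / N)) z := by
  have e1 := neg_exp_eq hN hN2 m (ε := 1) (Or.inl rfl)
  have e2 := neg_exp_eq hN hN2 m (ε := -1) (Or.inr rfl)
  have e3 : ∀ w : ℂ, ∑ θ ∈ rootsK N, coeffB N θ * θ ^ (m + 1) * Complex.exp (-θ * w * z) =
      -∑ θ ∈ rootsJ N, coeffA N θ * θ * (-θ) ^ m * Complex.exp (θ * w * z) := by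
    intro w
    rw [sum_rootsK hN hN2, ← Finset.sum_neg_distrib]
    refine Finset.sum_congr rfl fun θ _ => ?_
    rw [coeffB_neg hN hN2, neg_neg, pow_succ]
    ring
  simp only [one_mul, neg_mul, neg_neg] at e1 e2
  rw [kernelK, e3, e3, rayKernel, rayKernel]
  push_cast
  push_cast at e1 e2
  simp only [neg_mul] at e1 e2 ⊢
  rw [← e1, ← e2, mul_comm (Real.pi / N : ℂ) Complex.I]
  ring

theorem densityIntegrand_eq (hN : Even N) (hN2 : 2 ≤ N) (m : ℕ) (t s x ξ : ℝ) :
    densityIntegrand N m t s x ξ =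
      rayIntegrand N m (Real.pi / N) t s x ξ - rayIntegrand N m (-(Real.pi / N)) t s x ξ := by
  rw [densityIntegrand, kernelK_eq hN hN2, rayIntegrand, rayIntegrand, mittagExponent]
  ring

theorem norm_rayKernel_le (hN : Even N) (hN2 : 2 ≤ N) (m : ℕ) {ψ z : ℝ} (hψ : |ψ| ≤ Real.pi / N)
    (hz : z ≤ 0) : ‖rayKernel N m ψ z‖ ≤ coeffNorm N := by
  have h1 : ((N / 2 + 1 + m : ℕ) : ℂ) * (ψ * Complex.I) =
      (((N / 2 + 1 + m : ℕ) * ψ : ℝ) : ℂ) * Complex.I := by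
    push_cast; ring
  rw [rayKernel, norm_mul, h1, Complex.norm_exp_ofReal_mul_I, one_mul, coeffNorm]
  refine norm_sum_le_of_le _ fun θ hθ => ?_
  rw [norm_mul, norm_mul _ ((-θ) ^ m), norm_pow, norm_neg, norm_of_mem_rootsJ hN2 hθ, one_pow,
    mul_one]
  refine mul_le_of_le_one_right (norm_nonneg _) ?_
  rw [Complex.norm_exp, Real.exp_le_one_iff, Complex.re_mul_ofReal]
  exact mul_nonpos_of_nonneg_of_nonpos (re_mul_exp_nonneg hN hN2 hθ hψ) hz

theorem integrableOn_rayIntegrand (hN : Even N) (hN2 : 2 ≤ N) (m : ℕ) {ψ t s x : ℝ}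
    (hψ : |ψ| ≤ Real.pi / N) (hs : 0 < s) (hst : s < t) (hx : x ≤ 0) :
    IntegrableOn (rayIntegrand N m ψ t s x) (Set.Ioi 0) := by
  have hβ := mittagExponent_pos hN hN2 m
  have hu : 0 < t - s := sub_pos.2 hst
  obtain ⟨C, hC0, hC⟩ := exists_norm_mittagLeffler_le hβ
  set k := m + (rootsJ N).card with hk
  refine (((integrable_pow_mul_exp_neg hN2 k hu).add
    ((integrable_pow_mul_exp_neg hN2 (k + N) hu).const_mul s)).const_mul (coeffNorm N * C)).mono' ?_
    ((ae_restrict_iff' measurableSet_Ioi).2 (Eventually.of_forall fun ξ hξ => ?_))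
  · refine Continuous.aestronglyMeasurable ?_
    have h1 : Continuous fun ξ : ℝ =>
        mittagLeffler 1 (mittagExponent N m) ((-s * ξ ^ N : ℝ) : ℂ) :=
      (continuous_mittagLeffler hβ).comp (Complex.continuous_ofReal.comp (by fun_prop))
    have h2 : Continuous fun ξ : ℝ => rayKernel N m ψ (x * ξ) := by unfold rayKernel; fun_prop
    unfold rayIntegrand
    exact (Continuous.mul (by fun_prop) h2).mul h1
  · have hξ : 0 < ξ := hξ
    have h1 := norm_rayKernel_le hN hN2 m hψ (mul_nonpos_of_nonpos_of_nonneg hx hξ.le)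
    have h2 := hC (s * ξ ^ N) (by positivity)
    have h3 := coeffNorm_nonneg (N := N)
    rw [rayIntegrand, norm_mul, norm_mul, norm_mul, norm_pow, Complex.norm_real, Complex.norm_real,
      Real.norm_of_nonneg hξ.le, Real.norm_of_nonneg (Real.exp_pos _).le, neg_mul, neg_mul]
    calc _ ≤ ξ ^ k * Real.exp (-((t - s) * ξ ^ N)) * coeffNorm N * (C * (1 + s * ξ ^ N)) := by
          gcongr
      _ = _ := by
        simp only [Pi.add_apply, pow_add]
        ring

/-- On these rays `ζᴺ = -rᴺ`, so every `c = θζ` satisfies `cᴺ = -κrᴺ` and `halfLaplace_eq` applies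
with the same `X = rᴺ` for all `θ`. The Mittag-Leffler factors then come out of the sum over `θ`. -/
theorem densityContour_mul_exp (hN : Even N) (hN2 : 2 ≤ N) {ψ t s x r : ℝ}
    (hψ : |ψ| = Real.pi / N) (hs : 0 < s) (hr : 0 < r) :
    densityContour N (t - s) s x (r * Complex.exp (ψ * Complex.I)) * Complex.exp (ψ * Complex.I) =
      ∑ m ∈ Finset.range ((rootsK N).card + 1), alpha N (-(m : ℤ)) *
        ((s ^ (((m : ℝ) - (rootsK N).card) / N) : ℝ) : ℂ) * rayIntegrand N m ψ t s x r := by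
  set w := Complex.exp (ψ * Complex.I) with hw
  have hN0 : (N : ℝ) ≠ 0 := by exact_mod_cast (by omega : N ≠ 0)
  have hwN : w ^ N = -1 := by
    rw [hw, ← Complex.exp_nat_mul]
    rcases (abs_eq (hψ ▸ abs_nonneg ψ)).1 hψ with h | h
    · have e : (N : ℂ) * (ψ * Complex.I) = Real.pi * Complex.I := by
        rw [h]
        push_cast
        have : (N : ℂ) ≠ 0 := by exact_mod_cast hN0
        field_simp
      rw [e, Complex.exp_pi_mul_I]
    · have e : (N : ℂ) * (ψ * Complex.I) = -(Real.pi * Complex.I) := by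
        rw [h]
        push_cast
        have : (N : ℂ) ≠ 0 := by exact_mod_cast hN0
        field_simp
      rw [e, Complex.exp_neg, Complex.exp_pi_mul_I]
      norm_num
  have hH : ∀ θ ∈ rootsJ N, halfLaplace N s (θ * (r * w)) =
      ∑ m ∈ Finset.range ((rootsK N).card + 1), alpha N (-(m : ℤ)) * (-(θ * (r * w))) ^ m *
        (((s ^ (mittagExponent N m - 1) : ℝ) : ℂ) *
          mittagLeffler 1 (mittagExponent N m) ((-s * r ^ N : ℝ) : ℂ)) := by
    intro θ hθ
    refine halfLaplace_eq hN hN2 ?_ ?_ (by positivity) hs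
    · rw [mul_left_comm, Complex.re_ofReal_mul]
      exact mul_nonneg hr.le (re_mul_exp_nonneg hN hN2 hθ hψ.le)
    · rw [mul_pow, mul_pow, hwN, ((mem_rootsJ hN2).1 hθ).1]
      push_cast
      ring
  have hsum : ∑ θ ∈ rootsJ N, coeffA N θ * θ * (Complex.exp (θ * (r * w) * x) *
        halfLaplace N s (θ * (r * w))) =
      ∑ m ∈ Finset.range ((rootsK N).card + 1), alpha N (-(m : ℤ)) *
        (((s ^ (mittagExponent N m - 1) : ℝ) : ℂ) *
          mittagLeffler 1 (mittagExponent N m) ((-s * r ^ N : ℝ) : ℂ)) * (r * w) ^ m *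
        ∑ θ ∈ rootsJ N, coeffA N θ * θ * (-θ) ^ m * Complex.exp (θ * w * (x * r : ℝ)) := by
    simp only [Finset.mul_sum]
    rw [Finset.sum_comm]
    refine Finset.sum_congr rfl fun θ hθ => ?_
    rw [hH θ hθ, Finset.mul_sum, Finset.mul_sum]
    refine Finset.sum_congr rfl fun m _ => ?_
    have e : θ * (r * w) * x = θ * w * (x * r : ℝ) := by push_cast; ring
    rw [e, ← neg_mul, mul_pow]
    ring
  rw [densityContour, hsum, mul_pow _ w N, hwN, Finset.mul_sum, Finset.sum_mul]
  refine Finset.sum_congr rfl fun m _ => ?_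
  have e1 : Complex.exp ((N / 2 + 1 + m : ℕ) * (ψ * Complex.I)) = w ^ (N / 2) * w * w ^ m := by
    rw [Complex.exp_nat_mul, ← hw, pow_add, pow_add, pow_one]
  have e2 : (Real.exp (-(t - s) * r ^ N) : ℂ) =
      Complex.exp (((t - s : ℝ) : ℂ) * ((r : ℂ) ^ N * -1)) := by
    rw [Complex.ofReal_exp]
    push_cast
    ring_nf
  rw [rayIntegrand, rayKernel, e1, e2, ← hw, mittagExponent_sub_one hN hN2, card_rootsJ hN hN2,
    pow_add, mul_pow, mul_pow]
  ring

theorem rayIntegral_densityContour (hN : Even N) (hN2 : 2 ≤ N) {ψ t s x : ℝ}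
    (hψ : |ψ| = Real.pi / N) (hs : 0 < s) (hst : s < t) (hx : x ≤ 0) :
    rayIntegral ψ (densityContour N (t - s) s x) =
      ∑ m ∈ Finset.range ((rootsK N).card + 1), alpha N (-(m : ℤ)) *
        ((s ^ (((m : ℝ) - (rootsK N).card) / N) : ℝ) : ℂ) *
          ∫ ξ in Set.Ioi (0 : ℝ), rayIntegrand N m ψ t s x ξ := by
  rw [rayIntegral, setIntegral_congr_fun measurableSet_Ioi fun r hr =>
    densityContour_mul_exp hN hN2 (t := t) (x := x) hψ hs hr,
    integral_finsetSum _ fun m _ => (integrableOn_rayIntegrand hN hN2 m hψ.le hs hst hx).const_mul _]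
  simp only [integral_const_mul]

theorem abs_pi_div (N : ℕ) : |Real.pi / N| = Real.pi / N :=
  abs_of_nonneg (by have := Real.pi_pos; positivity)

theorem integrableOn_densityIntegrand (hN : Even N) (hN2 : 2 ≤ N) (m : ℕ) {t s x : ℝ}
    (hs : 0 < s) (hst : s < t) (hx : x ≤ 0) :
    IntegrableOn (densityIntegrand N m t s x) (Set.Ioi 0) := by
  rw [funext (densityIntegrand_eq hN hN2 m t s x)]
  exact (integrableOn_rayIntegrand hN hN2 m (abs_pi_div N).le hs hst hx).sub
    (integrableOn_rayIntegrand hN hN2 m (by rw [abs_neg, abs_pi_div]) hs hst hx)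

theorem jointDensity_eq (hN : Even N) (hN2 : 2 ≤ N) {t s x : ℝ} (hs : 0 < s) (hst : s < t)
    (hx : x ≤ 0) : (jointDensity N t s x : ℂ) = -((N : ℂ) * Complex.I / (2 * Real.pi)) *
      ∑ m ∈ Finset.range ((rootsK N).card + 1), alpha N (-(m : ℤ)) *
        ((s ^ (((m : ℝ) - (rootsK N).card) / N) : ℝ) : ℂ) *
          ∫ ξ in Set.Ioi (0 : ℝ), densityIntegrand N m t s x ξ := by
  have hm : |(-(Real.pi / N))| = Real.pi / N := by rw [abs_neg, abs_pi_div]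
  have hpi : (Real.pi : ℂ) ≠ 0 := by exact_mod_cast Real.pi_ne_zero
  have hc : (N : ℂ) / (2 * Real.pi * Complex.I) = -((N : ℂ) * Complex.I / (2 * Real.pi)) := by
    rw [← div_div, div_eq_iff Complex.I_ne_zero]
    linear_combination ((N : ℂ) / (2 * Real.pi)) * Complex.I_mul_I
  rw [ofReal_jointDensity hN hN2 hs hst hx,
    rayIntegral_densityContour hN hN2 (abs_pi_div N) hs hst hx,
    rayIntegral_densityContour hN hN2 hm hs hst hx, ← Finset.sum_sub_distrib, hc]
  congr 1
  refine Finset.sum_congr rfl fun m _ => ?_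
  rw [← mul_sub, ← integral_sub (integrableOn_rayIntegrand hN hN2 m (abs_pi_div N).le hs hst hx)
    (integrableOn_rayIntegrand hN hN2 m hm.le hs hst hx)]
  simp only [densityIntegrand_eq hN hN2]

end Formula

end PseudoProcess

end

theorem mainTheorem6 (N : ℕ) (hN : Even N) (hN2 : 2 ≤ N) :
    (∀ t s x : ℝ, 0 < s → s < t → x ≤ 0 → ∀ m ∈ Finset.range ((PseudoProcess.rootsK N).card + 1),
      IntegrableOn (PseudoProcess.densityIntegrand N m t s x) (Set.Ioi 0)) ∧
    ∃ f : ℝ → ℝ → ℝ → ℝ,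
      PseudoProcess.IsJointDensity N f ∧
      ContinuousOn (fun p : ℝ × ℝ × ℝ => f p.1 p.2.1 p.2.2) PseudoProcess.timeDomain ∧
      (∀ g : ℝ → ℝ → ℝ → ℝ, PseudoProcess.IsJointDensity N g →
        ∀ᵐ p : ℝ × ℝ × ℝ, p ∈ PseudoProcess.timeDomain →
          g p.1 p.2.1 p.2.2 = f p.1 p.2.1 p.2.2) ∧
      ∀ t s x : ℝ, 0 < s → s < t → x ≤ 0 →
        (f t s x : ℂ) =
          -((N : ℂ) * Complex.I / (2 * Real.pi)) *
            ∑ m ∈ Finset.range ((PseudoProcess.rootsK N).card + 1),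
              PseudoProcess.alpha N (-(m : ℤ)) *
                ((s ^ (((m : ℝ) - (PseudoProcess.rootsK N).card) / N) : ℝ) : ℂ) *
                ∫ ξ in Set.Ioi (0 : ℝ), PseudoProcess.densityIntegrand N m t s x ξ := by
  refine ⟨fun t s x hs hst hx m _ => PseudoProcess.integrableOn_densityIntegrand hN hN2 m hs hst hx,
    PseudoProcess.jointDensity N, PseudoProcess.isJointDensity_jointDensity hN hN2,
    PseudoProcess.continuousOn_jointDensity hN hN2,
    fun g hg => (PseudoProcess.isJointDensity_jointDensity hN hN2).ae_eq hg,
    fun t s x hs hst hx => PseudoProcess.jointDensity_eq hN hN2 hs hst hx⟩
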